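/- **Setting.** Let $d\ge 2$. Let $\sigma:\mathbb R^d\to\mathbb R$ be a $C^2$, rotationally invariant function vanishing outside the closed ball of radius $1/2$ centred at $0$, and let $U:\mathbb R\to\mathbb R$ be $C^\infty$ and confining: $U(Q)\to+\infty$ as $|Q|\to\infty$. For $M\ge 1$, $\alpha_*>0$ put $\alpha=\alpha_*\sqrt M$. For $p\in\mathbb R^d\setminus\{0\}$, $e=p/\|p\|$, and $\kappa=(b,Q,P)\in\mathbb R^d\times\mathbb R\times\mathbb R$ with $p\cdot b=0$, $\|b\|\le 1/2$, consider the solution $(q(t),Q(t))$ of $$\ddot q=-\alpha Q(t)\nabla\sigma(q),\qquad M\ddot Q+U'(Q)=-\alpha\,\sigma(q),$$ $$q(0)=b-\tfrac12 e,\quad \dot q(0)=p,\quad Q(0)=Q,\quad M\dot Q(0)=P,$$ up to the instant $t_+$ at which the particle exits the scatterer, i.e. the first $t\ge 0$ with $\|q(t)\|=\tfrac12$ and $q(t)\cdot\dot q(t)\ge 0$. The momentum transfer is $R_p=-\alpha\int_0^{t_+}Q(t)\nabla\sigma(q(t))\,dt$ and the energy transfer is $\Delta E=\tfrac12(\|p+R_p\|^2-\|p\|^2)$.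 Put $$L_0(\mu,\|b\|)=\int_0^\mu\sigma\big(b+(\lambda-\tfrac12)e\big)d\lambda,\qquad K_0(\mu,\|b\|)=\int_0^\mu L_0(\lambda,\|b\|)\,d\lambda,\qquad L_0(\|b\|)=L_0(1,\|b\|).$$ Let $H_M(Q,P)=\frac{P^2}{2M}+U(Q)$. Call a measurable $\hat\rho\ge 0$ *admissible for $M$* if $\rho=\hat\rho\circ H_M$ is a compactly supported probability density on $\mathbb R^2$. For such $\hat\rho$, $\overline{f}$ denotes the expectation of $f(\kappa)$ when $b$ is uniform on $\{b\perp p,\ \|b\|\le\tfrac12\}$ and $(Q,P)$ is independent of $b$ with density $\rho$. **Proposition.** Let $$\beta^{(1)}(\kappa)=\frac{P}{\sqrt M}L_0(\|b\|),\qquad \delta\beta^{(2)}(\kappa)=-\frac{L_0(\|b\|)^2}{2}.$$ There are a coefficient $\delta\beta^{(4)}(M,\kappa)$, error terms $A_2,A_4,B_3,B_5$ depending only on $(M,\|p\|,\kappa)$ (not on $\alpha_*$), and a remainder $r(\alpha_*,M,\|p\|,\kappa)$ such that the following holds. 1. For every $R>0$ there are $C,s_0>0$, depending only on $d,\sigma,U,R$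 and the choice of these functions, such that, uniformly over all $M\ge 1$ and all $\kappa$ with $\|b\|\le \frac12$, $|Q|\le R$, $|P|/\sqrt M\le R$: (a) for all $\alpha_*>0$ and all $p$ with $p\cdot b=0$ and $\|p\|\ge s_0\max(1,\sqrt{\alpha_*\sqrt M})$, the solution exists up to an exit time $t_+$, and every such solution has $$\Delta E=\alpha_*\Big(\frac{\beta^{(1)}(\kappa)}{\|p\|}+A_2+A_4\Big)+\alpha_*^2\Big(\frac{\delta\beta^{(2)}(\kappa)}{\|p\|^2}+B_3+\frac{\delta\beta^{(4)}(M,\kappa)}{\|p\|^4}+B_5\Big)+r;$$ (b) for $\|p\|\ge s_0$: $|A_2|\le CM^{-1/2}\|p\|^{-2}$, $|A_4|\le CM^{-3/2}\|p\|^{-4}$, $|B_3|\le CM^{1/2}\|p\|^{-3}$, $|B_5|\le CM^{-1/2}\|p\|^{-5}$; (c) $r=o(\alpha_*^2\sqrt M)$ as $\alpha\to 0$: for every $\varepsilon>0$ there is $\delta>0$ with $|r|\le\varepsilon\,\alpha_*^2\sqrt M$ whenever $\alpha_*\sqrt M\le\delta$ and $\|p\|\ge s_0$. 2. For every $M\ge1$,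 $p\ne0$ and $\hat\rho$ admissible for $M$, all the expectations below are of integrable functions, and $$\overline{A_2}=\overline{B_3}=0,\qquad \overline{\beta^{(1)}}=0,\qquad \overline{\delta\beta^{(2)}}=-\tfrac12\overline{L_0^2},\qquad \Sigma_1^2:=\overline{(\beta^{(1)})^2}=\frac{\overline{P^2}}{M}\,\overline{L_0^2},$$ and $\delta\beta^{(4)}$ is integrable with, if $\overline{L_0^2}\neq0$, $$\overline{\delta\beta^{(4)}}=\Sigma_1^2\left(\frac{d-3}{2}+\frac{\overline{U''}}{\overline{P^2}}\;\frac{\overline{\int_0^1 d\lambda\,\sigma\big(b+(\lambda-\frac12)e\big)\int_0^\lambda d\lambda'\,K_0(\lambda',\|b\|)}}{\overline{L_0^2}}\right).$$ -/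

import Mathlib

open MeasureTheory Set Filter Topology
open scoped ContDiff RealInnerProductSpace

namespace LorentzGas

/-- Position and momentum space of the particle, with the Euclidean norm. -/
abbrev Space (d : ℕ) := EuclideanSpace ℝ (Fin d)

/-- The parameters `κ = (b, Q, P)` of a collision: impact parameter, initial displacement and
initial momentum of the scatterer. -/
abbrev Param (d : ℕ) := Space d × ℝ × ℝ

/-- The impact parameter `b` of `κ = (b, Q, P)`. -/
def impact {d : ℕ} (κ : Param d) : Space d := κ.1

/-- The initial displacement `Q` of `κ = (b, Q, P)`. -/
def disp {d : ℕ} (κ : Param d) : ℝ := κ.2.1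

/-- The initial momentum `P` of `κ = (b, Q, P)`. -/
def mom {d : ℕ} (κ : Param d) : ℝ := κ.2.2

/-- The energy `P² / (2M) + U(Q)` of a scatterer. -/
noncomputable def hScatt (U : ℝ → ℝ) (M Q P : ℝ) : ℝ := P ^ 2 / (2 * M) + U Q

/-- The direction `e = p / ‖p‖`. -/
noncomputable def dir {d : ℕ} (p : Space d) : Space d := ‖p‖⁻¹ • p

/-- `(q, v, Q, P)` is, on the time interval `[0, T]`, the motion of the particle and of one
scatterer centred at the origin, with coupling constant `α` and mass ratio `M`:
`q'' = -α Q ∇σ(q)`, `M Q'' + U'(Q) = -α σ(q)`, written as a first order system with `v = q'` and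
`P = M Q'`. It starts with `q(0) = b - p / (2‖p‖)`, `q'(0) = p` and the scatterer in the state
`(Q, P)` given by `κ`. The time `T` is the instant at which the particle exits the scatterer: the
first time at which it is on the sphere of radius `1/2` without moving inwards. -/
structure IsCollision {d : ℕ} (σ : Space d → ℝ) (U : ℝ → ℝ) (α M : ℝ) (p : Space d) (κ : Param d)
    (q v : ℝ → Space d) (Q P : ℝ → ℝ) (T : ℝ) : Prop where
  pos_deriv : ∀ t ∈ Icc 0 T, HasDerivWithinAt q (v t) (Icc 0 T) t
  vel_deriv : ∀ t ∈ Icc 0 T,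
    HasDerivWithinAt v (-(α * Q t) • gradient σ (q t)) (Icc 0 T) t
  disp_deriv : ∀ t ∈ Icc 0 T, HasDerivWithinAt Q (P t / M) (Icc 0 T) t
  mom_deriv : ∀ t ∈ Icc 0 T,
    HasDerivWithinAt P (-deriv U (Q t) - α * σ (q t)) (Icc 0 T) t
  pos_init : q 0 = impact κ - (1 / 2 : ℝ) • dir p
  vel_init : v 0 = p
  disp_init : Q 0 = disp κ
  mom_init : P 0 = mom κ
  exit_time : IsLeast {t : ℝ | 0 ≤ t ∧ ‖q t‖ = 1 / 2 ∧ 0 ≤ ⟪q t, v t⟫} T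

/-- The momentum transfer `R = -α ∫₀^T Q(t) ∇σ(q(t)) dt`. -/
noncomputable def momentumTransfer {d : ℕ} (σ : Space d → ℝ) (α : ℝ) (q : ℝ → Space d)
    (Q : ℝ → ℝ) (T : ℝ) : Space d :=
  -α • ∫ t in (0 : ℝ)..T, Q t • gradient σ (q t)

/-- The energy transfer `ΔE = (‖p + R‖² - ‖p‖²) / 2`. -/
noncomputable def energyTransfer {d : ℕ} (σ : Space d → ℝ) (α : ℝ) (p : Space d)
    (q : ℝ → Space d) (Q : ℝ → ℝ) (T : ℝ) : ℝ :=
  (‖p + momentumTransfer σ α q Q T‖ ^ 2 - ‖p‖ ^ 2) / 2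

/-- `L₀(μ, ‖b‖) = ∫₀^μ σ(b + (l - 1/2) e) dl`, for a unit vector `e` orthogonal to `b`. -/
noncomputable def L0 {d : ℕ} (σ : Space d → ℝ) (e b : Space d) (μ : ℝ) : ℝ :=
  ∫ l in (0 : ℝ)..μ, σ (b + (l - 1 / 2) • e)

/-- `K₀(μ, ‖b‖) = ∫₀^μ L₀(l, ‖b‖) dl`. -/
noncomputable def K0 {d : ℕ} (σ : Space d → ℝ) (e b : Space d) (μ : ℝ) : ℝ :=
  ∫ l in (0 : ℝ)..μ, L0 σ e b l

/-- `∫₀¹ dl σ(b + (l - 1/2) e) ∫₀^l dl' K₀(l', ‖b‖)`. -/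
noncomputable def formIntegral {d : ℕ} (σ : Space d → ℝ) (e b : Space d) : ℝ :=
  ∫ l in (0 : ℝ)..1, σ (b + (l - 1 / 2) • e) * ∫ l' in (0 : ℝ)..l, K0 σ e b l'

/-- `β⁽¹⁾(κ) = (P / √M) L₀(‖b‖)`, where `L₀(‖b‖) = L₀(1, ‖b‖)`. -/
noncomputable def beta1 {d : ℕ} (σ : Space d → ℝ) (M : ℝ) (e : Space d) (κ : Param d) : ℝ :=
  mom κ / √M * L0 σ e (impact κ) 1

/-- `δβ⁽²⁾(κ) = -L₀(‖b‖)² / 2`. -/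
noncomputable def deltaBeta2 {d : ℕ} (σ : Space d → ℝ) (e : Space d) (κ : Param d) : ℝ :=
  -(L0 σ e (impact κ) 1) ^ 2 / 2

/-- `ρ(Q, P) = ρhat(H(Q, P))` is a probability density with compact support on the phase space of
a scatterer of mass `M`. -/
structure IsStationaryDensity (U : ℝ → ℝ) (M : ℝ) (ρhat : ℝ → ℝ) : Prop where
  measurable : Measurable ρhat
  nonneg : ∀ E, 0 ≤ ρhat E
  compact_support : HasCompactSupport fun x : ℝ × ℝ => ρhat (hScatt U M x.1 x.2)
  total_mass : ∫⁻ x : ℝ × ℝ, ENNReal.ofReal (ρhat (hScatt U M x.1 x.2)) = 1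

/-- The law of the impact parameter: uniform on the ball of radius `1/2` of the hyperplane
orthogonal to `p`. -/
noncomputable def impactLaw {d : ℕ} (p : Space d) : Measure (Space d) :=
  (ProbabilityTheory.cond (volume : Measure (Submodule.span ℝ {p})ᗮ)
    (Metric.closedBall 0 (1 / 2))).map Subtype.val

/-- The law of `κ = (b, Q, P)`: `b` is uniform on the ball of radius `1/2` orthogonal to `p`, and
`(Q, P)` is independent of `b`, with density `ρhat(H(Q, P))`. -/
noncomputable def collisionLaw {d : ℕ} (U : ℝ → ℝ) (M : ℝ) (ρhat : ℝ → ℝ) (p : Space d) :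
    Measure (Param d) :=
  (impactLaw p).prod
    (volume.withDensity fun x : ℝ × ℝ => ENNReal.ofReal (ρhat (hScatt U M x.1 x.2)))

/-- `f` is integrable, and its mean is `m`. -/
def HasMean {d : ℕ} (law : Measure (Param d)) (f : Param d → ℝ) (m : ℝ) : Prop :=
  Integrable f law ∧ ∫ κ, f κ ∂law = m

/-- The parameters `κ = (b, Q, P)` with `‖b‖ ≤ 1/2`, `|Q| ≤ R` and `|P| / √M ≤ R`. -/
def params (d : ℕ) (R M : ℝ) : Set (Param d) :=
  {κ | ‖impact κ‖ ≤ 1 / 2 ∧ |disp κ| ≤ R ∧ |mom κ| / √M ≤ R}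

end LorentzGas

/-!
The energy of particle and scatterer together is conserved, and outside the support of `σ` the
particle moves freely. In the rescaled time `l = ‖p‖ t` a fast particle stays close to the straight
line `l ↦ b + (l - 1/2) e`, leaves the scatterer before `l = 2`, and its energy transfer is
`α ∫ y σ(q) dl`, with `y` the rescaled velocity of the scatterer (`exists_collision`).

The energy transfer is expanded twice. In powers of `α` (`IsMotion.work_expand`) its first order
term involves the free scatterer `X, Y` only; the second order term is the sum of the linear
response `Y₁` of the scatterer to the particle, and of the effect of the deflection of the particle
by the free scatterer. In these terms, the parameter `θ = 1 / (√M ‖p‖)` is the ratio of the time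
scale of the particle to that of the scatterer, and a Taylor expansion in `θ`
(`IsFreeMotion.first_order`, `IsFreeMotion.second_order_response`,
`IsFreeMotion.second_order_deflection`) yields `β⁽¹⁾`, `δβ⁽²⁾`, the parts of zero mean `A₂`, `B₃`,
and `δβ⁽⁴⁾`. Everything depends on the direction of incidence only through its orthogonality to
`b`, because of rotation invariance, so that the coefficients are functions of `‖p‖` and `κ`. The
error terms `A₄` and `B₅` are the remaining parts of the first two coefficients of the expansion in
`α`; these are determined by the motion itself (`IsFreePart.unique`), so that they do not depend on
the radius `R` used for the bounds.

For the means, Liouville's theorem (`IsStationaryDensity.integral_bracket`) says that Poisson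
brackets with the energy have zero mean. It gives the vanishing means, and the virial theorem
`mean (Q U') = mean (P²) / M`. The virial theorem leaves in the mean of `δβ⁽⁴⁾` the difference of
two double integrals of `∇σ(x) · ∇σ(x')` along the line, which for a radial gradient is the exact
expression `-L₀ (b · ∇L₀) - L₀²` (`gradMoment_sub_gradMoment`). As the impact parameters fill a
ball of dimension `d - 1`, the divergence theorem turns it into `(d - 3) / 2` times the mean of
`L₀²` (`integral_gradMoment_sub`).
-/

namespace LorentzGas

/-! ### Ordinary differential equations on a bounded time interval -/

section ODE

variable {E : Type*} [NormedAddCommGroup E] [NormedSpace ℝ E]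

theorem exists_lipschitzOnWith_of_contDiff {F : Type*} [NormedAddCommGroup F] [NormedSpace ℝ F]
    {f : E → F} (hf : ContDiff ℝ 1 f) {s : Set E} (hs : IsCompact s) (hc : Convex ℝ s) :
    ∃ K : NNReal, LipschitzOnWith K f s := by
  obtain ⟨C, hC⟩ := hs.exists_bound_of_continuousOn
    (hf.continuous_fderiv one_ne_zero).continuousOn
  refine ⟨C.toNNReal, hc.lipschitzOnWith_of_nnnorm_fderiv_le (𝕜 := ℝ)
    (fun x _ => hf.differentiable one_ne_zero x) fun x hx => ?_⟩
  rw [← NNReal.coe_le_coe]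
  exact (hC x hx).trans (Real.le_coe_toNNReal C)

/-- The Picard–Lindelöf theorem, which also records that the solution stays in the ball. -/
theorem _root_.IsPicardLindelof.exists_mem_closedBall [CompleteSpace E] {f : ℝ → E → E}
    {tmin tmax : ℝ} {t₀ : Icc tmin tmax} {x₀ : E} {a L K : NNReal}
    (hf : IsPicardLindelof f t₀ x₀ a 0 L K) :
    ∃ x : ℝ → E, Continuous x ∧ x t₀ = x₀ ∧ ∀ t ∈ Icc tmin tmax,
      x t ∈ Metric.closedBall x₀ a ∧ HasDerivWithinAt x (f t (x t)) (Icc tmin tmax) t := by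
  have hx : x₀ ∈ Metric.closedBall x₀ ((0 : NNReal) : ℝ) := by simp
  obtain ⟨α, hα⟩ := ODE.FunSpace.exists_isFixedPt_next hf hx
  refine ⟨α.compProj, α.continuous_compProj, by
    rw [ODE.FunSpace.compProj_val, ← hα, ODE.FunSpace.next_apply₀],
    fun t ht => ⟨α.compProj_mem_closedBall hf.mul_max_le, ?_⟩⟩
  apply ODE.hasDerivWithinAt_picard_Icc t₀.2 hf.continuousOn_uncurry
    α.continuous_compProj.continuousOn (fun _ _ => α.compProj_mem_closedBall hf.mul_max_le)
    x₀ ht |>.congr_of_mem _ ht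
  intro t' ht'
  nth_rw 1 [← hα]
  rw [ODE.FunSpace.compProj_of_mem ht', ODE.FunSpace.next_apply]

/-- A time dependent `C¹` vector field which is too small to leave a ball within time `T` has an
integral curve on `[0, T]` that stays in the ball. -/
theorem exists_solution_Icc [FiniteDimensional ℝ E] {F : ℝ × E → E} (hF : ContDiff ℝ 1 F) (x₀ : E)
    {a T : ℝ} (ha : 0 ≤ a) (hT : 0 < T)
    (hb : ∀ t ∈ Icc 0 T, ∀ x ∈ Metric.closedBall x₀ a, ‖F (t, x)‖ * T ≤ a) :
    ∃ x : ℝ → E, Continuous x ∧ x 0 = x₀ ∧ ∀ t ∈ Icc 0 T,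
      x t ∈ Metric.closedBall x₀ a ∧ HasDerivWithinAt x (F (t, x t)) (Icc 0 T) t := by
  obtain ⟨K, hK⟩ := exists_lipschitzOnWith_of_contDiff hF
    (isCompact_Icc.prod (isCompact_closedBall x₀ a))
    ((convex_Icc (0 : ℝ) T).prod (convex_closedBall x₀ a))
  lift a to NNReal using ha
  have hL : ((a / T.toNNReal : NNReal) : ℝ) = a / T := by
    rw [NNReal.coe_div, Real.coe_toNNReal T hT.le]
  have hPL : IsPicardLindelof (fun t x => F (t, x)) (⟨0, by simp [hT.le]⟩ : Icc 0 T) x₀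
      a 0 (a / T.toNNReal) K := by
    refine ⟨fun t ht => ?_, fun x _ => ?_, fun t ht x hx => ?_, ?_⟩
    · intro x hx y hy
      have := hK (x := (t, x)) ⟨ht, hx⟩ (y := (t, y)) ⟨ht, hy⟩
      simpa [Prod.edist_eq] using this
    · exact (hF.continuous.comp (by fun_prop)).continuousOn
    · rw [hL]
      exact (le_div_iff₀ hT).2 (hb t ht x hx)
    · rw [hL]
      simp [max_eq_left hT.le, div_mul_cancel₀ _ hT.ne']
  simpa using hPL.exists_mem_closedBall

theorem hasDerivWithinAt_Ici_of_Icc {f : ℝ → E} {f' : E} {a b t : ℝ}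
    (h : HasDerivWithinAt f f' (Icc a b) t) (ht : t ∈ Ico a b) : HasDerivWithinAt f f' (Ici t) t :=
  (h.mono (Icc_subset_Icc_left ht.1)).mono_of_mem_nhdsWithin (Icc_mem_nhdsGE ht.2)

/-- Two integral curves of an autonomous `C¹` vector field with the same origin coincide. -/
theorem eqOn_of_solutions [FiniteDimensional ℝ E] {F : E → E} (hF : ContDiff ℝ 1 F) {x y : ℝ → E}
    {T : ℝ} (hx : ∀ t ∈ Icc 0 T, HasDerivWithinAt x (F (x t)) (Icc 0 T) t)
    (hy : ∀ t ∈ Icc 0 T, HasDerivWithinAt y (F (y t)) (Icc 0 T) t) (h0 : x 0 = y 0) :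
    EqOn x y (Icc 0 T) := by
  have hxc : ContinuousOn x (Icc 0 T) := fun t ht => (hx t ht).continuousWithinAt
  have hyc : ContinuousOn y (Icc 0 T) := fun t ht => (hy t ht).continuousWithinAt
  obtain ⟨Cx, hCx⟩ := isCompact_Icc.exists_bound_of_continuousOn hxc
  obtain ⟨Cy, hCy⟩ := isCompact_Icc.exists_bound_of_continuousOn hyc
  obtain ⟨K, hK⟩ := exists_lipschitzOnWith_of_contDiff hF
    (isCompact_closedBall (0 : E) (max Cx Cy)) (convex_closedBall _ _)
  refine ODE_solution_unique_of_mem_Icc_right (v := fun _ => F)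
    (s := fun _ => Metric.closedBall (0 : E) (max Cx Cy)) (K := K) (fun _ _ => hK)
    hxc (fun t ht => hasDerivWithinAt_Ici_of_Icc (hx t (Ico_subset_Icc_self ht)) ht)
    (fun t ht => ?_) hyc
    (fun t ht => hasDerivWithinAt_Ici_of_Icc (hy t (Ico_subset_Icc_self ht)) ht)
    (fun t ht => ?_) h0
  · simpa using Or.inl (hCx t (Ico_subset_Icc_self ht))
  · simpa using Or.inr (hCy t (Ico_subset_Icc_self ht))

theorem integral_eq_sub_of_hasDerivWithinAt_Icc [CompleteSpace E] {f f' : ℝ → E} {a b : ℝ}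
    (hab : a ≤ b) (hf : ∀ t ∈ Icc a b, HasDerivWithinAt f (f' t) (Icc a b) t)
    (hf' : ContinuousOn f' (Icc a b)) : ∫ t in a..b, f' t = f b - f a := by
  refine intervalIntegral.integral_eq_sub_of_hasDeriv_right_of_le hab
    (fun t ht => (hf t ht).continuousWithinAt) (fun t ht => ?_) ?_
  · exact (hasDerivWithinAt_Ici_of_Icc (hf t (Ioo_subset_Icc_self ht))
      (Ioo_subset_Ico_self ht)).mono Ioi_subset_Ici_self
  · exact ContinuousOn.intervalIntegrable (by rwa [uIcc_of_le hab])

theorem monotoneOn_Icc_of_nonneg_deriv {f f' : ℝ → ℝ} {a b : ℝ}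
    (hf : ∀ t ∈ Icc a b, HasDerivWithinAt f (f' t) (Icc a b) t)
    (hf' : ∀ t ∈ Icc a b, 0 ≤ f' t) : MonotoneOn f (Icc a b) :=
  monotoneOn_of_hasDerivWithinAt_nonneg (convex_Icc a b)
    (fun t ht => (hf t ht).continuousWithinAt)
    (fun t ht => (hf t (interior_subset ht)).mono interior_subset)
    (fun t ht => hf' t (interior_subset ht))

/-- Grönwall's inequality on `[0, 2]`, with a numerical constant. -/
theorem norm_le_of_norm_deriv_le {h h' : ℝ → E} {ε : ℝ} (hε : 0 ≤ ε)
    (hd : ∀ t ∈ Icc (0 : ℝ) 2, HasDerivWithinAt h (h' t) (Icc 0 2) t) (h0 : h 0 = 0)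
    (hb : ∀ t ∈ Icc (0 : ℝ) 2, ‖h' t‖ ≤ ‖h t‖ + ε) :
    ∀ t ∈ Icc (0 : ℝ) 2, ‖h t‖ ≤ 8 * ε := by
  intro t ht
  have := norm_le_gronwallBound_of_norm_deriv_right_le (δ := 0) (K := 1) (ε := ε)
    (fun t ht => (hd t ht).continuousWithinAt)
    (fun t ht => hasDerivWithinAt_Ici_of_Icc (hd t (Ico_subset_Icc_self ht)) ht) (by simp [h0])
    (fun t ht => by simpa using hb t (Ico_subset_Icc_self ht)) t ht
  rw [gronwallBound_of_K_ne_0 one_ne_zero] at this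
  have h2 : Real.exp (1 * (t - 0)) ≤ 8 := by
    calc Real.exp (1 * (t - 0)) ≤ Real.exp (1 + 1) := Real.exp_le_exp.2 (by linarith [ht.2])
      _ = Real.exp 1 * Real.exp 1 := Real.exp_add 1 1
      _ ≤ 8 := by nlinarith [Real.exp_one_lt_d9, Real.exp_pos 1]
  calc ‖h t‖ ≤ _ := this
    _ ≤ 8 * ε := by nlinarith

theorem norm_le_of_norm_deriv_le_const {h h' : ℝ → E} {ε : ℝ} (hε : 0 ≤ ε)
    (hd : ∀ t ∈ Icc (0 : ℝ) 2, HasDerivWithinAt h (h' t) (Icc 0 2) t) (h0 : h 0 = 0)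
    (hb : ∀ t ∈ Icc (0 : ℝ) 2, ‖h' t‖ ≤ ε) : ∀ t ∈ Icc (0 : ℝ) 2, ‖h t‖ ≤ 8 * ε :=
  norm_le_of_norm_deriv_le hε hd h0 fun t ht => by linarith [hb t ht, norm_nonneg (h t)]

end ODE

/-! ### The form factor and its gradient -/

/-- The standing assumptions on the form factor: `C²`, rotation invariant, and zero outside the
closed ball of radius `1/2`. -/
structure IsFormFactor {d : ℕ} (σ : Space d → ℝ) : Prop where
  contDiff : ContDiff ℝ 2 σ
  radial : ∀ x y : Space d, ‖x‖ = ‖y‖ → σ x = σ y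
  support : Function.support σ ⊆ Metric.closedBall 0 (1 / 2)

theorem eq_zero_of_half_le_norm {d : ℕ} {F : Type*} [TopologicalSpace F] [T2Space F] [Zero F]
    {f : Space d → F} (hf : Continuous f) (h : ∀ x, 1 / 2 < ‖x‖ → f x = 0) (x : Space d)
    (hx : 1 / 2 ≤ ‖x‖) : f x = 0 := by
  have hc : Continuous fun t : ℝ => f ((1 + t) • x) := by fun_prop
  have h1 : Tendsto (fun t : ℝ => f ((1 + t) • x)) (𝓝[>] 0) (𝓝 (f x)) := by
    have := (hc.tendsto 0).mono_left (nhdsWithin_le_nhds (s := Ioi 0))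
    simpa using this
  refine tendsto_nhds_unique_of_eventuallyEq h1 (tendsto_const_nhds (x := (0 : F))) ?_
  filter_upwards [self_mem_nhdsWithin] with t ht
  refine (h _ ?_)
  have ht' : 0 < t := ht
  rw [norm_smul, Real.norm_of_nonneg (by linarith)]
  nlinarith

namespace IsFormFactor

variable {d : ℕ} {σ : Space d → ℝ} (hσ : IsFormFactor σ)
include hσ

theorem differentiable : Differentiable ℝ σ := hσ.contDiff.differentiable two_ne_zero

theorem continuous : Continuous σ := hσ.contDiff.continuous

theorem hasGradientAt (x : Space d) : HasGradientAt σ (gradient σ x) x :=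
  (hσ.differentiable x).hasGradientAt

theorem contDiff_gradient : ContDiff ℝ 1 (gradient σ) := by
  have h : ContDiff ℝ 1 (fderiv ℝ σ) := hσ.contDiff.fderiv_right (by norm_num)
  exact (InnerProductSpace.toDual ℝ (Space d)).symm.contDiff.comp h

theorem continuous_gradient : Continuous (gradient σ) := hσ.contDiff_gradient.continuous

theorem fderiv_apply (x y : Space d) : fderiv ℝ σ x y = ⟪gradient σ x, y⟫ := by
  rw [(hσ.hasGradientAt x).hasFDerivAt.fderiv]
  simp

theorem eq_zero_of_lt {x : Space d} (hx : 1 / 2 < ‖x‖) : σ x = 0 := by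
  by_contra h
  have := hσ.support h
  simp only [Metric.mem_closedBall, dist_zero_right] at this
  linarith

theorem eq_zero {x : Space d} (hx : 1 / 2 ≤ ‖x‖) : σ x = 0 :=
  eq_zero_of_half_le_norm hσ.continuous (fun _ h => hσ.eq_zero_of_lt h) x hx

theorem gradient_eq_zero {x : Space d} (hx : 1 / 2 ≤ ‖x‖) : gradient σ x = 0 := by
  refine eq_zero_of_half_le_norm hσ.continuous_gradient (fun y hy => ?_) x hx
  have : σ =ᶠ[𝓝 y] fun _ => 0 := by
    filter_upwards [(isOpen_lt continuous_const continuous_norm).mem_nhds hy] with z hz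
    exact hσ.eq_zero_of_lt hz
  rw [this.gradient_eq]
  simp [gradient]

theorem hasCompactSupport : HasCompactSupport σ :=
  HasCompactSupport.of_support_subset_isCompact (isCompact_closedBall 0 (1 / 2)) hσ.support

theorem hasCompactSupport_gradient : HasCompactSupport (gradient σ) := by
  refine HasCompactSupport.of_support_subset_isCompact
    (isCompact_closedBall (0 : Space d) (1 / 2)) fun x hx => ?_
  by_contra h
  simp only [Metric.mem_closedBall, dist_zero_right, not_le] at h
  exact hx (hσ.gradient_eq_zero h.le)

theorem comp_isometry (g : Space d ≃ₗᵢ[ℝ] Space d) (x : Space d) : σ (g x) = σ x :=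
  hσ.radial _ _ (g.norm_map x)

theorem gradient_isometry (g : Space d ≃ₗᵢ[ℝ] Space d) (x : Space d) :
    gradient σ (g x) = g (gradient σ x) := by
  refine ext_inner_right ℝ fun y => ?_
  have h1 : HasFDerivAt (fun z => σ (g z)) ((fderiv ℝ σ (g x)).comp
      (g.toContinuousLinearEquiv : Space d →L[ℝ] Space d)) x :=
    (hσ.differentiable (g x)).hasFDerivAt.comp x
      (g.toContinuousLinearEquiv : Space d →L[ℝ] Space d).hasFDerivAt
  have h2 : (fun z => σ (g z)) = σ := funext fun z => hσ.comp_isometry g z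
  rw [h2] at h1
  have h3 := congrArg (fun L => L (g.symm y)) h1.fderiv
  simp only [hσ.fderiv_apply, ContinuousLinearMap.comp_apply] at h3
  have h4 : (g.toContinuousLinearEquiv : Space d →L[ℝ] Space d) (g.symm y) = y :=
    g.apply_symm_apply y
  rw [h4] at h3
  rw [← h3, ← g.inner_map_map, g.apply_symm_apply]

/-- The gradient of a rotation invariant function is radial: it is fixed by the reflection in the
line through the point. -/
theorem exists_gradient_eq_smul (x : Space d) : ∃ k : ℝ, gradient σ x = k • x := by
  have h : (Submodule.span ℝ {x}).reflection (gradient σ x) = gradient σ x := by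
    rw [← hσ.gradient_isometry, Submodule.reflection_mem_subspace_eq_self
      (Submodule.mem_span_singleton_self x)]
  rw [Submodule.reflection_eq_self_iff, Submodule.mem_span_singleton] at h
  obtain ⟨k, hk⟩ := h
  exact ⟨k, hk.symm⟩

/-- A common bound for the form factor, its gradient, their Lipschitz constants and the remainder
of the first order Taylor expansion. -/
theorem exists_bound : ∃ S : ℝ, 1 ≤ S ∧ (∀ x, |σ x| ≤ S) ∧ (∀ x, ‖gradient σ x‖ ≤ S) ∧
    (∀ x y, |σ y - σ x| ≤ S * ‖y - x‖) ∧
    (∀ x y, ‖gradient σ y - gradient σ x‖ ≤ S * ‖y - x‖) ∧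
    (∀ x y, |σ y - σ x - ⟪gradient σ x, y - x⟫| ≤ S * ‖y - x‖ ^ 2) := by
  obtain ⟨C₀, h₀⟩ := hσ.continuous.bounded_above_of_compact_support hσ.hasCompactSupport
  obtain ⟨C₁, h₁⟩ :=
    hσ.continuous_gradient.bounded_above_of_compact_support hσ.hasCompactSupport_gradient
  obtain ⟨K, hK⟩ := hσ.contDiff_gradient.lipschitzWith_of_hasCompactSupport
    hσ.hasCompactSupport_gradient one_ne_zero
  set S := 1 + |C₀| + |C₁| + K with hS
  have hK0 : (0 : ℝ) ≤ K := K.2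
  have hS0 : C₀ ≤ S := by linarith [le_abs_self C₀, abs_nonneg C₁]
  have hS1 : C₁ ≤ S := by linarith [le_abs_self C₁, abs_nonneg C₀]
  have hS2 : (K : ℝ) ≤ S := by linarith [abs_nonneg C₁, abs_nonneg C₀]
  have hG : ∀ x y, ‖gradient σ y - gradient σ x‖ ≤ S * ‖y - x‖ := fun x y =>
    (hK.norm_sub_le y x).trans (by gcongr)
  refine ⟨S, by linarith [abs_nonneg C₁, abs_nonneg C₀], fun x => (h₀ x).trans hS0,
    fun x => (h₁ x).trans hS1, fun x y => ?_, hG, fun x y => ?_⟩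
  · refine convex_univ.norm_image_sub_le_of_norm_fderiv_le (𝕜 := ℝ) (f := σ)
      (fun z _ => hσ.differentiable z) (fun z _ => ?_) (mem_univ x) (mem_univ y)
    rw [(hσ.hasGradientAt z).hasFDerivAt.fderiv]
    exact ((LinearIsometryEquiv.norm_map _ _).trans_le (h₁ z)).trans hS1
  · have key := (convex_segment x y).norm_image_sub_le_of_norm_hasFDerivWithin_le
      (f := fun z => σ z - ⟪gradient σ x, z⟫)
      (f' := fun z => fderiv ℝ σ z - innerSL ℝ (gradient σ x)) (C := S * ‖y - x‖)
      (fun z _ => ((hσ.differentiable z).hasFDerivAt.sub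
        (innerSL ℝ (gradient σ x)).hasFDerivAt).hasFDerivWithinAt)
      (fun z hz => ?_) (left_mem_segment ℝ x y) (right_mem_segment ℝ x y)
    · rw [inner_sub_right]
      calc _ = ‖σ y - ⟪gradient σ x, y⟫ - (σ x - ⟪gradient σ x, x⟫)‖ := by
            rw [Real.norm_eq_abs]; ring_nf
        _ ≤ _ := key
        _ = _ := by ring
    · refine ContinuousLinearMap.opNorm_le_bound _ (by positivity) fun v => ?_
      rw [sub_apply, hσ.fderiv_apply, innerSL_apply_apply, ← inner_sub_left]
      refine (norm_inner_le_norm _ _).trans ?_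
      gcongr
      refine (hG x z).trans ?_
      gcongr
      rw [← dist_eq_norm, ← dist_eq_norm, dist_comm z, dist_comm y]
      obtain ⟨t, ht, rfl⟩ := segment_eq_image_lineMap ℝ x y ▸ hz
      rw [dist_left_lineMap, Real.norm_of_nonneg ht.1]
      exact mul_le_of_le_one_left dist_nonneg ht.2

end IsFormFactor

/-! ### The collision in rescaled time -/

/-- `C` bounds the form factor and, for displacements within `R + 1`, the force `U'` of the
confining potential, together with the relevant Lipschitz constants and Taylor remainders. -/
structure IsBound {d : ℕ} (σ : Space d → ℝ) (U : ℝ → ℝ) (R C : ℝ) : Prop where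
  pos : 0 < R
  radius_le : R + 1 ≤ C
  form : ∀ x, |σ x| ≤ C
  grad : ∀ x, ‖gradient σ x‖ ≤ C
  form_lip : ∀ x y, |σ y - σ x| ≤ C * ‖y - x‖
  grad_lip : ∀ x y, ‖gradient σ y - gradient σ x‖ ≤ C * ‖y - x‖
  form_taylor : ∀ x y, |σ y - σ x - ⟪gradient σ x, y - x⟫| ≤ C * ‖y - x‖ ^ 2
  force : ∀ x, |x| ≤ R + 1 → |deriv U x| ≤ C
  force_deriv : ∀ x, |x| ≤ R + 1 → |deriv (deriv U) x| ≤ C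
  force_lip : ∀ x y, |x| ≤ R + 1 → |y| ≤ R + 1 → |deriv U y - deriv U x| ≤ C * |y - x|
  force_deriv_lip : ∀ x y, |x| ≤ R + 1 → |y| ≤ R + 1 →
    |deriv (deriv U) y - deriv (deriv U) x| ≤ C * |y - x|
  force_taylor : ∀ x y, |x| ≤ R + 1 → |y| ≤ R + 1 →
    |deriv U y - deriv U x - deriv (deriv U) x * (y - x)| ≤ C * |y - x| ^ 2

theorem IsBound.one_le {d : ℕ} {σ : Space d → ℝ} {U : ℝ → ℝ} {R C : ℝ} (h : IsBound σ U R C) :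
    1 ≤ C := by linarith [h.pos, h.radius_le]

theorem exists_bound_on_Icc {f : ℝ → ℝ} (hf : ContDiff ℝ ∞ f) (r : ℝ) :
    ∃ C : ℝ, 0 ≤ C ∧ (∀ x, |x| ≤ r → |f x| ≤ C) ∧
      ∀ x y, |x| ≤ r → |y| ≤ r → |f y - f x| ≤ C * |y - x| := by
  obtain ⟨C, hC⟩ := (isCompact_Icc (a := -r) (b := r)).exists_bound_of_continuousOn
    hf.continuous.continuousOn
  obtain ⟨K, hK⟩ := exists_lipschitzOnWith_of_contDiff (hf.of_le (by simp))
    (isCompact_Icc (a := -r) (b := r)) (convex_Icc _ _)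
  have hK0 : (0 : ℝ) ≤ K := K.2
  refine ⟨|C| + K, by positivity, fun x hx => ?_, fun x y hx hy => ?_⟩
  · have := hC x (abs_le.1 hx)
    rw [Real.norm_eq_abs] at this
    linarith [le_abs_self C]
  · have := hK.dist_le_mul y (abs_le.1 hy) x (abs_le.1 hx)
    rw [Real.dist_eq, Real.dist_eq] at this
    nlinarith [abs_nonneg C, abs_nonneg (y - x)]

theorem exists_isBound {d : ℕ} {σ : Space d → ℝ} (hσ : IsFormFactor σ) {U : ℝ → ℝ}
    (hU : ContDiff ℝ ∞ U) {R : ℝ} (hR : 0 < R) : ∃ C, IsBound σ U R C := by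
  obtain ⟨S, -, s1, s2, s3, s4, s5⟩ := hσ.exists_bound
  have hU1 := (contDiff_infty_iff_deriv.1 hU).2
  have hU2 := (contDiff_infty_iff_deriv.1 hU1).2
  obtain ⟨C₁, p1, b1, l1⟩ := exists_bound_on_Icc hU1 (R + 1)
  obtain ⟨C₂, p2, b2, l2⟩ := exists_bound_on_Icc hU2 (R + 1)
  have hS : 0 ≤ S := (abs_nonneg _).trans (s1 0)
  set C := R + 1 + S + C₁ + C₂ with hC
  have e0 : S ≤ C := by linarith
  have e1 : C₁ ≤ C := by linarith
  have e2 : C₂ ≤ C := by linarith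
  refine ⟨C, hR, by linarith, fun x => (s1 x).trans e0, fun x => (s2 x).trans e0,
    fun x y => (s3 x y).trans (by gcongr), fun x y => (s4 x y).trans (by gcongr),
    fun x y => (s5 x y).trans (by gcongr), fun x hx => (b1 x hx).trans e1,
    fun x hx => (b2 x hx).trans e2, fun x y hx hy => (l1 x y hx hy).trans (by gcongr),
    fun x y hx hy => (l2 x y hx hy).trans (by gcongr), fun x y hx hy => ?_⟩
  have key := (convex_segment x y).norm_image_sub_le_of_norm_hasDerivWithin_le
    (f := fun z => deriv U z - deriv (deriv U) x * z)
    (f' := fun z => deriv (deriv U) z - deriv (deriv U) x) (C := C₂ * |y - x|)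
    (fun z _ => ((hU1.differentiable (by simp) z).hasDerivAt.sub (by
      simpa using (hasDerivAt_id z).const_mul (deriv (deriv U) x))).hasDerivWithinAt)
    (fun z hz => ?_) (left_mem_segment ℝ x y) (right_mem_segment ℝ x y)
  · calc _ = ‖deriv U y - deriv (deriv U) x * y - (deriv U x - deriv (deriv U) x * x)‖ := by
          rw [Real.norm_eq_abs]; ring_nf
      _ ≤ C₂ * |y - x| * |y - x| := by simpa using key
      _ ≤ C * |y - x| ^ 2 := by rw [mul_assoc, ← sq]; gcongr
  · have hz' : |z| ≤ R + 1 := by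
      have : segment ℝ x y ⊆ Icc (-(R + 1)) (R + 1) :=
        (convex_Icc _ _).segment_subset (abs_le.1 hx) (abs_le.1 hy)
      exact abs_le.2 (this hz)
    refine (l2 x z hx hz').trans (mul_le_mul_of_nonneg_left ?_ p2)
    rw [← Real.dist_eq, ← Real.dist_eq, dist_comm z, dist_comm y]
    obtain ⟨t, ht, rfl⟩ := segment_eq_image_lineMap ℝ x y ▸ hz
    rw [dist_left_lineMap, Real.norm_of_nonneg ht.1]
    exact mul_le_of_le_one_left dist_nonneg ht.2

/-- The equations of motion in the rescaled time `l = ‖p‖ t`, on the time interval `[0, 2]`.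
Here `w = v / ‖p‖`, `y = dQ/dl`, `γ = α / ‖p‖²`, `ν = 1 / (M ‖p‖²)` and `ζ = α / (M ‖p‖²)`. The
scatterer stays within unit distance of its initial position, and the velocity of the particle
close to its initial value. -/
structure IsMotion {d : ℕ} (σ : Space d → ℝ) (U : ℝ → ℝ) (γ ν ζ : ℝ) (e b : Space d) (Q₀ y₀ : ℝ)
    (q w : ℝ → Space d) (Q y : ℝ → ℝ) : Prop where
  pos_deriv : ∀ l ∈ Icc (0 : ℝ) 2, HasDerivWithinAt q (w l) (Icc 0 2) l
  vel_deriv : ∀ l ∈ Icc (0 : ℝ) 2,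
    HasDerivWithinAt w (-(γ * Q l) • gradient σ (q l)) (Icc 0 2) l
  disp_deriv : ∀ l ∈ Icc (0 : ℝ) 2, HasDerivWithinAt Q (y l) (Icc 0 2) l
  mom_deriv : ∀ l ∈ Icc (0 : ℝ) 2,
    HasDerivWithinAt y (-(ν * deriv U (Q l)) - ζ * σ (q l)) (Icc 0 2) l
  pos_init : q 0 = b - (1 / 2 : ℝ) • e
  vel_init : w 0 = e
  disp_init : Q 0 = Q₀
  mom_init : y 0 = y₀
  disp_near : ∀ l ∈ Icc (0 : ℝ) 2, |Q l - Q₀| ≤ 1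
  vel_near : ∀ l ∈ Icc (0 : ℝ) 2, ‖w l - e‖ ≤ 1 / 8

theorem exists_isMotion {d : ℕ} {σ : Space d → ℝ} (hσ : IsFormFactor σ) {U : ℝ → ℝ}
    (hU : ContDiff ℝ ∞ U) {R C : ℝ} (hC : IsBound σ U R C) {γ ν ζ Q₀ y₀ : ℝ} (e b : Space d)
    (hγ : 0 ≤ γ) (hγ' : γ * C ^ 2 ≤ 1 / 16) (hν : 0 ≤ ν) (hν' : ν * C ≤ 1 / 32)
    (hζ : 0 ≤ ζ) (hζ' : ζ * C ≤ 1 / 32) (hQ : |Q₀| ≤ R) (hy : |y₀| ≤ 1 / 8) :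
    ∃ q w Q y, IsMotion σ U γ ν ζ e b Q₀ y₀ q w Q y := by
  have hU1 := (contDiff_infty_iff_deriv.1 hU).2
  have hU1' : ContDiff ℝ 1 (deriv U) := hU1.of_le (by simp)
  have hσ1 : ContDiff ℝ 1 σ := hσ.contDiff.of_le (by norm_num)
  have hG := hσ.contDiff_gradient
  -- The unknown is `(u, z, h, k)` with `q = b + (l - 1/2) e + u`, `w = e + z / 4`, `Q = Q₀ + h`
  -- and `y = k / 4`: the free flight is subtracted and the velocities are scaled, so that the
  -- field is small on a ball of radius `1/2`.
  let F : ℝ × (Space d × Space d × ℝ × ℝ) → Space d × Space d × ℝ × ℝ := fun x =>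
    ((1 / 4 : ℝ) • x.2.2.1,
      -(4 * γ * (Q₀ + x.2.2.2.1)) • gradient σ (b + (x.1 - 1 / 2) • e + x.2.1),
      1 / 4 * x.2.2.2.2,
      4 * (-(ν * deriv U (Q₀ + x.2.2.2.1)) - ζ * σ (b + (x.1 - 1 / 2) • e + x.2.1)))
  have hF : ContDiff ℝ 1 F := by
    have h1 : ContDiff ℝ 1 fun x : ℝ × (Space d × Space d × ℝ × ℝ) =>
      b + (x.1 - 1 / 2) • e + x.2.1 := by fun_prop
    have h2 : ContDiff ℝ 1 fun x : ℝ × (Space d × Space d × ℝ × ℝ) => Q₀ + x.2.2.2.1 := by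
      fun_prop
    have h3 := hG.comp h1
    have h4 := hσ1.comp h1
    have h5 := hU1'.comp h2
    have h6 : ContDiff ℝ 1 fun x : ℝ × (Space d × Space d × ℝ × ℝ) =>
      -(4 * γ * (Q₀ + x.2.2.2.1)) := by fun_prop
    refine ContDiff.prodMk (by fun_prop) (ContDiff.prodMk (h6.smul h3)
      (ContDiff.prodMk (by fun_prop) ?_))
    exact contDiff_const.mul ((contDiff_const.mul h5).neg.sub (contDiff_const.mul h4))
  have hC1 := hC.one_le
  have hdist : ∀ x : Space d × Space d × ℝ × ℝ,
      x ∈ Metric.closedBall ((0 : Space d), (0 : Space d), (0 : ℝ), 4 * y₀) (1 / 2) →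
      ‖x.2.1‖ ≤ 1 / 2 ∧ |x.2.2.1| ≤ 1 / 2 ∧ |x.2.2.2| ≤ 1 := by
    intro x hx
    rw [Metric.mem_closedBall, dist_eq_norm, norm_prod_le_iff, norm_prod_le_iff,
      norm_prod_le_iff] at hx
    obtain ⟨-, h2, h3, h4⟩ := hx
    simp only [Prod.fst_sub, Prod.snd_sub, sub_zero, Real.norm_eq_abs] at h2 h3 h4
    refine ⟨h2, h3, ?_⟩
    rw [abs_le] at h4 hy ⊢
    constructor <;> linarith
  obtain ⟨x, -, hx0, hx⟩ := exists_solution_Icc hF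
    ((0 : Space d), (0 : Space d), (0 : ℝ), 4 * y₀) (a := 1 / 2) (T := 2) (by norm_num)
    (by norm_num) (by
      intro t _ x hx
      obtain ⟨h2, h3, h4⟩ := hdist x hx
      have hQ' : |Q₀ + x.2.2.1| ≤ R + 1 := by
        rw [abs_le] at *
        constructor <;> linarith
      have hQC : |Q₀ + x.2.2.1| ≤ C := hQ'.trans hC.radius_le
      suffices ‖F (t, x)‖ ≤ 1 / 4 by linarith
      refine norm_prod_le_iff.2 ⟨?_, norm_prod_le_iff.2 ⟨?_, norm_prod_le_iff.2 ⟨?_, ?_⟩⟩⟩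
      · simp only [F, norm_smul]
        norm_num
        linarith
      · simp only [F, norm_smul, norm_neg, Real.norm_eq_abs, abs_mul, abs_of_nonneg hγ]
        have h5 := hC.grad (b + (t - 1 / 2) • e + x.1)
        calc |(4 : ℝ)| * γ * |Q₀ + x.2.2.1| * ‖gradient σ (b + (t - 1 / 2) • e + x.1)‖
            ≤ |(4 : ℝ)| * γ * C * C := by gcongr
          _ ≤ 1 / 4 := by norm_num; nlinarith
      · simp only [F, Real.norm_eq_abs, abs_mul]
        norm_num
        linarith
      · have h5 := abs_le.1 (hC.form (b + (t - 1 / 2) • e + x.1))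
        have h6 := abs_le.1 (hC.force _ hQ')
        simp only [F, Real.norm_eq_abs]
        rw [abs_le]
        constructor <;> nlinarith)
  have hd1 := fun l hl => (ContinuousLinearMap.fst ℝ (Space d) _).hasFDerivAt.comp_hasDerivWithinAt
    l (hx l hl).2
  have hd' := fun l hl => (ContinuousLinearMap.snd ℝ (Space d) _).hasFDerivAt.comp_hasDerivWithinAt
    l (hx l hl).2
  have hd2 := fun l hl => (ContinuousLinearMap.fst ℝ (Space d) _).hasFDerivAt.comp_hasDerivWithinAt
    l (hd' l hl)
  have hd'' := fun l hl => (ContinuousLinearMap.snd ℝ (Space d) _).hasFDerivAt.comp_hasDerivWithinAt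
    l (hd' l hl)
  have hd3 := fun l hl => (ContinuousLinearMap.fst ℝ ℝ ℝ).hasFDerivAt.comp_hasDerivWithinAt
    l (hd'' l hl)
  have hd4 := fun l hl => (ContinuousLinearMap.snd ℝ ℝ ℝ).hasFDerivAt.comp_hasDerivWithinAt
    l (hd'' l hl)
  refine ⟨fun l => b + (l - 1 / 2) • e + (x l).1, fun l => e + (1 / 4 : ℝ) • (x l).2.1,
    fun l => Q₀ + (x l).2.2.1, fun l => 1 / 4 * (x l).2.2.2, ?_, ?_, ?_, ?_, ?_, ?_, ?_, ?_, ?_, ?_⟩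
  · intro l hl
    have h1 : HasDerivWithinAt (fun l : ℝ => b + (l - 1 / 2) • e) e (Icc 0 2) l := by
      exact ((((hasDerivAt_id l).sub_const (1 / 2)).smul_const e).const_add b).congr_deriv
        (one_smul ℝ e) |>.hasDerivWithinAt
    exact h1.add (hd1 l hl)
  · intro l hl
    refine (((hd2 l hl).const_smul (1 / 4 : ℝ)).const_add e).congr_deriv ?_
    simp only [F, ContinuousLinearMap.coe_fst', ContinuousLinearMap.coe_snd',
      smul_smul]
    congr 1
    ring
  · intro l hl
    exact (hd3 l hl).const_add Q₀
  · intro l hl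
    refine ((hd4 l hl).const_mul (1 / 4 : ℝ)).congr_deriv ?_
    simp only [F, ContinuousLinearMap.coe_snd']
    ring
  · simp only [hx0]
    rw [zero_sub, neg_smul, add_zero, sub_eq_add_neg]
  · simp [hx0]
  · simp [hx0]
  · simp [hx0]
  · intro l hl
    obtain ⟨-, h3, -⟩ := hdist _ (hx l hl).1
    simp only [add_sub_cancel_left]
    linarith
  · intro l hl
    obtain ⟨h2, -, -⟩ := hdist _ (hx l hl).1
    simp only [add_sub_cancel_left, norm_smul]
    norm_num
    linarith

/-! ### The exit of the particle and the conservation of energy -/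

namespace IsMotion

variable {d : ℕ} {σ : Space d → ℝ} {U : ℝ → ℝ} {R C γ ν ζ Q₀ y₀ : ℝ} {e b : Space d}
  {q w : ℝ → Space d} {Q y : ℝ → ℝ}

theorem abs_disp_le (h : IsMotion σ U γ ν ζ e b Q₀ y₀ q w Q y) (hQ : |Q₀| ≤ R) {l : ℝ}
    (hl : l ∈ Icc (0 : ℝ) 2) : |Q l| ≤ R + 1 := by
  have := abs_le.1 (h.disp_near l hl)
  rw [abs_le] at *
  constructor <;> linarith

theorem continuousOn_pos (h : IsMotion σ U γ ν ζ e b Q₀ y₀ q w Q y) : ContinuousOn q (Icc 0 2) :=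
  fun l hl => (h.pos_deriv l hl).continuousWithinAt

theorem continuousOn_vel (h : IsMotion σ U γ ν ζ e b Q₀ y₀ q w Q y) : ContinuousOn w (Icc 0 2) :=
  fun l hl => (h.vel_deriv l hl).continuousWithinAt

theorem continuousOn_mom (h : IsMotion σ U γ ν ζ e b Q₀ y₀ q w Q y) : ContinuousOn y (Icc 0 2) :=
  fun l hl => (h.mom_deriv l hl).continuousWithinAt

theorem inner_hasDeriv (h : IsMotion σ U γ ν ζ e b Q₀ y₀ q w Q y) {l : ℝ}
    (hl : l ∈ Icc (0 : ℝ) 2) : HasDerivWithinAt (fun l => ⟪q l, w l⟫)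
      (⟪q l, -(γ * Q l) • gradient σ (q l)⟫ + ⟪w l, w l⟫) (Icc 0 2) l :=
  (h.pos_deriv l hl).inner ℝ (h.vel_deriv l hl)

theorem norm_sq_hasDeriv (h : IsMotion σ U γ ν ζ e b Q₀ y₀ q w Q y) {l : ℝ}
    (hl : l ∈ Icc (0 : ℝ) 2) :
    HasDerivWithinAt (fun l => ‖q l‖ ^ 2) (2 * ⟪q l, w l⟫) (Icc 0 2) l :=
  (h.pos_deriv l hl).norm_sq

/-- The radial motion is strictly convex: the centrifugal term dominates the force. -/
theorem half_le_inner_deriv (hσ : IsFormFactor σ) (hC : IsBound σ U R C)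
    (h : IsMotion σ U γ ν ζ e b Q₀ y₀ q w Q y)
    (hγ : 0 ≤ γ) (hγ' : γ * C ^ 2 ≤ 1 / 16) (hQ : |Q₀| ≤ R) (he : ‖e‖ = 1) {l : ℝ}
    (hl : l ∈ Icc (0 : ℝ) 2) :
    1 / 2 ≤ ⟪q l, -(γ * Q l) • gradient σ (q l)⟫ + ⟪w l, w l⟫ := by
  have h1 : 7 / 8 ≤ ‖w l‖ := by
    have := norm_sub_norm_le e (w l)
    rw [norm_sub_rev] at this
    linarith [h.vel_near l hl]
  have h2 : |⟪q l, -(γ * Q l) • gradient σ (q l)⟫| ≤ 1 / 16 := by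
    by_cases hq : 1 / 2 ≤ ‖q l‖
    · simp [hσ.gradient_eq_zero hq]
    · refine (abs_real_inner_le_norm _ _).trans ?_
      rw [norm_smul, norm_neg, Real.norm_eq_abs, abs_mul, abs_of_nonneg hγ]
      have h3 := (h.abs_disp_le hQ hl).trans hC.radius_le
      have h4 := hC.grad (q l)
      have hC0 : 0 ≤ C := by linarith [hC.one_le]
      calc ‖q l‖ * (γ * |Q l| * ‖gradient σ (q l)‖) ≤ 1 * (γ * C * C) := by
            gcongr
            linarith
        _ ≤ 1 / 16 := by nlinarith
  rw [real_inner_self_eq_norm_sq]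
  nlinarith [abs_le.1 h2]

theorem inner_strictMonoOn (hσ : IsFormFactor σ) (hC : IsBound σ U R C)
    (h : IsMotion σ U γ ν ζ e b Q₀ y₀ q w Q y)
    (hγ : 0 ≤ γ) (hγ' : γ * C ^ 2 ≤ 1 / 16) (hQ : |Q₀| ≤ R) (he : ‖e‖ = 1) :
    StrictMonoOn (fun l => ⟪q l, w l⟫) (Icc 0 2) := by
  refine strictMonoOn_of_hasDerivWithinAt_pos (convex_Icc 0 2)
    (fun l hl => (h.inner_hasDeriv hl).continuousWithinAt)
    (fun l hl => (h.inner_hasDeriv (interior_subset hl)).mono interior_subset) fun l hl => ?_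
  linarith [h.half_le_inner_deriv hσ hC hγ hγ' hQ he (interior_subset hl)]

/-- As long as it has not reached the scatterer, the particle flies freely. -/
theorem free_flight (hσ : IsFormFactor σ) (h : IsMotion σ U γ ν ζ e b Q₀ y₀ q w Q y) {l : ℝ}
    (hl : l ∈ Icc (0 : ℝ) 2) (hq : ∀ l' ∈ Icc 0 l, 1 / 2 ≤ ‖q l'‖) :
    q l = b + (l - 1 / 2) • e ∧ w l = e := by
  have hsub : Icc 0 l ⊆ Icc (0 : ℝ) 2 := Icc_subset_Icc_right hl.2
  have hw : ∀ l' ∈ Icc 0 l, w l' = e := by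
    intro l' hl'
    rw [← h.vel_init]
    refine constant_of_has_deriv_right_zero (h.continuousOn_vel.mono hsub) (fun x hx => ?_) l' hl'
    have hx' := Ico_subset_Icc_self hx
    have := (h.vel_deriv x (hsub hx')).mono hsub
    rw [hσ.gradient_eq_zero (hq x hx'), smul_zero] at this
    exact hasDerivWithinAt_Ici_of_Icc this hx
  have hl0 : l ∈ Icc 0 l := ⟨hl.1, le_rfl⟩
  refine ⟨?_, hw l hl0⟩
  have := constant_of_has_deriv_right_zero (f := fun x => q x - x • e) (a := 0) (b := l)
    ((h.continuousOn_pos.mono hsub).sub (by fun_prop)) (fun x hx => ?_) l hl0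
  · simp only [zero_smul, sub_zero, h.pos_init] at this
    rw [sub_eq_iff_eq_add] at this
    rw [this, sub_smul]
    abel
  · have hx' := Ico_subset_Icc_self hx
    have h1 := (h.pos_deriv x (hsub hx')).mono hsub
    rw [hw x hx'] at h1
    have h2 := h1.sub (((hasDerivAt_id x).smul_const e).hasDerivWithinAt)
    rw [one_smul, sub_self] at h2
    exact hasDerivWithinAt_Ici_of_Icc h2 hx

/-- The particle reaches the scatterer, because its unperturbed trajectory does, and leaves it
before the rescaled time `2`, by convexity of the radial motion. -/
theorem exists_exit (hσ : IsFormFactor σ) (hC : IsBound σ U R C)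
    (h : IsMotion σ U γ ν ζ e b Q₀ y₀ q w Q y)
    (hγ : 0 ≤ γ) (hγ' : γ * C ^ 2 ≤ 1 / 16) (hQ : |Q₀| ≤ R) (he : ‖e‖ = 1) (heb : ⟪e, b⟫ = 0)
    (hb : ‖b‖ ≤ 1 / 2) :
    ∃ l ∈ Icc (0 : ℝ) 2, IsLeast {x | x ∈ Icc (0 : ℝ) 2 ∧ ‖q x‖ = 1 / 2 ∧ 0 ≤ ⟪q x, w x⟫} l ∧
      ∀ x ∈ Icc l 2, 1 / 2 ≤ ‖q x‖ := by
  have hmono := h.inner_strictMonoOn hσ hC hγ hγ' hQ he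
  have hψc : ContinuousOn (fun l => ⟪q l, w l⟫) (Icc 0 2) :=
    fun l hl => (h.inner_hasDeriv hl).continuousWithinAt
  have hfc : ContinuousOn (fun l => ‖q l‖ ^ 2) (Icc 0 2) :=
    fun l hl => (h.norm_sq_hasDeriv hl).continuousWithinAt
  have z0 : (0 : ℝ) ∈ Icc (0 : ℝ) 2 := by norm_num
  have z2 : (2 : ℝ) ∈ Icc (0 : ℝ) 2 := by norm_num
  have hψ0 : ⟪q 0, w 0⟫ = -(1 / 2) := by
    rw [h.pos_init, h.vel_init, inner_sub_left, real_inner_smul_left, real_inner_comm, heb,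
      real_inner_self_eq_norm_sq, he]
    norm_num
  have hf0 : 1 / 4 ≤ ‖q 0‖ ^ 2 := by
    rw [h.pos_init, norm_sub_sq_real, real_inner_smul_right, real_inner_comm, heb, norm_smul, he]
    norm_num
  have hψ : ∀ l ∈ Icc (0 : ℝ) 2, -(1 / 2) + 1 / 2 * l ≤ ⟪q l, w l⟫ := by
    have hm : MonotoneOn (fun l => ⟪q l, w l⟫ - 1 / 2 * l) (Icc 0 2) :=
      monotoneOn_Icc_of_nonneg_deriv
        (fun l hl => (h.inner_hasDeriv hl).sub
          ((hasDerivAt_id l).const_mul (1 / 2 : ℝ)).hasDerivWithinAt)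
        fun l hl => by linarith [h.half_le_inner_deriv hσ hC hγ hγ' hQ he hl]
    intro l hl
    have := hm z0 hl hl.1
    simp only [hψ0] at this
    linarith
  -- integrating the bound on the radial velocity: at `l = 2` the particle is outside
  have hf2 : 1 / 4 ≤ ‖q 2‖ ^ 2 := by
    have hm : MonotoneOn (fun l => ‖q l‖ ^ 2 + (l - l ^ 2 / 2)) (Icc 0 2) :=
      monotoneOn_Icc_of_nonneg_deriv
        (f' := fun l => 2 * ⟪q l, w l⟫ + (1 - l))
        (fun l hl => (h.norm_sq_hasDeriv hl).add
          (((hasDerivAt_id l).sub (((hasDerivAt_id l).pow 2).div_const 2)).congr_deriv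
            (by simp)).hasDerivWithinAt)
        fun l hl => by linarith [hψ l hl]
    have := hm z0 z2 (by norm_num)
    norm_num at this
    linarith
  -- `m` is the instant of closest approach
  obtain ⟨m, hm, hm0⟩ : (0 : ℝ) ∈ (fun l => ⟪q l, w l⟫) '' Icc 0 2 :=
    intermediate_value_Icc (by norm_num) hψc ⟨by simp only [hψ0]; norm_num, by
      linarith [hψ 2 z2]⟩
  simp only at hm0
  have hanti : AntitoneOn (fun l => ‖q l‖ ^ 2) (Icc 0 m) := by
    have hsub : Icc 0 m ⊆ Icc (0 : ℝ) 2 := Icc_subset_Icc_right hm.2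
    have := monotoneOn_Icc_of_nonneg_deriv (f := fun l => -‖q l‖ ^ 2)
      (fun l hl => ((h.norm_sq_hasDeriv (hsub hl)).mono hsub).neg) fun l hl => by
        have := hmono.monotoneOn (hsub hl) hm hl.2
        simp only [hm0] at this
        linarith
    intro x hx y hy hxy
    simpa using this hx hy hxy
  have hstrict : StrictMonoOn (fun l => ‖q l‖ ^ 2) (Icc m 2) := by
    have hsub : Icc m 2 ⊆ Icc (0 : ℝ) 2 := Icc_subset_Icc_left hm.1
    refine strictMonoOn_of_hasDerivWithinAt_pos (convex_Icc m 2) (hfc.mono hsub)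
      (fun l hl => (h.norm_sq_hasDeriv (hsub (interior_subset hl))).mono
        (interior_subset.trans hsub)) fun l hl => ?_
    have hl' := hsub (interior_subset hl)
    rw [interior_Icc] at hl
    have := hmono hm hl' hl.1
    simp only [hm0] at this
    linarith
  -- otherwise the flight up to `m` is free, and its closest approach has distance `‖b‖ ≤ 1/2`
  have hfm : ‖q m‖ ^ 2 ≤ 1 / 4 := by
    by_contra hcon
    push Not at hcon
    have hfree := h.free_flight hσ hm fun l hl => by
      have := hanti hl ⟨hm.1, le_rfl⟩ hl.2
      simp only at this
      nlinarith [norm_nonneg (q l)]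
    rw [hfree.1, norm_add_sq_real, real_inner_smul_right, real_inner_comm, heb, norm_smul, he]
      at hcon
    rw [hfree.1, hfree.2, inner_add_left, real_inner_smul_left, real_inner_comm, heb,
      real_inner_self_eq_norm_sq, he] at hm0
    have : m = 1 / 2 := by linarith
    rw [this] at hcon
    norm_num at hcon
    nlinarith [norm_nonneg b]
  obtain ⟨l, hl, hl4⟩ : (1 / 4 : ℝ) ∈ (fun l => ‖q l‖ ^ 2) '' Icc m 2 :=
    intermediate_value_Icc hm.2 (hfc.mono (Icc_subset_Icc_left hm.1)) ⟨hfm, hf2⟩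
  simp only at hl4
  have hl' : l ∈ Icc (0 : ℝ) 2 := ⟨hm.1.trans hl.1, hl.2⟩
  have hql : ‖q l‖ = 1 / 2 := by nlinarith [norm_nonneg (q l)]
  refine ⟨l, hl', ⟨⟨hl', hql, ?_⟩, ?_⟩, fun x hx => ?_⟩
  · have := hmono.monotoneOn hm hl' hl.1
    simpa only [hm0] using this
  · rintro x ⟨hx, hqx, hψx⟩
    have hmx : m ≤ x := by
      by_contra hcon
      have := hmono hx hm (not_le.1 hcon)
      simp only [hm0] at this
      linarith
    by_contra hcon
    have := hstrict ⟨hmx, hx.2⟩ hl (not_le.1 hcon)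
    simp only [hql, hqx] at this
    exact lt_irrefl _ this
  · have := hstrict.monotoneOn hl ⟨hl.1.trans hx.1, hx.2⟩ hx.1
    simp only [hl4] at this
    nlinarith [norm_nonneg (q x)]

/-- Conservation of the total energy, in the form: the kinetic energy gained by the particle is
the work of the interaction on the scatterer, as the interaction energy vanishes initially and on
the sphere. -/
theorem energy (hσ : IsFormFactor σ) (h : IsMotion σ U γ ν ζ e b Q₀ y₀ q w Q y)
    (he : ‖e‖ = 1) (heb : ⟪e, b⟫ = 0) {l : ℝ} (hl : l ∈ Icc (0 : ℝ) 2)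
    (hout : ∀ x ∈ Icc l 2, 1 / 2 ≤ ‖q x‖) :
    (‖w l‖ ^ 2 - 1) / 2 = γ * ∫ x in (0 : ℝ)..2, y x * σ (q x) := by
  have hsub : Icc 0 l ⊆ Icc (0 : ℝ) 2 := Icc_subset_Icc_right hl.2
  have hσq : ContinuousOn (fun x => σ (q x)) (Icc 0 2) :=
    hσ.continuous.comp_continuousOn h.continuousOn_pos
  have hc : ContinuousOn (fun x => y x * σ (q x)) (Icc 0 2) := h.continuousOn_mom.mul hσq
  have hd : ∀ x ∈ Icc (0 : ℝ) l, HasDerivWithinAt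
      (fun x => ‖w x‖ ^ 2 / 2 + γ * (Q x * σ (q x))) (γ * (y x * σ (q x))) (Icc 0 l) x := by
    intro x hx
    have hx' := hsub hx
    have h1 : HasDerivWithinAt (fun x => σ (q x)) ⟪gradient σ (q x), w x⟫ (Icc 0 2) x := by
      have := (hσ.differentiable (q x)).hasFDerivAt.comp_hasDerivWithinAt x (h.pos_deriv x hx')
      rwa [hσ.fderiv_apply] at this
    have h2 := (((h.vel_deriv x hx').norm_sq.div_const 2).add
      (((h.disp_deriv x hx').mul h1).const_mul γ)).mono hsub
    refine h2.congr_deriv ?_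
    rw [real_inner_smul_right, real_inner_comm]
    ring
  have hint := integral_eq_sub_of_hasDerivWithinAt_Icc hl.1 hd ((hc.mono hsub).const_mul γ)
  have hq0 : σ (q 0) = 0 := by
    refine hσ.eq_zero ?_
    have : ‖q 0‖ ^ 2 = ‖b‖ ^ 2 + 1 / 4 := by
      rw [h.pos_init, norm_sub_sq_real, real_inner_smul_right, real_inner_comm, heb, norm_smul, he]
      norm_num
    nlinarith [norm_nonneg (q 0), norm_nonneg b]
  rw [hq0, hσ.eq_zero (hout l ⟨le_rfl, hl.2⟩), h.vel_init, he,
    intervalIntegral.integral_const_mul] at hint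
  have h3 : ∫ x in (l : ℝ)..2, y x * σ (q x) = 0 := by
    rw [intervalIntegral.integral_congr (g := fun _ => 0), intervalIntegral.integral_zero]
    intro x hx
    rw [uIcc_of_le hl.2] at hx
    simp [hσ.eq_zero (hout x hx)]
  rw [← intervalIntegral.integral_add_adjacent_intervals (b := l)
    (ContinuousOn.intervalIntegrable (hc.mono (by rw [uIcc_of_le hl.1]; exact hsub)))
    (ContinuousOn.intervalIntegrable (hc.mono (by
      rw [uIcc_of_le hl.2]; exact Icc_subset_Icc_left hl.1))), h3, add_zero, hint]
  ring

end IsMotion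

/-! ### Existence and uniqueness of the collision -/

theorem norm_dir {d : ℕ} {p : Space d} (hp : p ≠ 0) : ‖dir p‖ = 1 := by
  rw [dir, norm_smul, norm_inv, norm_norm, inv_mul_cancel₀ (norm_ne_zero_iff.2 hp)]

theorem norm_smul_dir {d : ℕ} {p : Space d} (hp : p ≠ 0) : ‖p‖ • dir p = p := by
  rw [dir, smul_smul, mul_inv_cancel₀ (norm_ne_zero_iff.2 hp), one_smul]

theorem inner_dir {d : ℕ} {p b : Space d} (h : ⟪p, b⟫ = 0) : ⟪dir p, b⟫ = 0 := by
  rw [dir, real_inner_smul_left, h, mul_zero]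

section Collision

variable {d : ℕ} {σ : Space d → ℝ} {U : ℝ → ℝ} {α M : ℝ} {p : Space d} {κ : Param d}
  {q v : ℝ → Space d} {Q P : ℝ → ℝ} {T : ℝ}

theorem IsCollision.nonneg (h : IsCollision σ U α M p κ q v Q P T) : 0 ≤ T := h.exit_time.1.1

theorem IsCollision.momentumTransfer_eq (hσ : IsFormFactor σ)
    (h : IsCollision σ U α M p κ q v Q P T) : momentumTransfer σ α q Q T = v T - p := by
  have hqc : ContinuousOn q (Icc 0 T) := fun t ht => (h.pos_deriv t ht).continuousWithinAt
  have hQc : ContinuousOn Q (Icc 0 T) := fun t ht => (h.disp_deriv t ht).continuousWithinAt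
  have hGq : ContinuousOn (fun t => gradient σ (q t)) (Icc 0 T) :=
    hσ.continuous_gradient.comp_continuousOn hqc
  have := integral_eq_sub_of_hasDerivWithinAt_Icc h.nonneg h.vel_deriv
    ((continuousOn_const.mul hQc).neg.smul hGq)
  rw [momentumTransfer, ← intervalIntegral.integral_smul, ← h.vel_init, ← this]
  refine intervalIntegral.integral_congr fun t _ => ?_
  simp only [smul_smul]
  ring_nf

theorem IsCollision.energyTransfer_eq (hσ : IsFormFactor σ)
    (h : IsCollision σ U α M p κ q v Q P T) :
    energyTransfer σ α p q Q T = (‖v T‖ ^ 2 - ‖p‖ ^ 2) / 2 := by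
  rw [energyTransfer, h.momentumTransfer_eq hσ, add_sub_cancel]

/-- The collision is unique, and so is its energy transfer. -/
theorem IsCollision.energyTransfer_unique (hσ : IsFormFactor σ) (hU : ContDiff ℝ ∞ U)
    (h : IsCollision σ U α M p κ q v Q P T) {q' v' : ℝ → Space d} {Q' P' : ℝ → ℝ} {T' : ℝ}
    (h' : IsCollision σ U α M p κ q' v' Q' P' T') :
    energyTransfer σ α p q Q T = energyTransfer σ α p q' Q' T' := by
  wlog hT : T ≤ T' generalizing q v Q P T q' v' Q' P' T'
  · exact (this h' h (not_le.1 hT).le).symm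
  have hU1' : ContDiff ℝ 1 (deriv U) := (contDiff_infty_iff_deriv.1 hU).2.of_le (by simp)
  have hσ1 : ContDiff ℝ 1 σ := hσ.contDiff.of_le (by norm_num)
  have hG := hσ.contDiff_gradient
  let F : Space d × Space d × ℝ × ℝ → Space d × Space d × ℝ × ℝ := fun x =>
    (x.2.1, -(α * x.2.2.1) • gradient σ x.1, x.2.2.2 / M, -deriv U x.2.2.1 - α * σ x.1)
  have hF : ContDiff ℝ 1 F := by
    have h2 : ContDiff ℝ 1 fun x : Space d × Space d × ℝ × ℝ => -(α * x.2.2.1) := by fun_prop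
    have h1 : ContDiff ℝ 1 fun x : Space d × Space d × ℝ × ℝ => x.2.2.1 := by fun_prop
    refine contDiff_snd.fst.prodMk ((h2.smul (hG.comp contDiff_fst)).prodMk
      (ContDiff.prodMk (by fun_prop) ?_))
    exact (hU1'.comp h1).neg.sub (contDiff_const.mul (hσ1.comp contDiff_fst))
  have hsub : Icc 0 T ⊆ Icc 0 T' := Icc_subset_Icc_right hT
  have heq : EqOn (fun t => (q t, v t, Q t, P t)) (fun t => (q' t, v' t, Q' t, P' t))
      (Icc 0 T) := by
    refine eqOn_of_solutions hF (fun t ht => ?_) (fun t ht => ?_) ?_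
    · exact (h.pos_deriv t ht).prodMk ((h.vel_deriv t ht).prodMk
        ((h.disp_deriv t ht).prodMk (h.mom_deriv t ht)))
    · have ht' := hsub ht
      exact ((h'.pos_deriv t ht').prodMk ((h'.vel_deriv t ht').prodMk
        ((h'.disp_deriv t ht').prodMk (h'.mom_deriv t ht')))).mono hsub
    · simp only [h.pos_init, h.vel_init, h.disp_init, h.mom_init, h'.pos_init, h'.vel_init,
        h'.disp_init, h'.mom_init]
  have hTT := heq ⟨h.nonneg, le_rfl⟩
  simp only [Prod.mk.injEq] at hTT
  have : T' = T := by
    refine le_antisymm (h'.exit_time.2 ⟨h.nonneg, ?_⟩) hT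
    rw [← hTT.1, ← hTT.2.1]
    exact h.exit_time.1.2
  subst this
  rw [h.energyTransfer_eq hσ, h'.energyTransfer_eq hσ, hTT.2.1]

theorem IsCollision.map (hσ : IsFormFactor σ) (h : IsCollision σ U α M p κ q v Q P T)
    (g : Space d ≃ₗᵢ[ℝ] Space d) (hg : g (impact κ) = impact κ) :
    IsCollision σ U α M (g p) κ (fun t => g (q t)) (fun t => g (v t)) Q P T where
  pos_deriv t ht := g.toContinuousLinearEquiv.hasFDerivAt.comp_hasDerivWithinAt t (h.pos_deriv t ht)
  vel_deriv t ht := by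
    have := g.toContinuousLinearEquiv.hasFDerivAt.comp_hasDerivWithinAt t (h.vel_deriv t ht)
    refine this.congr_deriv ?_
    rw [hσ.gradient_isometry, map_smul]
    rfl
  disp_deriv := h.disp_deriv
  mom_deriv t ht := by
    rw [hσ.comp_isometry]
    exact h.mom_deriv t ht
  pos_init := by
    rw [h.pos_init, map_sub, hg, map_smul, dir, map_smul, dir, g.norm_map]
  vel_init := by rw [h.vel_init]
  disp_init := h.disp_init
  mom_init := h.mom_init
  exit_time := by simpa only [g.norm_map, g.inner_map_map] using h.exit_time

/-- Two vectors of the same norm orthogonal to `b` are exchanged by a linear isometry which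
fixes `b`: the reflection in the hyperplane orthogonal to their difference. -/
theorem exists_isometry {x y b : Space d} (hxy : ‖x‖ = ‖y‖) (hx : ⟪x, b⟫ = 0) (hy : ⟪y, b⟫ = 0) :
    ∃ g : Space d ≃ₗᵢ[ℝ] Space d, g x = y ∧ g b = b := by
  refine ⟨(Submodule.span ℝ {x - y})ᗮ.reflection, Submodule.reflection_sub hxy, ?_⟩
  refine Submodule.reflection_mem_subspace_eq_self ?_
  rw [Submodule.mem_orthogonal_singleton_iff_inner_right, inner_sub_left, hx, hy, sub_zero]

/-- By rotation invariance, the energy transfer depends on the incoming momentum only through its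
norm. -/
theorem IsCollision.energyTransfer_eq_of_norm_eq (hσ : IsFormFactor σ) (hU : ContDiff ℝ ∞ U)
    (h : IsCollision σ U α M p κ q v Q P T) {p' : Space d} {q' v' : ℝ → Space d} {Q' P' : ℝ → ℝ}
    {T' : ℝ} (h' : IsCollision σ U α M p' κ q' v' Q' P' T') (hp : ⟪p, impact κ⟫ = 0)
    (hp' : ⟪p', impact κ⟫ = 0) (hpp : ‖p‖ = ‖p'‖) :
    energyTransfer σ α p q Q T = energyTransfer σ α p' q' Q' T' := by
  obtain ⟨g, rfl, hg⟩ := exists_isometry hpp hp hp'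
  have hm := h.map hσ g hg
  rw [h'.energyTransfer_unique hσ hU hm, h.energyTransfer_eq hσ, hm.energyTransfer_eq hσ,
    g.norm_map, g.norm_map]

end Collision

/-- In rescaled time, a fast particle undergoes a collision, and its energy transfer is the work
of the interaction on the scatterer. -/
theorem exists_collision {d : ℕ} {σ : Space d → ℝ} (hσ : IsFormFactor σ) {U : ℝ → ℝ}
    (hU : ContDiff ℝ ∞ U) {R C : ℝ} (hC : IsBound σ U R C) {α M : ℝ} (hα : 0 ≤ α) (hM : 1 ≤ M)
    {p : Space d} {κ : Param d} (hκ : κ ∈ params d R M) (hpb : ⟪p, impact κ⟫ = 0)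
    (hp : 32 * C ^ 2 * max 1 √α ≤ ‖p‖) :
    ∃ q w Q y, IsMotion σ U (α / ‖p‖ ^ 2) (1 / (M * ‖p‖ ^ 2)) (α / (M * ‖p‖ ^ 2)) (dir p)
        (impact κ) (disp κ) (mom κ / (M * ‖p‖)) q w Q y ∧
      ∃ q' v' Q' P' T, IsCollision σ U α M p κ q' v' Q' P' T ∧
        energyTransfer σ α p q' Q' T = α * ∫ l in (0 : ℝ)..2, y l * σ (q l) := by
  obtain ⟨hb, hQ, hP⟩ := hκ
  have hC1 := hC.one_le
  have hM0 : 0 < M := by linarith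
  have hmax : 1 ≤ max 1 √α := le_max_left _ _
  have hC2 : 1 ≤ C ^ 2 := one_le_pow₀ hC1
  have hp32 : 32 * C ^ 2 ≤ ‖p‖ := le_trans (by nlinarith) hp
  have hpα : 32 * C ^ 2 * √α ≤ ‖p‖ := le_trans (by gcongr; exact le_max_right _ _) hp
  set s := ‖p‖ with hs
  have hs1 : 1 ≤ s := by linarith
  have hs0 : 0 < s := by linarith
  have hp0 : p ≠ 0 := by
    rintro rfl
    simp only [norm_zero] at hs
    linarith
  have hαs : 32 ^ 2 * C ^ 4 * α ≤ s ^ 2 := by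
    calc 32 ^ 2 * C ^ 4 * α = (32 * C ^ 2 * √α) ^ 2 := by
          rw [mul_pow, Real.sq_sqrt hα]; ring
      _ ≤ s ^ 2 := by gcongr
  have hss : 32 * C ^ 2 ≤ s ^ 2 := by nlinarith
  have he := norm_dir hp0
  have heb := inner_dir hpb
  have hC4 : C ^ 2 ≤ C ^ 4 := pow_le_pow_right₀ hC1 (by norm_num)
  have hC24 : C ≤ C ^ 2 := le_self_pow₀ hC1 (by norm_num)
  have hγ' : α / s ^ 2 * C ^ 2 ≤ 1 / 16 := by
    rw [div_mul_eq_mul_div, div_le_iff₀ (by positivity)]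
    nlinarith [mul_le_mul_of_nonneg_left hC4 hα]
  obtain ⟨q, w, Q, y, hm⟩ := exists_isMotion hσ hU hC (γ := α / s ^ 2)
    (ν := 1 / (M * s ^ 2)) (ζ := α / (M * s ^ 2)) (Q₀ := disp κ) (y₀ := mom κ / (M * s)) (dir p)
    (impact κ) (by positivity) hγ' (by positivity)
    (by
      rw [div_mul_eq_mul_div, div_le_iff₀ (by positivity)]
      nlinarith)
    (by positivity)
    (by
      rw [div_mul_eq_mul_div, div_le_iff₀ (by positivity)]
      nlinarith [mul_le_mul_of_nonneg_left hC4 hα, mul_le_mul_of_nonneg_left hC24 hα])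
    hQ
    (by
      have h1 : |mom κ| ≤ C * √M := by
        rw [div_le_iff₀ (Real.sqrt_pos.2 hM0)] at hP
        refine hP.trans ?_
        gcongr
        linarith [hC.radius_le]
      have h2 : √M ≤ M := Real.sqrt_le_iff.2 ⟨hM0.le, by nlinarith⟩
      rw [abs_div, abs_of_pos (by positivity : 0 < M * s), div_le_iff₀ (by positivity)]
      nlinarith [mul_le_mul_of_nonneg_left h2 (by linarith : 0 ≤ C)])
  refine ⟨q, w, Q, y, hm, ?_⟩
  obtain ⟨L, hL, hexit, hout⟩ := hm.exists_exit hσ hC (by positivity) hγ' hQ he heb hb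
  have hT : 0 ≤ L / s := div_nonneg hL.1 hs0.le
  have hmaps : MapsTo (fun t => s * t) (Icc 0 (L / s)) (Icc (0 : ℝ) 2) := by
    intro t ht
    refine ⟨mul_nonneg hs0.le ht.1, ?_⟩
    have := (le_div_iff₀ hs0).1 ht.2
    linarith [hL.2]
  have hscale : ∀ t, HasDerivWithinAt (fun t => s * t) s (Icc 0 (L / s)) t := fun t => by
    simpa using ((hasDerivAt_id t).const_mul s).hasDerivWithinAt
  have hcol : IsCollision σ U α M p κ (fun t => q (s * t)) (fun t => s • w (s * t))
      (fun t => Q (s * t)) (fun t => M * s * y (s * t)) (L / s) := by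
    constructor
    · intro t ht
      exact (hm.pos_deriv _ (hmaps ht)).scomp t (hscale t) hmaps
    · intro t ht
      refine (((hm.vel_deriv _ (hmaps ht)).scomp t (hscale t) hmaps).const_smul s).congr_deriv ?_
      rw [smul_smul, smul_smul]
      congr 1
      field_simp
    · intro t ht
      refine ((hm.disp_deriv _ (hmaps ht)).scomp t (hscale t) hmaps).congr_deriv ?_
      rw [smul_eq_mul]
      field_simp
    · intro t ht
      refine (((hm.mom_deriv _ (hmaps ht)).scomp t (hscale t) hmaps).const_mul
        (M * s)).congr_deriv ?_
      rw [smul_eq_mul]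
      field_simp
    · simp only [mul_zero, hm.pos_init]
    · simp only [mul_zero, hm.vel_init]
      exact norm_smul_dir hp0
    · simp only [mul_zero, hm.disp_init]
    · simp only [mul_zero, hm.mom_init]
      field_simp
    · have hsL : s * (L / s) = L := mul_div_cancel₀ _ hs0.ne'
      refine ⟨⟨hT, ?_, ?_⟩, ?_⟩
      · simp only [hsL, hexit.1.2.1]
      · simp only [hsL, real_inner_smul_right]
        exact mul_nonneg hs0.le hexit.1.2.2
      · rintro t ⟨ht0, ht1, ht2⟩
        rw [real_inner_smul_right] at ht2
        rw [div_le_iff₀ hs0, mul_comm]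
        by_cases h2 : s * t ≤ 2
        · exact hexit.2 ⟨⟨by positivity, h2⟩, ht1, nonneg_of_mul_nonneg_right ht2 hs0⟩
        · exact hL.2.trans (not_le.1 h2).le
  refine ⟨_, _, _, _, _, hcol, ?_⟩
  have hen := hm.energy hσ he heb hL hout
  rw [hcol.energyTransfer_eq hσ, mul_div_cancel₀ L hs0.ne', norm_smul, Real.norm_of_nonneg hs0.le,
    mul_pow, ← hs]
  have : (s ^ 2 * ‖w L‖ ^ 2 - s ^ 2) / 2 = s ^ 2 * ((‖w L‖ ^ 2 - 1) / 2) := by ring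
  rw [this, hen]
  field_simp

/-! ### The free scatterer and its linear response -/

/-- The unperturbed trajectory of the particle in rescaled time. -/
noncomputable def line {d : ℕ} (e b : Space d) (l : ℝ) : Space d := b + (l - 1 / 2) • e

theorem continuous_line {d : ℕ} (e b : Space d) : Continuous (line e b) := by
  unfold line
  fun_prop

theorem half_le_norm_line {d : ℕ} {e b : Space d} (he : ‖e‖ = 1) (heb : ⟪e, b⟫ = 0) {l : ℝ}
    (hl : 1 ≤ l) : 1 / 2 ≤ ‖line e b l‖ := by
  have : ‖line e b l‖ ^ 2 = ‖b‖ ^ 2 + (l - 1 / 2) ^ 2 := by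
    rw [line, norm_add_sq_real, real_inner_smul_right, real_inner_comm, heb, norm_smul, he,
      mul_one, Real.norm_eq_abs, sq_abs]
    ring
  nlinarith [norm_nonneg (line e b l), norm_nonneg b]

theorem hasDerivAt_primitive {E : Type*} [NormedAddCommGroup E] [NormedSpace ℝ E]
    [CompleteSpace E] {f : ℝ → E} (hf : Continuous f) (l : ℝ) :
    HasDerivAt (fun l => ∫ x in (0 : ℝ)..l, f x) (f l) l :=
  (hf.integral_hasStrictDerivAt 0 l).hasDerivAt

/-- The free motion `(X, Y)` of a scatterer of unit mass, in slow time `θ l`, and its first order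
response `(X₁, Y₁)` to the unperturbed passage of the particle. -/
structure IsFreeMotion {d : ℕ} (σ : Space d → ℝ) (U : ℝ → ℝ) (θ : ℝ) (e b : Space d) (Q₀ Y₀ : ℝ)
    (X Y X₁ Y₁ : ℝ → ℝ) : Prop where
  contX : Continuous X
  contY : Continuous Y
  contY₁ : Continuous Y₁
  derivX : ∀ l ∈ Icc (0 : ℝ) 2, HasDerivWithinAt X (θ * Y l) (Icc 0 2) l
  derivY : ∀ l ∈ Icc (0 : ℝ) 2, HasDerivWithinAt Y (-(θ * deriv U (X l))) (Icc 0 2) l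
  derivX₁ : ∀ l ∈ Icc (0 : ℝ) 2, HasDerivWithinAt X₁ (θ * Y₁ l) (Icc 0 2) l
  derivY₁ : ∀ l ∈ Icc (0 : ℝ) 2, HasDerivWithinAt Y₁
    (-(θ * (deriv (deriv U) (X l) * X₁ l + σ (line e b l)))) (Icc 0 2) l
  initX : X 0 = Q₀
  initY : Y 0 = Y₀
  initX₁ : X₁ 0 = 0
  initY₁ : Y₁ 0 = 0
  nearX : ∀ l ∈ Icc (0 : ℝ) 2, |X l - Q₀| ≤ 1
  nearY : ∀ l ∈ Icc (0 : ℝ) 2, |Y l - Y₀| ≤ 1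

theorem exists_isFreeMotion {d : ℕ} {σ : Space d → ℝ} (hσ : IsFormFactor σ) {U : ℝ → ℝ}
    (hU : ContDiff ℝ ∞ U) {R C : ℝ} (hC : IsBound σ U R C) {θ Q₀ Y₀ : ℝ} (e b : Space d)
    (hθ : 0 ≤ θ) (hθ' : 32 * C ^ 2 * θ ≤ 1) (hQ : |Q₀| ≤ R) (hY : |Y₀| ≤ R) :
    ∃ X Y X₁ Y₁, IsFreeMotion σ U θ e b Q₀ Y₀ X Y X₁ Y₁ := by
  have hU1 := (contDiff_infty_iff_deriv.1 hU).2
  have hU2 := (contDiff_infty_iff_deriv.1 hU1).2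
  have hU1' : ContDiff ℝ 1 (deriv U) := hU1.of_le (by simp)
  have hU2' : ContDiff ℝ 1 (deriv (deriv U)) := hU2.of_le (by simp)
  have hσ1 : ContDiff ℝ 1 σ := hσ.contDiff.of_le (by norm_num)
  let F : ℝ × (ℝ × ℝ × ℝ × ℝ) → ℝ × ℝ × ℝ × ℝ := fun x =>
    (θ * x.2.2.1, -(θ * deriv U x.2.1), θ * x.2.2.2.2,
      -(θ * (deriv (deriv U) x.2.1 * x.2.2.2.1 + σ (line e b x.1))))
  have hF : ContDiff ℝ 1 F := by
    have h1 : ContDiff ℝ 1 fun x : ℝ × (ℝ × ℝ × ℝ × ℝ) => line e b x.1 := by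
      unfold line
      fun_prop
    have h2 : ContDiff ℝ 1 fun x : ℝ × (ℝ × ℝ × ℝ × ℝ) => x.2.1 := by fun_prop
    have h3 : ContDiff ℝ 1 fun x : ℝ × (ℝ × ℝ × ℝ × ℝ) => x.2.2.2.1 := by fun_prop
    refine ContDiff.prodMk (by fun_prop) (ContDiff.prodMk ?_ (ContDiff.prodMk (by fun_prop) ?_))
    · exact (contDiff_const.mul (hU1'.comp h2)).neg
    · exact (contDiff_const.mul (((hU2'.comp h2).mul h3).add (hσ1.comp h1))).neg
  have hC1 := hC.one_le
  have hCθ : 32 * (C * θ) ≤ 1 := by nlinarith [mul_nonneg (by linarith : 0 ≤ C) hθ]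
  have hdist : ∀ x : ℝ × ℝ × ℝ × ℝ, x ∈ Metric.closedBall (Q₀, Y₀, (0 : ℝ), (0 : ℝ)) 1 →
      |x.1 - Q₀| ≤ 1 ∧ |x.2.1 - Y₀| ≤ 1 ∧ |x.2.2.1| ≤ 1 ∧ |x.2.2.2| ≤ 1 := by
    intro x hx
    rw [Metric.mem_closedBall, dist_eq_norm, norm_prod_le_iff, norm_prod_le_iff,
      norm_prod_le_iff] at hx
    simpa only [Prod.fst_sub, Prod.snd_sub, sub_zero, Real.norm_eq_abs] using hx
  obtain ⟨x, hxc, hx0, hx⟩ := exists_solution_Icc hF (Q₀, Y₀, (0 : ℝ), (0 : ℝ)) (a := 1) (T := 2)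
    (by norm_num) (by norm_num) (by
      intro t _ x hx
      obtain ⟨h1, h2, h3, h4⟩ := hdist x hx
      have hQ' : |x.1| ≤ R + 1 := by
        rw [abs_le] at *
        constructor <;> linarith
      have hY' : |x.2.1| ≤ C := by
        have := hC.radius_le
        rw [abs_le] at *
        constructor <;> linarith
      suffices ‖F (t, x)‖ ≤ 1 / 2 by linarith
      have b1 : θ * |x.2.1| ≤ θ * C := by gcongr
      have b2 : θ * |deriv U x.1| ≤ θ * C := by
        gcongr
        exact hC.force _ hQ'
      have b3 : θ * |x.2.2.2| ≤ θ * C := by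
        gcongr
        linarith
      have b4 : |deriv (deriv U) x.1 * x.2.2.1 + σ (line e b t)| ≤ C * 1 + C := by
        refine (abs_add_le _ _).trans (add_le_add ?_ (hC.form _))
        rw [abs_mul]
        gcongr
        exact hC.force_deriv _ hQ'
      have b5 : θ * |deriv (deriv U) x.1 * x.2.2.1 + σ (line e b t)| ≤ θ * (C * 1 + C) := by
        gcongr
      refine norm_prod_le_iff.2 ⟨?_, norm_prod_le_iff.2 ⟨?_, norm_prod_le_iff.2 ⟨?_, ?_⟩⟩⟩
      all_goals
        simp only [F, Real.norm_eq_abs, abs_neg, abs_mul θ, abs_of_nonneg hθ]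
        linarith)
  have hd1 := fun l hl => (ContinuousLinearMap.fst ℝ ℝ _).hasFDerivAt.comp_hasDerivWithinAt
    l (hx l hl).2
  have hd' := fun l hl => (ContinuousLinearMap.snd ℝ ℝ _).hasFDerivAt.comp_hasDerivWithinAt
    l (hx l hl).2
  have hd2 := fun l hl => (ContinuousLinearMap.fst ℝ ℝ _).hasFDerivAt.comp_hasDerivWithinAt
    l (hd' l hl)
  have hd'' := fun l hl => (ContinuousLinearMap.snd ℝ ℝ _).hasFDerivAt.comp_hasDerivWithinAt
    l (hd' l hl)
  have hd3 := fun l hl => (ContinuousLinearMap.fst ℝ ℝ ℝ).hasFDerivAt.comp_hasDerivWithinAt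
    l (hd'' l hl)
  have hd4 := fun l hl => (ContinuousLinearMap.snd ℝ ℝ ℝ).hasFDerivAt.comp_hasDerivWithinAt
    l (hd'' l hl)
  refine ⟨fun l => (x l).1, fun l => (x l).2.1, fun l => (x l).2.2.1, fun l => (x l).2.2.2,
    by fun_prop, by fun_prop, by fun_prop, hd1, hd2, hd3, hd4, by simp [hx0], by simp [hx0],
    by simp [hx0], by simp [hx0], fun l hl => (hdist _ (hx l hl).1).1,
    fun l hl => (hdist _ (hx l hl).1).2.1⟩

namespace IsFreeMotion

variable {d : ℕ} {σ : Space d → ℝ} {U : ℝ → ℝ} {R C θ Q₀ Y₀ : ℝ} {e b : Space d}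
  {X Y X₁ Y₁ : ℝ → ℝ}

theorem absX_le (h : IsFreeMotion σ U θ e b Q₀ Y₀ X Y X₁ Y₁) (hQ : |Q₀| ≤ R) {l : ℝ}
    (hl : l ∈ Icc (0 : ℝ) 2) : |X l| ≤ R + 1 := by
  have := abs_le.1 (h.nearX l hl)
  rw [abs_le] at *
  constructor <;> linarith

theorem absY_le (h : IsFreeMotion σ U θ e b Q₀ Y₀ X Y X₁ Y₁) (hC : IsBound σ U R C)
    (hY : |Y₀| ≤ R) {l : ℝ} (hl : l ∈ Icc (0 : ℝ) 2) : |Y l| ≤ C := by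
  have := abs_le.1 (h.nearY l hl)
  have := hC.radius_le
  rw [abs_le] at *
  constructor <;> linarith

theorem X_sub_init (h : IsFreeMotion σ U θ e b Q₀ Y₀ X Y X₁ Y₁) (hC : IsBound σ U R C)
    (hθ : 0 ≤ θ) (hY : |Y₀| ≤ R) :
    ∀ l ∈ Icc (0 : ℝ) 2, |X l - Q₀| ≤ 8 * (C * θ) := by
  have hC1 := hC.one_le
  refine norm_le_of_norm_deriv_le_const (by positivity)
    (fun l hl => (h.derivX l hl).sub_const Q₀) (by simp [h.initX]) fun l hl => ?_
  rw [Real.norm_eq_abs, abs_mul, abs_of_nonneg hθ, mul_comm]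
  gcongr
  exact h.absY_le hC hY hl

theorem Y_sub_init (h : IsFreeMotion σ U θ e b Q₀ Y₀ X Y X₁ Y₁) (hC : IsBound σ U R C)
    (hθ : 0 ≤ θ) (hQ : |Q₀| ≤ R) :
    ∀ l ∈ Icc (0 : ℝ) 2, |Y l - Y₀| ≤ 8 * (C * θ) := by
  have hC1 := hC.one_le
  refine norm_le_of_norm_deriv_le_const (by positivity)
    (fun l hl => (h.derivY l hl).sub_const Y₀) (by simp [h.initY]) fun l hl => ?_
  rw [Real.norm_eq_abs, abs_neg, abs_mul, abs_of_nonneg hθ, mul_comm]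
  gcongr
  exact hC.force _ (h.absX_le hQ hl)

theorem X_expand (h : IsFreeMotion σ U θ e b Q₀ Y₀ X Y X₁ Y₁) (hC : IsBound σ U R C)
    (hθ : 0 ≤ θ) (hQ : |Q₀| ≤ R) :
    ∀ l ∈ Icc (0 : ℝ) 2, |X l - Q₀ - θ * Y₀ * l| ≤ 64 * C * θ ^ 2 := by
  have hC1 := hC.one_le
  have key := norm_le_of_norm_deriv_le_const (h := fun l => X l - Q₀ - θ * Y₀ * l)
    (ε := 8 * C * θ ^ 2) (by positivity)
    (fun l hl => ((h.derivX l hl).sub_const Q₀).sub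
      ((hasDerivAt_id l).const_mul (θ * Y₀)).hasDerivWithinAt) (by simp [h.initX]) fun l hl => ?_
  · intro l hl
    refine (key l hl).trans (le_of_eq ?_)
    ring
  · have := h.Y_sub_init hC hθ hQ l hl
    rw [Real.norm_eq_abs, show θ * Y l - θ * Y₀ * 1 = θ * (Y l - Y₀) by ring, abs_mul,
      abs_of_nonneg hθ]
    calc θ * |Y l - Y₀| ≤ θ * (8 * (C * θ)) := by gcongr
      _ = 8 * C * θ ^ 2 := by ring

theorem Y_expand (h : IsFreeMotion σ U θ e b Q₀ Y₀ X Y X₁ Y₁) (hC : IsBound σ U R C)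
    (hθ : 0 ≤ θ) (hQ : |Q₀| ≤ R) (hY : |Y₀| ≤ R) :
    ∀ l ∈ Icc (0 : ℝ) 2, |Y l - Y₀ + θ * deriv U Q₀ * l| ≤ 64 * C ^ 2 * θ ^ 2 := by
  have hC1 := hC.one_le
  have key := norm_le_of_norm_deriv_le_const (h := fun l => Y l - Y₀ + θ * deriv U Q₀ * l)
    (ε := 8 * C ^ 2 * θ ^ 2) (by positivity)
    (fun l hl => ((h.derivY l hl).sub_const Y₀).add
      ((hasDerivAt_id l).const_mul (θ * deriv U Q₀)).hasDerivWithinAt) (by simp [h.initY])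
      fun l hl => ?_
  · intro l hl
    refine (key l hl).trans (le_of_eq ?_)
    ring
  · have h1 := hC.force_lip Q₀ (X l) (by linarith) (h.absX_le hQ hl)
    have h2 := h.X_sub_init hC hθ hY l hl
    rw [Real.norm_eq_abs, show -(θ * deriv U (X l)) + θ * deriv U Q₀ * 1
      = -(θ * (deriv U (X l) - deriv U Q₀)) by ring, abs_neg, abs_mul, abs_of_nonneg hθ]
    calc θ * |deriv U (X l) - deriv U Q₀| ≤ θ * (C * (8 * (C * θ))) := by
          gcongr
          exact h1.trans (by gcongr)
      _ = 8 * C ^ 2 * θ ^ 2 := by ring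

theorem Y_expand_two (h : IsFreeMotion σ U θ e b Q₀ Y₀ X Y X₁ Y₁) (hC : IsBound σ U R C)
    (hθ : 0 ≤ θ) (hQ : |Q₀| ≤ R) (hY : |Y₀| ≤ R) :
    ∀ l ∈ Icc (0 : ℝ) 2, |Y l - Y₀ + θ * deriv U Q₀ * l
      + θ ^ 2 * deriv (deriv U) Q₀ * Y₀ / 2 * l ^ 2| ≤ 1024 * C ^ 3 * θ ^ 3 := by
  have hC1 := hC.one_le
  have key := norm_le_of_norm_deriv_le_const (h := fun l => Y l - Y₀ + θ * deriv U Q₀ * l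
      + θ ^ 2 * deriv (deriv U) Q₀ * Y₀ / 2 * l ^ 2)
    (ε := 128 * C ^ 3 * θ ^ 3) (by positivity)
    (fun l hl => (((h.derivY l hl).sub_const Y₀).add
      ((hasDerivAt_id l).const_mul (θ * deriv U Q₀)).hasDerivWithinAt).add
        (((hasDerivAt_id l).pow 2).const_mul
          (θ ^ 2 * deriv (deriv U) Q₀ * Y₀ / 2)).hasDerivWithinAt) (by simp [h.initY])
      fun l hl => ?_
  · intro l hl
    refine (key l hl).trans (le_of_eq ?_)
    ring
  · have h1 := hC.force_taylor Q₀ (X l) (by linarith) (h.absX_le hQ hl)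
    have h2 := h.X_sub_init hC hθ hY l hl
    have h3 := h.X_expand hC hθ hQ l hl
    have h4 := hC.force_deriv Q₀ (by linarith)
    simp only [id, Nat.cast_ofNat, Nat.add_one_sub_one, pow_one, mul_one]
    rw [Real.norm_eq_abs, show -(θ * deriv U (X l)) + θ * deriv U Q₀
        + θ ^ 2 * deriv (deriv U) Q₀ * Y₀ / 2 * (2 * l)
      = -(θ * ((deriv U (X l) - deriv U Q₀ - deriv (deriv U) Q₀ * (X l - Q₀))
        + deriv (deriv U) Q₀ * (X l - Q₀ - θ * Y₀ * l))) by ring, abs_neg, abs_mul,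
      abs_of_nonneg hθ]
    calc _ ≤ θ * (C * (8 * (C * θ)) ^ 2 + C * (64 * C * θ ^ 2)) := by
          gcongr
          refine (abs_add_le _ _).trans (add_le_add (h1.trans (by gcongr)) ?_)
          rw [abs_mul]
          gcongr
      _ = 64 * C ^ 3 * θ ^ 3 + 64 * C ^ 2 * θ ^ 3 := by ring
      _ ≤ 64 * C ^ 3 * θ ^ 3 + 64 * C ^ 3 * θ ^ 3 := by
          gcongr
          norm_num
      _ = 128 * C ^ 3 * θ ^ 3 := by ring

theorem response_le (h : IsFreeMotion σ U θ e b Q₀ Y₀ X Y X₁ Y₁) (hC : IsBound σ U R C)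
    (hθ : 0 ≤ θ) (hθ' : 32 * C ^ 2 * θ ≤ 1) (hQ : |Q₀| ≤ R) :
    ∀ l ∈ Icc (0 : ℝ) 2, |Y₁ l| ≤ 8 * (C * θ) := by
  have hC1 := hC.one_le
  have hCθ : 32 * (C * θ) ≤ 1 := by nlinarith [mul_nonneg (by linarith : 0 ≤ C) hθ]
  have key := norm_le_of_norm_deriv_le (h := fun l => (X₁ l, Y₁ l)) (ε := C * θ) (by positivity)
    (fun l hl => (h.derivX₁ l hl).prodMk (h.derivY₁ l hl)) (by simp [h.initX₁, h.initY₁])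
    fun l hl => ?_
  · intro l hl
    exact (norm_prod_le_iff.1 (key l hl)).2
  · have hx : |X₁ l| ≤ ‖(X₁ l, Y₁ l)‖ := norm_fst_le (X₁ l, Y₁ l)
    have hy : |Y₁ l| ≤ ‖(X₁ l, Y₁ l)‖ := norm_snd_le (X₁ l, Y₁ l)
    have hn := norm_nonneg (X₁ l, Y₁ l)
    have h1 := hC.force_deriv _ (h.absX_le hQ hl)
    have h2 := hC.form (line e b l)
    refine norm_prod_le_iff.2 ⟨?_, ?_⟩
    · rw [Real.norm_eq_abs, abs_mul, abs_of_nonneg hθ]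
      nlinarith [mul_nonneg (by linarith : 0 ≤ C) hθ]
    · simp only
      rw [Real.norm_eq_abs, abs_neg, abs_mul, abs_of_nonneg hθ]
      calc _ ≤ θ * (C * ‖(X₁ l, Y₁ l)‖ + C) := by
            gcongr
            refine (abs_add_le _ _).trans (add_le_add ?_ h2)
            rw [abs_mul]
            gcongr
        _ ≤ ‖(X₁ l, Y₁ l)‖ + C * θ := by nlinarith

theorem X₁_le (h : IsFreeMotion σ U θ e b Q₀ Y₀ X Y X₁ Y₁) (hC : IsBound σ U R C)
    (hθ : 0 ≤ θ) (hθ' : 32 * C ^ 2 * θ ≤ 1) (hQ : |Q₀| ≤ R) :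
    ∀ l ∈ Icc (0 : ℝ) 2, |X₁ l| ≤ 64 * C * θ ^ 2 := by
  have hC1 := hC.one_le
  have key := norm_le_of_norm_deriv_le_const (ε := 8 * C * θ ^ 2) (by positivity)
    h.derivX₁ h.initX₁ fun l hl => ?_
  · intro l hl
    refine (key l hl).trans (le_of_eq ?_)
    ring
  · rw [Real.norm_eq_abs, abs_mul, abs_of_nonneg hθ]
    calc θ * |Y₁ l| ≤ θ * (8 * (C * θ)) := by
          gcongr
          exact h.response_le hC hθ hθ' hQ l hl
      _ = 8 * C * θ ^ 2 := by ring

theorem hasDerivAt_L0 (hσ : IsFormFactor σ) (l : ℝ) :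
    HasDerivAt (L0 σ e b) (σ (line e b l)) l :=
  hasDerivAt_primitive (f := fun l => σ (line e b l)) (hσ.continuous.comp (continuous_line e b)) l

theorem continuous_L0 (hσ : IsFormFactor σ) : Continuous (L0 σ e b) :=
  continuous_iff_continuousAt.2 fun l => (hasDerivAt_L0 hσ l).continuousAt

theorem hasDerivAt_K0 (hσ : IsFormFactor σ) (l : ℝ) : HasDerivAt (K0 σ e b) (L0 σ e b l) l :=
  hasDerivAt_primitive (continuous_L0 hσ) l

theorem continuous_K0 (hσ : IsFormFactor σ) : Continuous (K0 σ e b) :=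
  continuous_iff_continuousAt.2 fun l => (hasDerivAt_K0 hσ l).continuousAt

theorem abs_K0_le (hσ : IsFormFactor σ) (hC : IsBound σ U R C) :
    ∀ l ∈ Icc (0 : ℝ) 2, |K0 σ e b l| ≤ 64 * C := by
  have hC1 := hC.one_le
  have key := norm_le_of_norm_deriv_le_const (ε := C) (by positivity)
    (fun l _ => (hasDerivAt_L0 (e := e) (b := b) hσ l).hasDerivWithinAt) (by simp [L0])
    fun l _ => hC.form _
  have key2 := norm_le_of_norm_deriv_le_const (ε := 8 * C) (by positivity)
    (fun l _ => (hasDerivAt_K0 (e := e) (b := b) hσ l).hasDerivWithinAt) (by simp [K0])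
    key
  intro l hl
  refine (key2 l hl).trans (le_of_eq ?_)
  ring

theorem response_expand (h : IsFreeMotion σ U θ e b Q₀ Y₀ X Y X₁ Y₁) (hσ : IsFormFactor σ)
    (hC : IsBound σ U R C) (hθ : 0 ≤ θ) (hθ' : 32 * C ^ 2 * θ ≤ 1) (hQ : |Q₀| ≤ R) :
    ∀ l ∈ Icc (0 : ℝ) 2, |Y₁ l + θ * L0 σ e b l| ≤ 512 * C ^ 2 * θ ^ 3 := by
  have hC1 := hC.one_le
  have key := norm_le_of_norm_deriv_le_const (h := fun l => Y₁ l + θ * L0 σ e b l)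
    (ε := 64 * C ^ 2 * θ ^ 3) (by positivity)
    (fun l hl => (h.derivY₁ l hl).add ((hasDerivAt_L0 hσ l).const_mul θ).hasDerivWithinAt)
    (by simp [h.initY₁, L0]) fun l hl => ?_
  · intro l hl
    refine (key l hl).trans (le_of_eq ?_)
    ring
  · rw [Real.norm_eq_abs, show -(θ * (deriv (deriv U) (X l) * X₁ l + σ (line e b l)))
      + θ * σ (line e b l) = -(θ * (deriv (deriv U) (X l) * X₁ l)) by ring, abs_neg, abs_mul,
      abs_of_nonneg hθ, abs_mul]
    calc _ ≤ θ * (C * (64 * C * θ ^ 2)) := by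
          gcongr
          · exact hC.force_deriv _ (h.absX_le hQ hl)
          · exact h.X₁_le hC hθ hθ' hQ l hl
      _ = 64 * C ^ 2 * θ ^ 3 := by ring

theorem X₁_expand (h : IsFreeMotion σ U θ e b Q₀ Y₀ X Y X₁ Y₁) (hσ : IsFormFactor σ)
    (hC : IsBound σ U R C) (hθ : 0 ≤ θ) (hθ' : 32 * C ^ 2 * θ ≤ 1) (hQ : |Q₀| ≤ R) :
    ∀ l ∈ Icc (0 : ℝ) 2, |X₁ l + θ ^ 2 * K0 σ e b l| ≤ 4096 * C ^ 2 * θ ^ 4 := by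
  have hC1 := hC.one_le
  have key := norm_le_of_norm_deriv_le_const (h := fun l => X₁ l + θ ^ 2 * K0 σ e b l)
    (ε := 512 * C ^ 2 * θ ^ 4) (by positivity)
    (fun l hl => (h.derivX₁ l hl).add ((hasDerivAt_K0 hσ l).const_mul (θ ^ 2)).hasDerivWithinAt)
    (by simp [h.initX₁, K0]) fun l hl => ?_
  · intro l hl
    refine (key l hl).trans (le_of_eq ?_)
    ring
  · rw [Real.norm_eq_abs, show θ * Y₁ l + θ ^ 2 * L0 σ e b l = θ * (Y₁ l + θ * L0 σ e b l) by ring,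
      abs_mul, abs_of_nonneg hθ]
    calc _ ≤ θ * (512 * C ^ 2 * θ ^ 3) := by
          gcongr
          exact h.response_expand hσ hC hθ hθ' hQ l hl
      _ = 512 * C ^ 2 * θ ^ 4 := by ring

theorem response_expand_two (h : IsFreeMotion σ U θ e b Q₀ Y₀ X Y X₁ Y₁) (hσ : IsFormFactor σ)
    (hC : IsBound σ U R C) (hθ : 0 ≤ θ) (hθ' : 32 * C ^ 2 * θ ≤ 1) (hQ : |Q₀| ≤ R)
    (hY : |Y₀| ≤ R) :
    ∀ l ∈ Icc (0 : ℝ) 2, |Y₁ l + θ * L0 σ e b l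
      - θ ^ 3 * deriv (deriv U) Q₀ * ∫ x in (0 : ℝ)..l, K0 σ e b x| ≤ 40000 * C ^ 3 * θ ^ 4 := by
  have hC1 := hC.one_le
  have hθ1 : θ ≤ 1 := by nlinarith [one_le_pow₀ hC1 (n := 2)]
  have key := norm_le_of_norm_deriv_le_const (h := fun l => Y₁ l + θ * L0 σ e b l
      - θ ^ 3 * deriv (deriv U) Q₀ * ∫ x in (0 : ℝ)..l, K0 σ e b x)
    (ε := 5000 * C ^ 3 * θ ^ 4) (by positivity)
    (fun l hl => ((h.derivY₁ l hl).add ((hasDerivAt_L0 hσ l).const_mul θ).hasDerivWithinAt).sub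
      ((hasDerivAt_primitive (continuous_K0 hσ) l).const_mul
        (θ ^ 3 * deriv (deriv U) Q₀)).hasDerivWithinAt)
    (by simp [h.initY₁, L0]) fun l hl => ?_
  · intro l hl
    refine (key l hl).trans (le_of_eq ?_)
    ring
  · have h1 := hC.force_deriv _ (h.absX_le hQ hl)
    have h2 := h.X₁_expand hσ hC hθ hθ' hQ l hl
    have h3 := hC.force_deriv_lip Q₀ (X l) (by linarith) (h.absX_le hQ hl)
    have h4 := h.X_sub_init hC hθ hY l hl
    have h5 := abs_K0_le (e := e) (b := b) hσ hC l hl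
    rw [Real.norm_eq_abs, show -(θ * (deriv (deriv U) (X l) * X₁ l + σ (line e b l)))
      + θ * σ (line e b l) - θ ^ 3 * deriv (deriv U) Q₀ * K0 σ e b l
      = -(θ * (deriv (deriv U) (X l) * (X₁ l + θ ^ 2 * K0 σ e b l)
        - θ ^ 2 * K0 σ e b l * (deriv (deriv U) (X l) - deriv (deriv U) Q₀))) by ring, abs_neg,
      abs_mul, abs_of_nonneg hθ]
    calc _ ≤ θ * (C * (4096 * C ^ 2 * θ ^ 4) + θ ^ 2 * (64 * C) * (C * (8 * (C * θ)))) := by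
          gcongr
          refine (abs_sub _ _).trans (add_le_add ?_ ?_)
          · rw [abs_mul]
            gcongr
          · rw [abs_mul, abs_mul, abs_of_nonneg (sq_nonneg θ)]
            gcongr
            exact h3.trans (by gcongr)
      _ = 4096 * C ^ 3 * θ ^ 4 * θ + 512 * C ^ 3 * θ ^ 4 := by ring
      _ ≤ 4096 * C ^ 3 * θ ^ 4 * 1 + 512 * C ^ 3 * θ ^ 4 := by gcongr
      _ ≤ 5000 * C ^ 3 * θ ^ 4 := by
          have : 0 ≤ C ^ 3 * θ ^ 4 := by positivity
          nlinarith

end IsFreeMotion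

/-! ### The expansion of the energy transfer in the coupling constant -/

/-- `∫₀ˡ f(x) ∇σ(b + (x - 1/2) e) dx`. -/
noncomputable def impulse {d : ℕ} (σ : Space d → ℝ) (e b : Space d) (f : ℝ → ℝ) (l : ℝ) : Space d :=
  ∫ x in (0 : ℝ)..l, f x • gradient σ (line e b x)

/-- `∫₀ˡ (l - x) f(x) ∇σ(b + (x - 1/2) e) dx`, the displacement of a particle caused by the force
`f(x) ∇σ(b + (x - 1/2) e)`. -/
noncomputable def deflection {d : ℕ} (σ : Space d → ℝ) (e b : Space d) (f : ℝ → ℝ) (l : ℝ) :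
    Space d :=
  l • impulse σ e b f l - impulse σ e b (fun x => x * f x) l

section Deflection

variable {d : ℕ} {σ : Space d → ℝ} {U : ℝ → ℝ} {R C : ℝ} {e b : Space d} {f g : ℝ → ℝ}

theorem continuous_gradient_line (hσ : IsFormFactor σ) :
    Continuous fun x => gradient σ (line e b x) :=
  hσ.continuous_gradient.comp (continuous_line e b)

theorem continuous_form_line (hσ : IsFormFactor σ) : Continuous fun x => σ (line e b x) :=
  hσ.continuous.comp (continuous_line e b)

theorem hasDerivAt_impulse (hσ : IsFormFactor σ) (hf : Continuous f) (l : ℝ) :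
    HasDerivAt (impulse σ e b f) (f l • gradient σ (line e b l)) l :=
  hasDerivAt_primitive (hf.smul (continuous_gradient_line hσ)) l

theorem hasDerivAt_deflection (hσ : IsFormFactor σ) (hf : Continuous f) (l : ℝ) :
    HasDerivAt (deflection σ e b f) (impulse σ e b f l) l := by
  refine (((hasDerivAt_id l).smul (hasDerivAt_impulse hσ hf l)).sub
    (hasDerivAt_impulse hσ (continuous_id.mul hf) l)).congr_deriv ?_
  simp only [id, one_smul, smul_smul, Pi.mul_apply]
  abel

theorem continuous_deflection (hσ : IsFormFactor σ) (hf : Continuous f) :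
    Continuous (deflection σ e b f) :=
  continuous_iff_continuousAt.2 fun l => (hasDerivAt_deflection hσ hf l).continuousAt

@[simp] theorem impulse_zero : impulse σ e b f 0 = 0 := by simp [impulse]

@[simp] theorem deflection_zero : deflection σ e b f 0 = 0 := by simp [deflection]

theorem impulse_sub (hσ : IsFormFactor σ) (hf : Continuous f) (hg : Continuous g) (l : ℝ) :
    impulse σ e b (fun x => f x - g x) l = impulse σ e b f l - impulse σ e b g l := by
  simp only [impulse, sub_smul]
  exact intervalIntegral.integral_sub
    ((hf.smul (continuous_gradient_line hσ)).intervalIntegrable _ _)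
    ((hg.smul (continuous_gradient_line hσ)).intervalIntegrable _ _)

theorem impulse_const_mul (c : ℝ) (l : ℝ) :
    impulse σ e b (fun x => c * f x) l = c • impulse σ e b f l := by
  simp only [impulse, mul_smul]
  exact intervalIntegral.integral_smul _ _

theorem deflection_sub (hσ : IsFormFactor σ) (hf : Continuous f) (hg : Continuous g) (l : ℝ) :
    deflection σ e b (fun x => f x - g x) l = deflection σ e b f l - deflection σ e b g l := by
  have hxf : Continuous fun x => x * f x := continuous_id.mul hf
  have hxg : Continuous fun x => x * g x := continuous_id.mul hg
  simp only [deflection, mul_sub]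
  rw [impulse_sub hσ hf hg, impulse_sub hσ hxf hxg, smul_sub]
  abel

theorem deflection_const_mul (c : ℝ) (l : ℝ) :
    deflection σ e b (fun x => c * f x) l = c • deflection σ e b f l := by
  simp only [deflection, mul_left_comm _ c]
  rw [impulse_const_mul, impulse_const_mul, smul_sub, smul_comm]

theorem norm_deflection_le (hσ : IsFormFactor σ) (hC : IsBound σ U R C) (hf : Continuous f)
    {c : ℝ} (hc : 0 ≤ c) (hfc : ∀ x ∈ Icc (0 : ℝ) 2, |f x| ≤ c) :
    ∀ l ∈ Icc (0 : ℝ) 2, ‖deflection σ e b f l‖ ≤ 64 * (c * C) := by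
  have hC1 := hC.one_le
  have key := norm_le_of_norm_deriv_le_const (ε := c * C) (by positivity)
    (fun l _ => (hasDerivAt_impulse (e := e) (b := b) hσ hf l).hasDerivWithinAt) impulse_zero
    fun l hl => by
      rw [norm_smul]
      exact mul_le_mul (hfc l hl) (hC.grad _) (norm_nonneg _) hc
  have key2 := norm_le_of_norm_deriv_le_const (ε := 8 * (c * C)) (by positivity)
    (fun l _ => (hasDerivAt_deflection (e := e) (b := b) hσ hf l).hasDerivWithinAt)
    deflection_zero key
  intro l hl
  refine (key2 l hl).trans (le_of_eq ?_)
  ring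

end Deflection

section Perturbation

variable {d : ℕ} {σ : Space d → ℝ} {U : ℝ → ℝ} {R C α η θ Q₀ Y₀ : ℝ} {e b : Space d}
  {q w : ℝ → Space d} {Q y X Y X₁ Y₁ : ℝ → ℝ}

theorem IsMotion.pos_sub_line (h : IsMotion σ U (α * η ^ 2) (θ ^ 2) (α * θ ^ 2) e b Q₀ (θ * Y₀)
      q w Q y)
    (hC : IsBound σ U R C) (hα : 0 ≤ α) (hQ : |Q₀| ≤ R) :
    ∀ l ∈ Icc (0 : ℝ) 2, ‖q l - line e b l‖ ≤ 64 * (C ^ 2 * (α * η ^ 2)) := by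
  have hC1 := hC.one_le
  have hγ : 0 ≤ α * η ^ 2 := by positivity
  have key := norm_le_of_norm_deriv_le_const (h := fun l => w l - e)
    (ε := C ^ 2 * (α * η ^ 2)) (by positivity)
    (fun l hl => (h.vel_deriv l hl).sub_const e) (by simp [h.vel_init]) fun l hl => by
      have h3 := (h.abs_disp_le hQ hl).trans hC.radius_le
      rw [norm_smul, norm_neg, Real.norm_eq_abs, abs_mul, abs_of_nonneg hγ]
      calc _ ≤ (α * η ^ 2) * C * C := by
            gcongr
            exact hC.grad _
        _ = _ := by ring
  have key2 := norm_le_of_norm_deriv_le_const (h := fun l => q l - line e b l)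
    (ε := 8 * (C ^ 2 * (α * η ^ 2))) (by positivity)
    (fun l hl => (h.pos_deriv l hl).sub ((((hasDerivAt_id l).sub_const (1 / 2)).smul_const
      e).const_add b |>.congr_deriv (one_smul ℝ e)).hasDerivWithinAt)
    (by simp [h.pos_init, line, sub_eq_add_neg]) key
  intro l hl
  refine (key2 l hl).trans (le_of_eq ?_)
  ring

theorem IsMotion.scatterer_sub (h : IsMotion σ U (α * η ^ 2) (θ ^ 2) (α * θ ^ 2) e b Q₀ (θ * Y₀)
      q w Q y) (hf : IsFreeMotion σ U θ e b Q₀ Y₀ X Y X₁ Y₁)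
    (hC : IsBound σ U R C) (hα : 0 ≤ α) (hθ : 0 < θ) (hθ' : 32 * C ^ 2 * θ ≤ 1) (hQ : |Q₀| ≤ R) :
    ∀ l ∈ Icc (0 : ℝ) 2, |Q l - X l| ≤ α ∧ |y l / θ - Y l| ≤ α := by
  have hC1 := hC.one_le
  have hCθ : 32 * (C * θ) ≤ 1 := by nlinarith [mul_nonneg (by linarith : 0 ≤ C) hθ.le]
  have key := norm_le_of_norm_deriv_le (h := fun l => (Q l - X l, y l / θ - Y l))
    (ε := C * θ * α) (by positivity)
    (fun l hl => ((h.disp_deriv l hl).sub (hf.derivX l hl)).prodMk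
      (((h.mom_deriv l hl).div_const θ).sub (hf.derivY l hl)))
    (by simp [h.disp_init, h.mom_init, hf.initX, hf.initY, hθ.ne']) fun l hl => ?_
  · intro l hl
    have hk := norm_prod_le_iff.1 (key l hl)
    have h8 : 8 * (C * θ * α) ≤ α := by nlinarith
    exact ⟨hk.1.trans h8, hk.2.trans h8⟩
  · set N := ‖(Q l - X l, y l / θ - Y l)‖ with hN
    have hx : |Q l - X l| ≤ N := norm_fst_le (Q l - X l, y l / θ - Y l)
    have hy : |y l / θ - Y l| ≤ N := norm_snd_le (Q l - X l, y l / θ - Y l)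
    have hn : 0 ≤ N := norm_nonneg _
    have h1 := hC.force_lip (X l) (Q l) (hf.absX_le hQ hl) (h.abs_disp_le hQ hl)
    have h2 := hC.form (q l)
    refine norm_prod_le_iff.2 ⟨?_, ?_⟩
    · simp only
      rw [Real.norm_eq_abs, show y l - θ * Y l = θ * (y l / θ - Y l) by field_simp, abs_mul,
        abs_of_pos hθ]
      have : 0 ≤ C * θ * α := by positivity
      have hθ1 : θ ≤ 1 := by nlinarith [one_le_pow₀ hC1 (n := 2)]
      calc θ * |y l / θ - Y l| ≤ 1 * N := by gcongr
        _ ≤ N + C * θ * α := by linarith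
    · simp only
      rw [Real.norm_eq_abs, show (-(θ ^ 2 * deriv U (Q l)) - α * θ ^ 2 * σ (q l)) / θ
        - -(θ * deriv U (X l)) = -(θ * ((deriv U (Q l) - deriv U (X l)) + α * σ (q l))) by
          field_simp; ring, abs_neg, abs_mul, abs_of_pos hθ]
      calc _ ≤ θ * (C * N + α * C) := by
            gcongr
            refine (abs_add_le _ _).trans (add_le_add (h1.trans (by gcongr)) ?_)
            rw [abs_mul, abs_of_nonneg hα]
            gcongr
        _ ≤ N + C * θ * α := by nlinarith

theorem IsMotion.form_sub (h : IsMotion σ U (α * η ^ 2) (θ ^ 2) (α * θ ^ 2) e b Q₀ (θ * Y₀)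
      q w Q y)
    (hC : IsBound σ U R C) (hα : 0 ≤ α) (hη : 0 ≤ η) (hη1 : η ≤ 1) (hQ : |Q₀| ≤ R) :
    ∀ l ∈ Icc (0 : ℝ) 2, |σ (q l) - σ (line e b l)| ≤ 64 * C ^ 3 * α := by
  intro l hl
  have hC1 := hC.one_le
  have h1 := h.pos_sub_line hC hα hQ l hl
  calc _ ≤ C * ‖q l - line e b l‖ := hC.form_lip _ _
    _ ≤ C * (64 * (C ^ 2 * (α * 1 ^ 2))) := by
      gcongr
      exact h1.trans (by gcongr)
    _ = _ := by ring

theorem IsMotion.mom_expand (h : IsMotion σ U (α * η ^ 2) (θ ^ 2) (α * θ ^ 2) e b Q₀ (θ * Y₀)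
      q w Q y) (hf : IsFreeMotion σ U θ e b Q₀ Y₀ X Y X₁ Y₁)
    (hC : IsBound σ U R C) (hα : 0 ≤ α) (hη : 0 ≤ η) (hη1 : η ≤ 1)
    (hθ : 0 < θ) (hθ' : 32 * C ^ 2 * θ ≤ 1) (hQ : |Q₀| ≤ R) :
    ∀ l ∈ Icc (0 : ℝ) 2, |y l / θ - Y l - α * Y₁ l| ≤ 520 * C ^ 3 * α ^ 2 := by
  have hC1 := hC.one_le
  have hCθ : 32 * (C * θ) ≤ 1 := by nlinarith [mul_nonneg (by linarith : 0 ≤ C) hθ.le]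
  have hθ1 : θ ≤ 1 := by nlinarith [one_le_pow₀ hC1 (n := 2)]
  have key := norm_le_of_norm_deriv_le
    (h := fun l => (Q l - X l - α * X₁ l, y l / θ - Y l - α * Y₁ l))
    (ε := 65 * C ^ 3 * α ^ 2) (by positivity)
    (fun l hl => (((h.disp_deriv l hl).sub (hf.derivX l hl)).sub
        ((hf.derivX₁ l hl).const_mul α)).prodMk
      ((((h.mom_deriv l hl).div_const θ).sub (hf.derivY l hl)).sub
        ((hf.derivY₁ l hl).const_mul α)))
    (by simp [h.disp_init, h.mom_init, hf.initX, hf.initY, hf.initX₁, hf.initY₁, hθ.ne'])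
    fun l hl => ?_
  · intro l hl
    refine (norm_prod_le_iff.1 (key l hl)).2.trans (le_of_eq ?_)
    ring
  · set N := ‖(Q l - X l - α * X₁ l, y l / θ - Y l - α * Y₁ l)‖ with hN
    have hx : |Q l - X l - α * X₁ l| ≤ N :=
      norm_fst_le (Q l - X l - α * X₁ l, y l / θ - Y l - α * Y₁ l)
    have hy : |y l / θ - Y l - α * Y₁ l| ≤ N :=
      norm_snd_le (Q l - X l - α * X₁ l, y l / θ - Y l - α * Y₁ l)
    have hn : 0 ≤ N := norm_nonneg _
    have h1 := hC.force_taylor (X l) (Q l) (hf.absX_le hQ hl) (h.abs_disp_le hQ hl)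
    have h2 := h.form_sub hC hα hη hη1 hQ l hl
    have h3 := (h.scatterer_sub hf hC hα hθ hθ' hQ l hl).1
    have h4 := hC.force_deriv _ (hf.absX_le hQ hl)
    refine norm_prod_le_iff.2 ⟨?_, ?_⟩
    · simp only
      rw [Real.norm_eq_abs, show y l - θ * Y l - α * (θ * Y₁ l)
        = θ * (y l / θ - Y l - α * Y₁ l) by field_simp, abs_mul, abs_of_pos hθ]
      have : 0 ≤ 65 * C ^ 3 * α ^ 2 := by positivity
      nlinarith
    · simp only
      rw [Real.norm_eq_abs, show (-(θ ^ 2 * deriv U (Q l)) - α * θ ^ 2 * σ (q l)) / θ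
        - -(θ * deriv U (X l))
        - α * -(θ * (deriv (deriv U) (X l) * X₁ l + σ (line e b l)))
        = -(θ * ((deriv U (Q l) - deriv U (X l) - deriv (deriv U) (X l) * (Q l - X l))
          + deriv (deriv U) (X l) * (Q l - X l - α * X₁ l)
          + α * (σ (q l) - σ (line e b l)))) by
          field_simp; ring, abs_neg, abs_mul, abs_of_pos hθ]
      calc _ ≤ θ * (C * α ^ 2 + C * N + α * (64 * C ^ 3 * α)) := by
            gcongr
            refine (abs_add_le _ _).trans (add_le_add ((abs_add_le _ _).trans
              (add_le_add (h1.trans (by gcongr)) ?_)) ?_)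
            · rw [abs_mul]
              gcongr
            · rw [abs_mul, abs_of_nonneg hα]
              gcongr
        _ = (C * θ) * N + θ * (C ^ 1 * α ^ 2 + 64 * C ^ 3 * α ^ 2) := by ring
        _ ≤ 1 * N + 1 * (C ^ 3 * α ^ 2 + 64 * C ^ 3 * α ^ 2) := by
            gcongr
            · linarith
            · norm_num
        _ = N + 65 * C ^ 3 * α ^ 2 := by ring

theorem IsMotion.pos_expand (h : IsMotion σ U (α * η ^ 2) (θ ^ 2) (α * θ ^ 2) e b Q₀ (θ * Y₀)
      q w Q y) (hf : IsFreeMotion σ U θ e b Q₀ Y₀ X Y X₁ Y₁) (hσ : IsFormFactor σ)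
    (hC : IsBound σ U R C) (hα : 0 ≤ α) (hη : 0 ≤ η) (hη1 : η ≤ 1)
    (hθ : 0 < θ) (hθ' : 32 * C ^ 2 * θ ≤ 1) (hQ : |Q₀| ≤ R) :
    ∀ l ∈ Icc (0 : ℝ) 2, ‖q l - line e b l + (α * η ^ 2) • deflection σ e b X l‖
      ≤ 4160 * C ^ 4 * α ^ 2 := by
  have hC1 := hC.one_le
  have hγ : 0 ≤ α * η ^ 2 := by positivity
  have hγα : α * η ^ 2 ≤ α := mul_le_of_le_one_right hα (pow_le_one₀ hη hη1)
  have key := norm_le_of_norm_deriv_le_const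
    (h := fun l => w l - e + (α * η ^ 2) • impulse σ e b X l)
    (ε := 65 * C ^ 4 * α ^ 2) (by positivity)
    (fun l hl => ((h.vel_deriv l hl).sub_const e).add
      ((hasDerivAt_impulse hσ hf.contX l).const_smul (α * η ^ 2)).hasDerivWithinAt)
    (by simp [h.vel_init]) fun l hl => by
      have h1 := (h.scatterer_sub hf hC hα hθ hθ' hQ l hl).1
      have h2 := (hf.absX_le hQ hl).trans hC.radius_le
      have h3 := hC.grad (q l)
      have h4 := hC.grad_lip (line e b l) (q l)
      have h5 := h.pos_sub_line hC hα hQ l hl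
      rw [show -(α * η ^ 2 * Q l) • gradient σ (q l)
          + (α * η ^ 2) • X l • gradient σ (line e b l)
        = -((α * η ^ 2) • ((Q l - X l) • gradient σ (q l)
          + X l • (gradient σ (q l) - gradient σ (line e b l)))) by module, norm_neg, norm_smul,
        Real.norm_of_nonneg hγ]
      calc _ ≤ α * (α * C + C * (C * (64 * (C ^ 2 * α)))) := by
            gcongr
            refine (norm_add_le _ _).trans (add_le_add ?_ ?_)
            · rw [norm_smul, Real.norm_eq_abs]
              gcongr
            · rw [norm_smul, Real.norm_eq_abs]
              gcongr
              refine h4.trans ?_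
              gcongr
              exact h5.trans (by gcongr)
        _ = C ^ 1 * α ^ 2 + 64 * C ^ 4 * α ^ 2 := by ring
        _ ≤ C ^ 4 * α ^ 2 + 64 * C ^ 4 * α ^ 2 := by
            gcongr
            norm_num
        _ = _ := by ring
  have key2 := norm_le_of_norm_deriv_le_const
    (h := fun l => q l - line e b l + (α * η ^ 2) • deflection σ e b X l)
    (ε := 8 * (65 * C ^ 4 * α ^ 2)) (by positivity)
    (fun l hl => ((h.pos_deriv l hl).sub ((((hasDerivAt_id l).sub_const (1 / 2)).smul_const
      e).const_add b |>.congr_deriv (one_smul ℝ e)).hasDerivWithinAt).add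
      ((hasDerivAt_deflection hσ hf.contX l).const_smul (α * η ^ 2)).hasDerivWithinAt)
    (by simp [h.pos_init, line, sub_eq_add_neg]) key
  intro l hl
  refine (key2 l hl).trans (le_of_eq ?_)
  ring

/-- The work of the interaction on the scatterer, to second order in the coupling constant, with
`η = 1 / ‖p‖` and `θ = 1 / (√M ‖p‖)`. -/
theorem IsMotion.work_expand (h : IsMotion σ U (α * η ^ 2) (θ ^ 2) (α * θ ^ 2) e b Q₀ (θ * Y₀)
      q w Q y) (hf : IsFreeMotion σ U θ e b Q₀ Y₀ X Y X₁ Y₁) (hσ : IsFormFactor σ)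
    (hC : IsBound σ U R C) (hα : 0 ≤ α) (hη : 0 ≤ η) (hη1 : η ≤ 1)
    (hθ : 0 < θ) (hθ' : 32 * C ^ 2 * θ ≤ 1) (hQ : |Q₀| ≤ R) (hY : |Y₀| ≤ R) :
    |(∫ l in (0 : ℝ)..2, y l * σ (q l)) - θ * ((∫ l in (0 : ℝ)..2, Y l * σ (line e b l))
      + α * ((∫ l in (0 : ℝ)..2, Y₁ l * σ (line e b l))
        - η ^ 2 * ∫ l in (0 : ℝ)..2, Y l * ⟪gradient σ (line e b l), deflection σ e b X l⟫))|
      ≤ 20000 * C ^ 6 * α ^ 2 * θ := by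
  have hC1 := hC.one_le
  have hθ1 : θ ≤ 1 := by nlinarith [one_le_pow₀ hC1 (n := 2)]
  have hγ : 0 ≤ α * η ^ 2 := by positivity
  have hγα : α * η ^ 2 ≤ α := mul_le_of_le_one_right hα (pow_le_one₀ hη hη1)
  have hσq : ContinuousOn (fun x => σ (q x)) (Icc 0 2) :=
    hσ.continuous.comp_continuousOn h.continuousOn_pos
  have hu : uIcc (0 : ℝ) 2 = Icc 0 2 := uIcc_of_le (by norm_num)
  have hc1 : ContinuousOn (fun x => y x * σ (q x)) (uIcc 0 2) := by
    rw [hu]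
    exact h.continuousOn_mom.mul hσq
  have hs := continuous_form_line (e := e) (b := b) hσ
  have hg := continuous_gradient_line (e := e) (b := b) hσ
  have hdfl := continuous_deflection (e := e) (b := b) hσ hf.contX
  have hc2 : Continuous fun l => Y l * σ (line e b l) := hf.contY.mul hs
  have hc3 : Continuous fun l => Y₁ l * σ (line e b l) := hf.contY₁.mul hs
  have hc4 : Continuous fun l => Y l * ⟪gradient σ (line e b l), deflection σ e b X l⟫ :=
    hf.contY.mul (hg.inner hdfl)
  have hc5 : Continuous fun l => Y₁ l * σ (line e b l)
      - η ^ 2 * (Y l * ⟪gradient σ (line e b l), deflection σ e b X l⟫) :=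
    hc3.sub (hc4.const_mul _)
  have hc6 : Continuous fun l => Y l * σ (line e b l) + α * (Y₁ l * σ (line e b l)
      - η ^ 2 * (Y l * ⟪gradient σ (line e b l), deflection σ e b X l⟫)) :=
    hc2.add (hc5.const_mul _)
  rw [← intervalIntegral.integral_const_mul, ← intervalIntegral.integral_sub
    (hc3.intervalIntegrable _ _) ((hc4.const_mul _).intervalIntegrable _ _),
    ← intervalIntegral.integral_const_mul, ← intervalIntegral.integral_add
    (hc2.intervalIntegrable _ _) ((hc5.const_mul _).intervalIntegrable _ _),
    ← intervalIntegral.integral_const_mul, ← intervalIntegral.integral_sub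
    hc1.intervalIntegrable ((hc6.const_mul _).intervalIntegrable _ _)]
  have hbound := intervalIntegral.norm_integral_le_of_norm_le_const (a := (0 : ℝ)) (b := 2)
    (f := fun l => y l * σ (q l) - θ * (Y l * σ (line e b l) + α * (Y₁ l * σ (line e b l)
      - η ^ 2 * (Y l * ⟪gradient σ (line e b l), deflection σ e b X l⟫))))
    (C := 10000 * C ^ 6 * α ^ 2 * θ) fun l hl => ?_
  · refine hbound.trans (le_of_eq ?_)
    norm_num
    ring
  · rw [uIoc_of_le (by norm_num)] at hl
    replace hl : l ∈ Icc (0 : ℝ) 2 := Ioc_subset_Icc_self hl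
    have h1 := h.mom_expand hf hC hα hη hη1 hθ hθ' hQ l hl
    have h2 := hC.form (q l)
    have h3 := h.form_sub hC hα hη hη1 hQ l hl
    have h4 : |Y₁ l| ≤ 1 := by
      have := hf.response_le hC hθ.le hθ' hQ l hl
      nlinarith [mul_nonneg (by linarith : 0 ≤ C) hθ.le]
    have h5 := hC.form_taylor (line e b l) (q l)
    have h6 := h.pos_sub_line hC hα hQ l hl
    have h7 := h.pos_expand hf hσ hC hα hη hη1 hθ hθ' hQ l hl
    have h8 := hC.grad (line e b l)
    have h9 := hf.absY_le hC hY hl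
    have hid : y l * σ (q l) - θ * (Y l * σ (line e b l) + α * (Y₁ l * σ (line e b l)
        - η ^ 2 * (Y l * ⟪gradient σ (line e b l), deflection σ e b X l⟫)))
      = θ * ((y l / θ - Y l - α * Y₁ l) * σ (q l) + α * Y₁ l * (σ (q l) - σ (line e b l))
        + Y l * ((σ (q l) - σ (line e b l) - ⟪gradient σ (line e b l), q l - line e b l⟫)
          + ⟪gradient σ (line e b l),
              q l - line e b l + (α * η ^ 2) • deflection σ e b X l⟫)) := by
      rw [inner_add_right, real_inner_smul_right]
      field_simp
      ring
    rw [hid, Real.norm_eq_abs, abs_mul, abs_of_pos hθ, mul_comm]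
    gcongr
    calc _ ≤ 520 * C ^ 3 * α ^ 2 * C + α * 1 * (64 * C ^ 3 * α)
          + C * (C * (64 * (C ^ 2 * α)) ^ 2 + C * (4160 * C ^ 4 * α ^ 2)) := by
          refine (abs_add_le _ _).trans (add_le_add ((abs_add_le _ _).trans (add_le_add ?_ ?_)) ?_)
          · rw [abs_mul]
            gcongr
          · rw [abs_mul, abs_mul, abs_of_nonneg hα]
            gcongr
          · rw [abs_mul]
            gcongr
            refine (abs_add_le _ _).trans (add_le_add (h5.trans ?_) ?_)
            · gcongr
              exact h6.trans (by gcongr)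
            · refine (abs_real_inner_le_norm _ _).trans ?_
              gcongr
      _ = 520 * C ^ 4 * α ^ 2 + 64 * C ^ 3 * α ^ 2 + 8256 * C ^ 6 * α ^ 2 := by ring
      _ ≤ 520 * C ^ 6 * α ^ 2 + 64 * C ^ 6 * α ^ 2 + 8256 * C ^ 6 * α ^ 2 := by
          gcongr <;> norm_num
      _ ≤ 10000 * C ^ 6 * α ^ 2 := by
          have : 0 ≤ C ^ 6 * α ^ 2 := by positivity
          linarith

end Perturbation

/-! ### The expansion of the coefficients in the inverse speed -/

/-- `∫₀¹ lᵏ σ(b + (l - 1/2) e) dl`. -/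
noncomputable def formMoment {d : ℕ} (σ : Space d → ℝ) (e b : Space d) (k : ℕ) : ℝ :=
  ∫ l in (0 : ℝ)..1, l ^ k * σ (line e b l)

/-- `∫₀¹ dl ∫₀ˡ dx (l - x) lʲ xᵏ ∇σ(b + (l - 1/2) e) · ∇σ(b + (x - 1/2) e)`. -/
noncomputable def gradMoment {d : ℕ} (σ : Space d → ℝ) (e b : Space d) (j k : ℕ) : ℝ :=
  ∫ l in (0 : ℝ)..1, l ^ j * ⟪gradient σ (line e b l), deflection σ e b (fun x => x ^ k) l⟫

/-- The main part, of zero mean, of the first order coefficient beyond `β⁽¹⁾`. -/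
noncomputable def meanZeroA {d : ℕ} (σ : Space d → ℝ) (U : ℝ → ℝ) (M s : ℝ) (e : Space d)
    (κ : Param d) : ℝ :=
  -(deriv U (disp κ) * formMoment σ e (impact κ) 1 / (√M * s ^ 2))
    - deriv (deriv U) (disp κ) * mom κ * formMoment σ e (impact κ) 2 / (2 * √M ^ 3 * s ^ 3)

/-- The part of zero mean of the second order coefficient. -/
noncomputable def meanZeroB {d : ℕ} (σ : Space d → ℝ) (s : ℝ) (e : Space d) (κ : Param d) : ℝ :=
  -(mom κ * disp κ * gradMoment σ e (impact κ) 0 0 / s ^ 3)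

/-- The coefficient `δβ⁽⁴⁾`: the elastic response of the scatterer, and the effect of the drift of
the scatterer on the deflection of the particle. -/
noncomputable def deltaBeta4 {d : ℕ} (σ : Space d → ℝ) (U : ℝ → ℝ) (M : ℝ) (e : Space d)
    (κ : Param d) : ℝ :=
  deriv (deriv U) (disp κ) * formIntegral σ e (impact κ) / M
    + deriv U (disp κ) * disp κ * gradMoment σ e (impact κ) 1 0
    - mom κ ^ 2 / M * gradMoment σ e (impact κ) 0 1

section Coefficients

variable {d : ℕ} {σ : Space d → ℝ} {U : ℝ → ℝ} {R C θ Q₀ Y₀ : ℝ} {e b : Space d}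
  {X Y X₁ Y₁ : ℝ → ℝ}

theorem integral_zero_two {f : ℝ → ℝ} (hf : Continuous f) (h : ∀ l, 1 ≤ l → f l = 0) :
    ∫ l in (0 : ℝ)..2, f l = ∫ l in (0 : ℝ)..1, f l := by
  rw [← intervalIntegral.integral_add_adjacent_intervals (b := 1) (hf.intervalIntegrable _ _)
    (hf.intervalIntegrable _ _), intervalIntegral.integral_congr (a := 1) (g := fun _ => 0),
    intervalIntegral.integral_zero, add_zero]
  intro l hl
  rw [uIcc_of_le (by norm_num)] at hl
  exact h l hl.1

theorem abs_integral_zero_one_le {f : ℝ → ℝ} {c : ℝ} (h : ∀ l ∈ Icc (0 : ℝ) 1, |f l| ≤ c) :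
    |∫ l in (0 : ℝ)..1, f l| ≤ c := by
  have := intervalIntegral.norm_integral_le_of_norm_le_const (a := (0 : ℝ)) (b := 1) (f := f)
    (C := c) fun l hl => by
      rw [uIoc_of_le (by norm_num)] at hl
      exact h l (Ioc_subset_Icc_self hl)
  simpa using this

theorem abs_integral_sub_combination_le {f u v w : ℝ → ℝ} (hf : Continuous f) (hu : Continuous u)
    (hv : Continuous v) (hw : Continuous w) {x y z ε : ℝ}
    (h : ∀ l ∈ Icc (0 : ℝ) 1, |f l - (x * u l + y * v l + z * w l)| ≤ ε) :
    |(∫ l in (0 : ℝ)..1, f l) - (x * (∫ l in (0 : ℝ)..1, u l) + y * (∫ l in (0 : ℝ)..1, v l)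
      + z * ∫ l in (0 : ℝ)..1, w l)| ≤ ε := by
  have huv : Continuous fun l => x * u l + y * v l := by fun_prop
  have huvw : Continuous fun l => x * u l + y * v l + z * w l := by fun_prop
  rw [← intervalIntegral.integral_const_mul, ← intervalIntegral.integral_const_mul,
    ← intervalIntegral.integral_const_mul,
    ← intervalIntegral.integral_add ((hu.const_mul x).intervalIntegrable _ _)
      ((hv.const_mul y).intervalIntegrable _ _),
    ← intervalIntegral.integral_add (huv.intervalIntegrable _ _)
      ((hw.const_mul z).intervalIntegrable _ _),
    ← intervalIntegral.integral_sub (hf.intervalIntegrable _ _) (huvw.intervalIntegrable _ _)]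
  exact abs_integral_zero_one_le h

theorem Icc_zero_one_subset : Icc (0 : ℝ) 1 ⊆ Icc 0 2 := Icc_subset_Icc_right (by norm_num)

theorem integral_form_mul_L0 (hσ : IsFormFactor σ) :
    ∫ l in (0 : ℝ)..1, L0 σ e b l * σ (line e b l) = L0 σ e b 1 ^ 2 / 2 := by
  have hs := continuous_form_line (e := e) (b := b) hσ
  have hL := IsFreeMotion.continuous_L0 (e := e) (b := b) hσ
  rw [intervalIntegral.integral_eq_sub_of_hasDerivAt (f := fun l => L0 σ e b l ^ 2 / 2)
    (f' := fun l => L0 σ e b l * σ (line e b l))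
    (fun l _ => (((IsFreeMotion.hasDerivAt_L0 hσ l).pow 2).div_const 2).congr_deriv
      (by simp; ring)) ((hL.mul hs).intervalIntegrable _ _)]
  simp [L0]

theorem IsFreeMotion.first_order (h : IsFreeMotion σ U θ e b Q₀ Y₀ X Y X₁ Y₁)
    (hσ : IsFormFactor σ) (hC : IsBound σ U R C) (hθ : 0 ≤ θ) (hQ : |Q₀| ≤ R) (hY : |Y₀| ≤ R)
    (he : ‖e‖ = 1) (heb : ⟪e, b⟫ = 0) :
    |(∫ l in (0 : ℝ)..2, Y l * σ (line e b l)) - (Y₀ * L0 σ e b 1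
      - θ * deriv U Q₀ * formMoment σ e b 1
      - θ ^ 2 * deriv (deriv U) Q₀ * Y₀ / 2 * formMoment σ e b 2)| ≤ 1024 * C ^ 4 * θ ^ 3 := by
  have hC1 := hC.one_le
  have hs := continuous_form_line (e := e) (b := b) hσ
  have hc1 : Continuous fun l : ℝ => l ^ 1 * σ (line e b l) := (continuous_pow 1).mul hs
  have hc2 : Continuous fun l : ℝ => l ^ 2 * σ (line e b l) := (continuous_pow 2).mul hs
  have hc3 : Continuous fun l => Y l * σ (line e b l) := h.contY.mul hs
  have hL : L0 σ e b 1 = ∫ l in (0 : ℝ)..1, σ (line e b l) := rfl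
  rw [integral_zero_two hc3 fun l hl => by rw [hσ.eq_zero (half_le_norm_line he heb hl), mul_zero],
    hL, show Y₀ * (∫ l in (0 : ℝ)..1, σ (line e b l)) - θ * deriv U Q₀ * formMoment σ e b 1
      - θ ^ 2 * deriv (deriv U) Q₀ * Y₀ / 2 * formMoment σ e b 2
      = Y₀ * (∫ l in (0 : ℝ)..1, σ (line e b l)) + -(θ * deriv U Q₀) * formMoment σ e b 1
      + -(θ ^ 2 * deriv (deriv U) Q₀ * Y₀ / 2) * formMoment σ e b 2 by ring]
  refine abs_integral_sub_combination_le hc3 hs hc1 hc2 fun l hl => ?_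
  have h1 := h.Y_expand_two hC hθ hQ hY l (Icc_zero_one_subset hl)
  have h2 := hC.form (line e b l)
  rw [show Y l * σ (line e b l) - (Y₀ * σ (line e b l)
      + -(θ * deriv U Q₀) * (l ^ 1 * σ (line e b l))
      + -(θ ^ 2 * deriv (deriv U) Q₀ * Y₀ / 2) * (l ^ 2 * σ (line e b l)))
    = (Y l - Y₀ + θ * deriv U Q₀ * l + θ ^ 2 * deriv (deriv U) Q₀ * Y₀ / 2 * l ^ 2)
      * σ (line e b l) by ring, abs_mul]
  calc _ ≤ 1024 * C ^ 3 * θ ^ 3 * C := by gcongr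
    _ = _ := by ring

theorem IsFreeMotion.second_order_response (h : IsFreeMotion σ U θ e b Q₀ Y₀ X Y X₁ Y₁)
    (hσ : IsFormFactor σ) (hC : IsBound σ U R C) (hθ : 0 ≤ θ) (hθ' : 32 * C ^ 2 * θ ≤ 1)
    (hQ : |Q₀| ≤ R) (hY : |Y₀| ≤ R) (he : ‖e‖ = 1) (heb : ⟪e, b⟫ = 0) :
    |(∫ l in (0 : ℝ)..2, Y₁ l * σ (line e b l)) - (-(θ * (L0 σ e b 1 ^ 2 / 2))
      + θ ^ 3 * deriv (deriv U) Q₀ * formIntegral σ e b)| ≤ 40000 * C ^ 4 * θ ^ 4 := by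
  have hC1 := hC.one_le
  have hs := continuous_form_line (e := e) (b := b) hσ
  have hK : Continuous fun l => ∫ x in (0 : ℝ)..l, K0 σ e b x :=
    continuous_iff_continuousAt.2 fun l =>
      (hasDerivAt_primitive (continuous_K0 hσ) l).continuousAt
  have hc1 : Continuous fun l : ℝ => L0 σ e b l * σ (line e b l) := (continuous_L0 hσ).mul hs
  have hc2 : Continuous fun l : ℝ => σ (line e b l) * ∫ x in (0 : ℝ)..l, K0 σ e b x := hs.mul hK
  have hc3 : Continuous fun l => Y₁ l * σ (line e b l) := h.contY₁.mul hs
  have hF : formIntegral σ e b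
    = ∫ l in (0 : ℝ)..1, σ (line e b l) * ∫ x in (0 : ℝ)..l, K0 σ e b x := rfl
  rw [integral_zero_two hc3 fun l hl => by rw [hσ.eq_zero (half_le_norm_line he heb hl), mul_zero],
    ← integral_form_mul_L0 hσ, hF,
    show -(θ * ∫ l in (0 : ℝ)..1, L0 σ e b l * σ (line e b l))
      = 0 * (∫ l in (0 : ℝ)..1, L0 σ e b l * σ (line e b l))
        + -θ * ∫ l in (0 : ℝ)..1, L0 σ e b l * σ (line e b l) by ring]
  refine abs_integral_sub_combination_le hc3 hc1 hc1 hc2 fun l hl => ?_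
  have h1 := h.response_expand_two hσ hC hθ hθ' hQ hY l (Icc_zero_one_subset hl)
  have h2 := hC.form (line e b l)
  rw [show Y₁ l * σ (line e b l) - (0 * (L0 σ e b l * σ (line e b l))
      + -θ * (L0 σ e b l * σ (line e b l))
      + θ ^ 3 * deriv (deriv U) Q₀ * (σ (line e b l) * ∫ x in (0 : ℝ)..l, K0 σ e b x))
    = (Y₁ l + θ * L0 σ e b l - θ ^ 3 * deriv (deriv U) Q₀ * ∫ x in (0 : ℝ)..l, K0 σ e b x)
      * σ (line e b l) by ring, abs_mul]
  calc _ ≤ 40000 * C ^ 3 * θ ^ 4 * C := by gcongr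
    _ = _ := by ring

theorem continuous_inner_deflection (hσ : IsFormFactor σ) {f : ℝ → ℝ} (hf : Continuous f) :
    Continuous fun l => ⟪gradient σ (line e b l), deflection σ e b f l⟫ :=
  (continuous_gradient_line hσ).inner (continuous_deflection hσ hf)

theorem abs_gradMoment_le (hσ : IsFormFactor σ) (hC : IsBound σ U R C) (j : ℕ) :
    |gradMoment σ e b j 0| ≤ 64 * C ^ 2 := by
  have hC1 := hC.one_le
  refine abs_integral_zero_one_le fun l hl => ?_
  have h1 := norm_deflection_le (e := e) (b := b) hσ hC (f := fun x => x ^ 0) (by fun_prop)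
    zero_le_one (fun x _ => by simp) l (Icc_zero_one_subset hl)
  have h2 := hC.grad (line e b l)
  rw [abs_mul]
  calc _ ≤ 1 * (C * (64 * (1 * C))) := by
        gcongr
        · rw [abs_of_nonneg (pow_nonneg hl.1 j)]
          exact pow_le_one₀ hl.1 hl.2
        · exact (abs_real_inner_le_norm _ _).trans (by gcongr)
    _ = _ := by ring

theorem IsFreeMotion.second_order_deflection (h : IsFreeMotion σ U θ e b Q₀ Y₀ X Y X₁ Y₁)
    (hσ : IsFormFactor σ) (hC : IsBound σ U R C) (hθ : 0 ≤ θ)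
    (hQ : |Q₀| ≤ R) (hY : |Y₀| ≤ R) (he : ‖e‖ = 1) (heb : ⟪e, b⟫ = 0) :
    |(∫ l in (0 : ℝ)..2, Y l * ⟪gradient σ (line e b l), deflection σ e b X l⟫)
      - (Y₀ * Q₀ * gradMoment σ e b 0 0 + θ * (Y₀ ^ 2 * gradMoment σ e b 0 1
        - deriv U Q₀ * Q₀ * gradMoment σ e b 1 0))| ≤ 13000 * C ^ 5 * θ ^ 2 := by
  have hC1 := hC.one_le
  have hp0 : Continuous fun x : ℝ => x ^ 0 := by fun_prop
  have hp1 : Continuous fun x : ℝ => x ^ 1 := by fun_prop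
  have hc0 : Continuous fun l => Y l * ⟪gradient σ (line e b l), deflection σ e b X l⟫ :=
    h.contY.mul (continuous_inner_deflection hσ h.contX)
  have hc1 : Continuous fun l =>
      l ^ 0 * ⟪gradient σ (line e b l), deflection σ e b (fun x => x ^ 0) l⟫ :=
    (continuous_pow 0).mul (continuous_inner_deflection hσ hp0)
  have hc2 : Continuous fun l =>
      l ^ 0 * ⟪gradient σ (line e b l), deflection σ e b (fun x => x ^ 1) l⟫ :=
    (continuous_pow 0).mul (continuous_inner_deflection hσ hp1)
  have hc3 : Continuous fun l =>
      l ^ 1 * ⟪gradient σ (line e b l), deflection σ e b (fun x => x ^ 0) l⟫ :=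
    (continuous_pow 1).mul (continuous_inner_deflection hσ hp0)
  rw [integral_zero_two hc0 fun l hl => by
      rw [hσ.gradient_eq_zero (half_le_norm_line he heb hl), inner_zero_left, mul_zero],
    show Y₀ * Q₀ * gradMoment σ e b 0 0 + θ * (Y₀ ^ 2 * gradMoment σ e b 0 1
        - deriv U Q₀ * Q₀ * gradMoment σ e b 1 0)
      = Y₀ * Q₀ * gradMoment σ e b 0 0 + θ * Y₀ ^ 2 * gradMoment σ e b 0 1
        + -(θ * (deriv U Q₀ * Q₀)) * gradMoment σ e b 1 0 by ring]
  refine abs_integral_sub_combination_le hc0 hc1 hc2 hc3 fun l hl => ?_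
  have hl2 := Icc_zero_one_subset hl
  have hG := hC.grad (line e b l)
  set D0 := deflection σ e b (fun x => x ^ 0) l with hD0
  set D1 := deflection σ e b (fun x => x ^ 1) l with hD1
  set DX := deflection σ e b X l with hDX
  set G := gradient σ (line e b l) with hGdef
  have hdX : ‖DX‖ ≤ 64 * (C * C) := norm_deflection_le hσ hC h.contX (by linarith)
    (fun x hx => (h.absX_le hQ hx).trans hC.radius_le) l hl2
  have hd1 : ‖D1‖ ≤ 64 * (2 * C) := norm_deflection_le hσ hC hp1 (by norm_num)
    (fun x hx => by rw [pow_one, abs_of_nonneg hx.1]; exact hx.2) l hl2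
  -- the error made by replacing the displacement by its first order expansion
  have herr : ‖DX - Q₀ • D0 - (θ * Y₀) • D1‖ ≤ 64 * (64 * C * θ ^ 2 * C) := by
    have hXc : Continuous fun x => X x - Q₀ * x ^ 0 := h.contX.sub (hp0.const_mul Q₀)
    have : deflection σ e b (fun x => X x - Q₀ * x ^ 0 - θ * Y₀ * x ^ 1) l
        = DX - Q₀ • D0 - (θ * Y₀) • D1 := by
      rw [deflection_sub hσ hXc (hp1.const_mul (θ * Y₀)),
        deflection_sub hσ h.contX (hp0.const_mul Q₀), deflection_const_mul, deflection_const_mul]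
    rw [← this]
    refine norm_deflection_le hσ hC (hXc.sub (hp1.const_mul (θ * Y₀))) (by positivity)
      (fun x hx => ?_) l hl2
    have := h.X_expand hC hθ hQ x hx
    simpa using this
  have hYerr := h.Y_expand hC hθ hQ hY l hl2
  have hY' : |Y l| ≤ C := h.absY_le hC hY hl2
  have hU' : |deriv U Q₀| ≤ C := hC.force _ (by linarith)
  have hQC : |Q₀| ≤ C := by linarith [hC.radius_le]
  have hYC : |Y₀| ≤ C := by linarith [hC.radius_le]
  have hd0 : ‖D0‖ ≤ 64 * (1 * C) := norm_deflection_le hσ hC hp0 (by norm_num)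
    (fun x _ => by simp) l hl2
  have hYl : |Y l - Y₀| ≤ 8 * (C * θ) := h.Y_sub_init hC hθ hQ l hl2
  have hid : Y l * ⟪G, DX⟫ - (Y₀ * Q₀ * (l ^ 0 * ⟪G, D0⟫) + θ * Y₀ ^ 2 * (l ^ 0 * ⟪G, D1⟫)
      + -(θ * (deriv U Q₀ * Q₀)) * (l ^ 1 * ⟪G, D0⟫))
      = Y l * ⟪G, DX - Q₀ • D0 - (θ * Y₀) • D1⟫
        + (Y l - Y₀ + θ * deriv U Q₀ * l) * (Q₀ * ⟪G, D0⟫)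
        + (Y l - Y₀) * (θ * Y₀ * ⟪G, D1⟫) := by
    rw [inner_sub_right, inner_sub_right, real_inner_smul_right, real_inner_smul_right]
    ring
  rw [hid]
  have i0 : |⟪G, D0⟫| ≤ C * (64 * (1 * C)) :=
    (abs_real_inner_le_norm _ _).trans (by gcongr)
  have i1 : |⟪G, D1⟫| ≤ C * (64 * (2 * C)) :=
    (abs_real_inner_le_norm _ _).trans (by gcongr)
  have i2 : |⟪G, DX - Q₀ • D0 - (θ * Y₀) • D1⟫| ≤ C * (64 * (64 * C * θ ^ 2 * C)) :=
    (abs_real_inner_le_norm _ _).trans (by gcongr)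
  calc _ ≤ C * (C * (64 * (64 * C * θ ^ 2 * C))) + 64 * C ^ 2 * θ ^ 2 * (C * (C * (64 * (1 * C))))
        + 8 * (C * θ) * (θ * C * (C * (64 * (2 * C)))) := by
        refine (abs_add_le _ _).trans (add_le_add ((abs_add_le _ _).trans (add_le_add ?_ ?_)) ?_)
        · rw [abs_mul]
          gcongr
        · rw [abs_mul, abs_mul]
          gcongr
        · rw [abs_mul, abs_mul, abs_mul, abs_of_nonneg hθ]
          gcongr
    _ = 5120 * C ^ 4 * θ ^ 2 + 4096 * C ^ 5 * θ ^ 2 := by ring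
    _ ≤ 5120 * C ^ 5 * θ ^ 2 + 4096 * C ^ 5 * θ ^ 2 := by
        gcongr
        norm_num
    _ ≤ 13000 * C ^ 5 * θ ^ 2 := by
        have : 0 ≤ C ^ 5 * θ ^ 2 := by positivity
        linarith

end Coefficients

/-! ### Dependence on the direction of incidence -/

section Direction

variable {d : ℕ} {σ : Space d → ℝ} {U : ℝ → ℝ} {e e' b : Space d}

theorem line_map (g : Space d ≃ₗᵢ[ℝ] Space d) (hge : g e = e') (hgb : g b = b) (l : ℝ) :
    line e' b l = g (line e b l) := by
  rw [line, line, map_add, map_smul, hge, hgb]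

theorem form_line_eq (hσ : IsFormFactor σ) (hee : ‖e‖ = ‖e'‖) (he : ⟪e, b⟫ = 0)
    (he' : ⟪e', b⟫ = 0) (l : ℝ) : σ (line e' b l) = σ (line e b l) := by
  obtain ⟨g, hge, hgb⟩ := exists_isometry hee he he'
  rw [line_map g hge hgb, hσ.comp_isometry]

theorem L0_eq (hσ : IsFormFactor σ) (hee : ‖e‖ = ‖e'‖) (he : ⟪e, b⟫ = 0)
    (he' : ⟪e', b⟫ = 0) (l : ℝ) : L0 σ e' b l = L0 σ e b l :=
  intervalIntegral.integral_congr fun x _ => form_line_eq hσ hee he he' x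

theorem K0_eq (hσ : IsFormFactor σ) (hee : ‖e‖ = ‖e'‖) (he : ⟪e, b⟫ = 0)
    (he' : ⟪e', b⟫ = 0) (l : ℝ) : K0 σ e' b l = K0 σ e b l :=
  intervalIntegral.integral_congr fun x _ => L0_eq hσ hee he he' x

theorem formIntegral_eq (hσ : IsFormFactor σ) (hee : ‖e‖ = ‖e'‖) (he : ⟪e, b⟫ = 0)
    (he' : ⟪e', b⟫ = 0) : formIntegral σ e' b = formIntegral σ e b := by
  refine intervalIntegral.integral_congr fun x _ => ?_
  have h1 := form_line_eq hσ hee he he' x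
  simp only [line] at h1
  simp only [h1, K0_eq hσ hee he he']

theorem formMoment_eq (hσ : IsFormFactor σ) (hee : ‖e‖ = ‖e'‖) (he : ⟪e, b⟫ = 0)
    (he' : ⟪e', b⟫ = 0) (k : ℕ) : formMoment σ e' b k = formMoment σ e b k := by
  refine intervalIntegral.integral_congr fun x _ => ?_
  simp only [form_line_eq hσ hee he he' x]

theorem gradMoment_eq (hσ : IsFormFactor σ) (hee : ‖e‖ = ‖e'‖) (he : ⟪e, b⟫ = 0)
    (he' : ⟪e', b⟫ = 0) (j k : ℕ) : gradMoment σ e' b j k = gradMoment σ e b j k := by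
  obtain ⟨g, hge, hgb⟩ := exists_isometry hee he he'
  have himp : ∀ f : ℝ → ℝ, Continuous f → ∀ l, impulse σ e' b f l = g (impulse σ e b f l) := by
    intro f hf l
    have := (g.toContinuousLinearEquiv : Space d →L[ℝ] Space d).intervalIntegral_comp_comm
      ((hf.smul (continuous_gradient_line (e := e) (b := b) hσ)).intervalIntegrable
        (μ := volume) 0 l)
    refine Eq.trans (intervalIntegral.integral_congr fun x _ => ?_) this
    simp only [line_map g hge hgb, hσ.gradient_isometry]
    exact (map_smul g _ _).symm
  refine intervalIntegral.integral_congr fun x _ => ?_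
  have h1 : Continuous fun x : ℝ => x ^ k := by fun_prop
  have h2 : Continuous fun x : ℝ => x * x ^ k := by fun_prop
  simp only [deflection, himp _ h1, himp _ h2, line_map g hge hgb, hσ.gradient_isometry]
  rw [← map_smul, ← map_sub, g.inner_map_map]

theorem exists_perp (hd : 2 ≤ d) (b : Space d) : ∃ e : Space d, ‖e‖ = 1 ∧ ⟪e, b⟫ = 0 := by
  have hne : Submodule.span ℝ {b} ≠ ⊤ := by
    intro h
    have h1 := finrank_span_le_card (R := ℝ) ({b} : Set (Space d))
    rw [h, finrank_top, finrank_euclideanSpace, Fintype.card_fin, Set.toFinset_singleton,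
      Finset.card_singleton] at h1
    omega
  have hne' : (Submodule.span ℝ {b})ᗮ ≠ ⊥ := fun h => hne (Submodule.orthogonal_eq_bot_iff.1 h)
  obtain ⟨x, hx, hx0⟩ := Submodule.exists_mem_ne_zero_of_ne_bot hne'
  rw [Submodule.mem_orthogonal_singleton_iff_inner_left] at hx
  exact ⟨dir x, norm_dir hx0, inner_dir hx⟩

open Classical in
/-- A unit vector orthogonal to `b`, for `d ≥ 2`. It serves to express quantities which depend on
the direction of incidence only through its orthogonality to `b`. -/
noncomputable def perp (b : Space d) : Space d :=
  if h : ∃ e : Space d, ‖e‖ = 1 ∧ ⟪e, b⟫ = 0 then h.choose else 0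

theorem norm_perp (hd : 2 ≤ d) (b : Space d) : ‖perp b‖ = 1 := by
  rw [perp, dif_pos (exists_perp hd b)]
  exact (exists_perp hd b).choose_spec.1

theorem inner_perp (hd : 2 ≤ d) (b : Space d) : ⟪perp b, b⟫ = 0 := by
  rw [perp, dif_pos (exists_perp hd b)]
  exact (exists_perp hd b).choose_spec.2

end Direction

/-! ### The expansion of the energy transfer -/

section Expansion

variable {d : ℕ} {σ : Space d → ℝ} {U : ℝ → ℝ} {R C M s : ℝ} {κ : Param d} {e : Space d}

/-- The terms of the expansion of the energy transfer, with the free parts `a` and `a'` of the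
coefficients. -/
noncomputable def expansion (σ : Space d → ℝ) (U : ℝ → ℝ) (αs M s : ℝ) (e : Space d) (κ : Param d)
    (a a' : ℝ) : ℝ :=
  αs * (beta1 σ M e κ / s + meanZeroA σ U M s e κ + a)
    + αs ^ 2 * (deltaBeta2 σ e κ / s ^ 2 + meanZeroB σ s e κ + deltaBeta4 σ U M e κ / s ^ 4 + a')

theorem exists_expansion (hσ : IsFormFactor σ) (hU : ContDiff ℝ ∞ U) (hC : IsBound σ U R C)
    (hM : 1 ≤ M) (hs : 32 * C ^ 2 ≤ s) (hκ : κ ∈ params d R M) (he : ‖e‖ = 1)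
    (heb : ⟪e, impact κ⟫ = 0) :
    ∃ a a' : ℝ, |a| ≤ 60000 * C ^ 6 * (1 / (√M ^ 3 * s ^ 4)) ∧
      |a'| ≤ 60000 * C ^ 6 * (1 / (√M * s ^ 5)) ∧
      ∀ αs : ℝ, 0 < αs → αs * √M ≤ 1 → ∀ q v Q P T,
        IsCollision σ U (αs * √M) M (s • e) κ q v Q P T →
        |energyTransfer σ (αs * √M) (s • e) q Q T - expansion σ U αs M s e κ a a'|
          ≤ 60000 * C ^ 6 * (αs ^ 3 * M) := by
  have hC1 := hC.one_le
  have hC2 : 1 ≤ C ^ 2 := one_le_pow₀ hC1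
  have hs32 : 32 ≤ s := by nlinarith
  have hs0 : 0 < s := by linarith
  have hM0 : 0 < M := by linarith
  have hm1 : 1 ≤ √M := Real.one_le_sqrt.2 hM
  set m := √M with hm
  have hm0 : 0 < m := by linarith
  have hmM : M = m ^ 2 := (Real.sq_sqrt hM0.le).symm
  obtain ⟨hb, hQ, hP⟩ := id hκ
  have hY : |mom κ / m| ≤ R := by rwa [abs_div, abs_of_pos hm0]
  set θ := 1 / (m * s) with hθ
  have hθ0 : 0 < θ := by positivity
  have hθ' : 32 * C ^ 2 * θ ≤ 1 := by
    rw [hθ, mul_one_div, div_le_one (by positivity)]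
    nlinarith
  set b := impact κ with hbdef
  set Q₀ := disp κ with hQ₀
  set Y₀ := mom κ / m with hY₀
  have hYP : mom κ = Y₀ * m := by rw [hY₀]; field_simp
  obtain ⟨X, Y, X₁, Y₁, hf⟩ := exists_isFreeMotion hσ hU hC e b hθ0.le hθ' hQ hY
  have i1 := hf.first_order hσ hC hθ0.le hQ hY he heb
  have i2 := hf.second_order_response hσ hC hθ0.le hθ' hQ hY he heb
  have i3 := hf.second_order_deflection hσ hC hθ0.le hQ hY he heb
  set I1 := ∫ l in (0 : ℝ)..2, Y l * σ (line e b l) with hI1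
  set I2 := ∫ l in (0 : ℝ)..2, Y₁ l * σ (line e b l) with hI2
  set I3 := ∫ l in (0 : ℝ)..2, Y l * ⟪gradient σ (line e b l), deflection σ e b X l⟫ with hI3
  set r1 := I1 - (Y₀ * L0 σ e b 1 - θ * deriv U Q₀ * formMoment σ e b 1
    - θ ^ 2 * deriv (deriv U) Q₀ * Y₀ / 2 * formMoment σ e b 2) with hr1
  set r2 := I2 - (-(θ * (L0 σ e b 1 ^ 2 / 2))
    + θ ^ 3 * deriv (deriv U) Q₀ * formIntegral σ e b) with hr2
  set r3 := I3 - (Y₀ * Q₀ * gradMoment σ e b 0 0 + θ * (Y₀ ^ 2 * gradMoment σ e b 0 1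
    - deriv U Q₀ * Q₀ * gradMoment σ e b 1 0)) with hr3
  have hC46 : C ^ 4 ≤ C ^ 6 := pow_le_pow_right₀ hC1 (by norm_num)
  have hC56 : C ^ 5 ≤ C ^ 6 := pow_le_pow_right₀ hC1 (by norm_num)
  have hC6 : 0 ≤ C ^ 6 := by positivity
  refine ⟨1 / s * r1, m / s * (r2 - 1 / s ^ 2 * r3), ?_, ?_, ?_⟩
  · rw [abs_mul, abs_of_pos (by positivity : 0 < 1 / s)]
    calc 1 / s * |r1| ≤ 1 / s * (1024 * C ^ 4 * θ ^ 3) := by gcongr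
      _ = 1024 * C ^ 4 * (1 / (m ^ 3 * s ^ 4)) := by
          rw [hθ]; field_simp
      _ ≤ 60000 * C ^ 6 * (1 / (m ^ 3 * s ^ 4)) := by
          gcongr
          linarith
  · rw [abs_mul, abs_of_pos (by positivity : 0 < m / s)]
    have h1 : |r2 - 1 / s ^ 2 * r3|
        ≤ 40000 * C ^ 4 * θ ^ 4 + 1 / s ^ 2 * (13000 * C ^ 5 * θ ^ 2) := by
      refine (abs_sub _ _).trans (add_le_add i2 ?_)
      rw [abs_mul, abs_of_pos (by positivity : 0 < 1 / s ^ 2)]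
      gcongr
    have h2 : θ ^ 4 ≤ 1 / s ^ 2 * θ ^ 2 := by
      have : θ ≤ 1 / s := by
        rw [hθ]
        apply one_div_le_one_div_of_le hs0
        nlinarith
      calc θ ^ 4 = θ ^ 2 * θ ^ 2 := by ring
        _ ≤ (1 / s) ^ 2 * θ ^ 2 := by gcongr
        _ = _ := by rw [one_div_pow]
    calc m / s * |r2 - 1 / s ^ 2 * r3|
        ≤ m / s * (40000 * C ^ 6 * (1 / s ^ 2 * θ ^ 2) + 1 / s ^ 2 * (13000 * C ^ 6 * θ ^ 2)) := by
          gcongr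
          refine h1.trans ?_
          gcongr
      _ = 53000 * C ^ 6 * (1 / (m * s ^ 5)) := by
          rw [hθ]; field_simp; ring
      _ ≤ 60000 * C ^ 6 * (1 / (m * s ^ 5)) := by
          gcongr
          linarith
  · intro αs hαs hα1 q' v' Q' P' T hcol
    set α := αs * m with hα
    have hα0 : 0 ≤ α := by positivity
    have hns : ‖s • e‖ = s := by rw [norm_smul, he, mul_one, Real.norm_of_nonneg hs0.le]
    have hdir : dir (s • e) = e := by
      rw [dir, hns, smul_smul, inv_mul_cancel₀ hs0.ne', one_smul]
    obtain ⟨q, w, Q, y, hmot, q'', v'', Q'', P'', T'', hcol', hen⟩ :=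
      exists_collision hσ hU hC hα0 hM (p := s • e) hκ
        (by rw [real_inner_smul_left, heb, mul_zero])
        (by
          rw [hns, max_eq_left (Real.sqrt_le_one.2 hα1), mul_one]
          exact hs)
    rw [hcol.energyTransfer_unique hσ hU hcol', hen]
    rw [hns, hdir] at hmot
    have e1 : α / s ^ 2 = α * (1 / s) ^ 2 := by field_simp
    have e2 : 1 / (M * s ^ 2) = θ ^ 2 := by rw [hθ, hmM]; field_simp
    have e3 : α / (M * s ^ 2) = α * θ ^ 2 := by rw [hθ, hmM]; field_simp
    have e4 : mom κ / (M * s) = θ * Y₀ := by rw [hθ, hmM, hY₀]; field_simp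
    rw [e1, e2, e3, e4] at hmot
    have hw := hmot.work_expand hf hσ hC hα0 (by positivity)
      ((div_le_one hs0).2 (by linarith)) hθ0 hθ' hQ hY
    rw [← hI1, ← hI2, ← hI3] at hw
    have hkey : α * (∫ l in (0 : ℝ)..2, y l * σ (q l))
        - expansion σ U αs M s e κ (1 / s * r1) (m / s * (r2 - 1 / s ^ 2 * r3))
        = α * ((∫ l in (0 : ℝ)..2, y l * σ (q l))
          - θ * (I1 + α * (I2 - (1 / s) ^ 2 * I3))) := by
      rw [expansion, beta1, meanZeroA, deltaBeta2, meanZeroB, deltaBeta4, hr1, hr2, hr3, hα, hθ,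
        ← hbdef, ← hQ₀, ← hm, hYP, hmM]
      field_simp
      ring
    rw [hkey, abs_mul, abs_of_nonneg hα0]
    calc _ ≤ α * (20000 * C ^ 6 * α ^ 2 * θ) := by gcongr
      _ = 20000 * C ^ 6 * (αs ^ 3 * M) * (1 / s) := by
          rw [hα, hθ, hmM]; field_simp
      _ ≤ 60000 * C ^ 6 * (αs ^ 3 * M) * 1 := by
          gcongr
          · norm_num
          · exact (div_le_one hs0).2 (by linarith)
      _ = _ := mul_one _

end Expansion

/-! ### Means over the state of the scatterer -/

section Scatterer

variable {U : ℝ → ℝ} {M : ℝ}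

/-- The energy of the scatterer as a function on phase space. -/
noncomputable def energyFun (U : ℝ → ℝ) (M : ℝ) (x : ℝ × ℝ) : ℝ := hScatt U M x.1 x.2

theorem energyFun_continuous (hU : Continuous U) : Continuous (energyFun U M) := by
  unfold energyFun hScatt
  fun_prop

theorem isCompact_sublevel (hU : Continuous U) (hconf : Tendsto U (cocompact ℝ) atTop)
    (hM : 0 < M) (E : ℝ) : IsCompact {x | energyFun U M x ≤ E} := by
  obtain ⟨m, hm⟩ := hU.exists_forall_le hconf
  have h1 : ∀ᶠ Q in cocompact ℝ, E < U Q := hconf.eventually_gt_atTop E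
  rw [Filter.Eventually, Metric.cobounded_eq_cocompact.symm, ← Bornology.isCobounded_def,
    ← Bornology.isBounded_compl_iff, isBounded_iff_forall_norm_le] at h1
  obtain ⟨A, hA⟩ := h1
  have hK : IsCompact (Icc (-A) A ×ˢ Icc (-√(2 * M * (E - U m))) √(2 * M * (E - U m))) :=
    isCompact_Icc.prod isCompact_Icc
  refine hK.of_isClosed_subset (isClosed_le (energyFun_continuous hU) continuous_const) ?_
  intro x hx
  have hx' : x.2 ^ 2 / (2 * M) + U x.1 ≤ E := hx
  have hP : 0 ≤ x.2 ^ 2 / (2 * M) := by positivity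
  refine ⟨abs_le.1 (hA x.1 ?_), abs_le.1 (Real.abs_le_sqrt ?_)⟩
  · simp only [mem_compl_iff, Set.mem_ofPred_eq, not_lt]
    linarith
  · have h2 : x.2 ^ 2 / (2 * M) ≤ E - U m := by linarith [hm x.1]
    rw [div_le_iff₀ (by positivity)] at h2
    linarith

theorem isCompact_preimage_energyFun (hU : Continuous U) (hconf : Tendsto U (cocompact ℝ) atTop)
    (hM : 0 < M) {K : Set ℝ} (hK : IsCompact K) : IsCompact (energyFun U M ⁻¹' K) := by
  obtain ⟨E, hE⟩ := hK.bddAbove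
  exact (isCompact_sublevel hU hconf hM E).of_isClosed_subset
    (hK.isClosed.preimage (energyFun_continuous hU)) fun x hx => hE hx

/-- The Poisson bracket of `u(Q) k(P)` with the energy. -/
noncomputable def bracket (U : ℝ → ℝ) (M : ℝ) (u k : ℝ → ℝ) (x : ℝ × ℝ) : ℝ :=
  deriv u x.1 * k x.2 * (x.2 / M) - u x.1 * deriv k x.2 * deriv U x.1

theorem hasFDerivAt_energyFun (hU : ContDiff ℝ ∞ U) (x : ℝ × ℝ) :
    HasFDerivAt (energyFun U M) ((deriv U x.1) • ContinuousLinearMap.fst ℝ ℝ ℝ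
      + (x.2 / M) • ContinuousLinearMap.snd ℝ ℝ ℝ) x := by
  have h1 : HasDerivAt U (deriv U x.1) x.1 := (hU.differentiable (by simp) x.1).hasDerivAt
  have h2 : HasDerivAt (fun P : ℝ => P ^ 2 / (2 * M)) (x.2 / M) x.2 := by
    refine ((hasDerivAt_pow 2 x.2).div_const (2 * M)).congr_deriv ?_
    rw [pow_one, Nat.cast_ofNat, mul_div_mul_left _ _ (two_ne_zero)]
  have h3 := (h2.comp_hasFDerivAt x (hasFDerivAt_snd (𝕜 := ℝ) (p := x))).add
    (h1.comp_hasFDerivAt x (hasFDerivAt_fst (𝕜 := ℝ) (p := x)))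
  rw [add_comm ((x.2 / M) • _)] at h3
  exact h3

theorem fderiv_mul_apply {f g : ℝ → ℝ} (hf : Differentiable ℝ f) (hg : Differentiable ℝ g)
    (x v : ℝ × ℝ) : fderiv ℝ (fun x : ℝ × ℝ => f x.1 * g x.2) x v
      = deriv f x.1 * v.1 * g x.2 + f x.1 * (deriv g x.2 * v.2) := by
  have h1 := ((hf x.1).hasDerivAt.comp_hasFDerivAt x
      (hasFDerivAt_fst (𝕜 := ℝ) (p := x))).mul
    ((hg x.2).hasDerivAt.comp_hasFDerivAt x (hasFDerivAt_snd (𝕜 := ℝ) (p := x)))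
  rw [show (fun x : ℝ × ℝ => f x.1 * g x.2) = (f ∘ Prod.fst) * (g ∘ Prod.snd) from rfl, h1.fderiv]
  simp
  ring

/-- Liouville's theorem: the bracket of a function with the energy has zero mean with respect to
every function of the energy. For smooth functions of the energy this is an integration by parts. -/
theorem integral_bracket_mul_comp (hU : ContDiff ℝ ∞ U) (hconf : Tendsto U (cocompact ℝ) atTop)
    (hM : 0 < M) {u k : ℝ → ℝ} (hu : ContDiff ℝ ∞ u) (hk : ContDiff ℝ ∞ k) {h : ℝ → ℝ}
    (hh : Continuous h) (hhs : HasCompactSupport h) :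
    ∫ x, bracket U M u k x * h (energyFun U M x) = 0 := by
  obtain ⟨E, hE⟩ := hhs.isCompact.bddAbove
  have hzero : ∀ t, E < t → h t = 0 := fun t ht =>
    image_eq_zero_of_notMem_tsupport fun hmem => absurd (hE hmem) (not_le.2 ht)
  have hu' := (contDiff_infty_iff_deriv.1 hu)
  have hk' := (contDiff_infty_iff_deriv.1 hk)
  have hUd := (contDiff_infty_iff_deriv.1 hU)
  -- `g` is the primitive of `h` which vanishes at large energies
  set g : ℝ → ℝ := fun t => ∫ x in (E + 1)..t, h x with hg
  have hgd : ∀ t, HasDerivAt g (h t) t := fun t =>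
    (hh.integral_hasStrictDerivAt (E + 1) t).hasDerivAt
  have hgz : ∀ t, E < t → g t = 0 := by
    intro t ht
    rw [hg]
    simp only
    rw [intervalIntegral.integral_congr (g := fun _ => 0), intervalIntegral.integral_zero]
    intro x hx
    exact hzero x ((lt_min (by linarith) ht).trans_le hx.1)
  have hgc : Continuous g := continuous_iff_continuousAt.2 fun t => (hgd t).continuousAt
  set G : ℝ × ℝ → ℝ := fun x => g (energyFun U M x) with hG
  have hEc := energyFun_continuous (M := M) hU.continuous
  have hGd : ∀ x, HasFDerivAt G (h (energyFun U M x) • ((deriv U x.1) •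
      ContinuousLinearMap.fst ℝ ℝ ℝ + (x.2 / M) • ContinuousLinearMap.snd ℝ ℝ ℝ)) x := fun x =>
    (hgd _).comp_hasFDerivAt x (hasFDerivAt_energyFun hU x)
  have hGc : Continuous G := hgc.comp hEc
  have hhc : Continuous fun x => h (energyFun U M x) := hh.comp hEc
  have hcomp := isCompact_sublevel hU.continuous hconf hM E
  have hint : ∀ f : ℝ × ℝ → ℝ, Continuous f → (∀ x, E < energyFun U M x → f x = 0) →
      Integrable f := fun f hf hf0 =>
    hf.integrable_of_hasCompactSupport (HasCompactSupport.intro hcomp fun x hx =>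
      hf0 x (not_le.1 hx))
  have c1 := hu.continuous
  have c2 := hk.continuous
  have c3 := hu'.2.continuous
  have c4 := hk'.2.continuous
  have c5 := hUd.2.continuous
  have d1 : Differentiable ℝ (deriv u) := hu'.2.differentiable (by simp)
  have d2 : Differentiable ℝ (deriv k) := hk'.2.differentiable (by simp)
  set a : ℝ × ℝ → ℝ := fun x => deriv u x.1 * k x.2 with ha
  set c : ℝ × ℝ → ℝ := fun x => u x.1 * deriv k x.2 with hc
  have hac : Continuous a := by fun_prop
  have hcc : Continuous c := by fun_prop
  have had : Differentiable ℝ a := (d1.comp differentiable_fst).mul (hk'.1.comp differentiable_snd)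
  have hcd : Differentiable ℝ c := (hu'.1.comp differentiable_fst).mul (d2.comp differentiable_snd)
  have fa : ∀ x, fderiv ℝ a x (0, 1) = deriv u x.1 * deriv k x.2 := fun x => by
    rw [ha, fderiv_mul_apply d1 hk'.1]; simp
  have fc : ∀ x, fderiv ℝ c x (1, 0) = deriv u x.1 * deriv k x.2 := fun x => by
    rw [hc, fderiv_mul_apply hu'.1 d2]; simp
  have fG1 : ∀ x, fderiv ℝ G x (0, 1) = h (energyFun U M x) * (x.2 / M) := fun x => by
    rw [(hGd x).fderiv]; simp
  have fG2 : ∀ x, fderiv ℝ G x (1, 0) = h (energyFun U M x) * deriv U x.1 := fun x => by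
    rw [(hGd x).fderiv]; simp
  have k1 : Continuous fun x : ℝ × ℝ => deriv u x.1 * deriv k x.2 * G x := by fun_prop
  have k2 : Continuous fun x : ℝ × ℝ => a x * (h (energyFun U M x) * (x.2 / M)) := by fun_prop
  have k3 : Continuous fun x : ℝ × ℝ => c x * (h (energyFun U M x) * deriv U x.1) := by fun_prop
  have i1 : Integrable fun x : ℝ × ℝ => deriv u x.1 * deriv k x.2 * G x :=
    hint _ k1 fun x hx => by simp [hG, hgz _ hx]
  have i2 : Integrable fun x : ℝ × ℝ => a x * (h (energyFun U M x) * (x.2 / M)) :=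
    hint _ k2 fun x hx => by simp [hzero _ hx]
  have i3 : Integrable fun x : ℝ × ℝ => c x * (h (energyFun U M x) * deriv U x.1) :=
    hint _ k3 fun x hx => by simp [hzero _ hx]
  have p1 := integral_mul_fderiv_eq_neg_fderiv_mul_of_integrable (μ := volume) (f := a) (g := G)
    (v := ((0 : ℝ), (1 : ℝ))) (by simpa only [fa] using i1) (by simpa only [fG1] using i2)
    (hint _ (hac.mul hGc) fun x hx => by simp [hG, hgz _ hx]) (fun x _ => had x)
    (fun x _ => (hGd x).differentiableAt)
  have p2 := integral_mul_fderiv_eq_neg_fderiv_mul_of_integrable (μ := volume) (f := c) (g := G)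
    (v := ((1 : ℝ), (0 : ℝ))) (by simpa only [fc] using i1) (by simpa only [fG2] using i3)
    (hint _ (hcc.mul hGc) fun x hx => by simp [hG, hgz _ hx]) (fun x _ => hcd x)
    (fun x _ => (hGd x).differentiableAt)
  simp only [fa, fG1, fc, fG2] at p1 p2
  have : ∀ x, bracket U M u k x * h (energyFun U M x)
      = a x * (h (energyFun U M x) * (x.2 / M)) - c x * (h (energyFun U M x) * deriv U x.1) :=
    fun x => by rw [bracket, ha, hc]; ring
  simp only [this]
  rw [integral_sub i2 i3, p1, p2, sub_self]

/-- If a continuous `f` is orthogonal to all compactly supported continuous functions of the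
energy, it is orthogonal to all functions of the energy: the images under the energy of the
measures with densities `f⁺` and `f⁻` coincide. -/
theorem integral_mul_comp_eq_zero (hU : Continuous U) (hconf : Tendsto U (cocompact ℝ) atTop)
    (hM : 0 < M) {f : ℝ × ℝ → ℝ} (hf : Continuous f)
    (h0 : ∀ h : ℝ → ℝ, Continuous h → HasCompactSupport h →
      ∫ x, f x * h (energyFun U M x) = 0)
    {ρ : ℝ → ℝ} (hρ : Measurable ρ) (hρ0 : ∀ E, 0 ≤ ρ E)
    (hint : Integrable fun x => f x * ρ (energyFun U M x)) :
    ∫ x, f x * ρ (energyFun U M x) = 0 := by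
  have hEc := energyFun_continuous (M := M) hU
  let μ : (ℝ × ℝ → ℝ) → Measure ℝ := fun f =>
    ((volume : Measure (ℝ × ℝ)).withDensity fun x => ENNReal.ofReal (f x)).map (energyFun U M)
  have hμ : ∀ f : ℝ × ℝ → ℝ, Continuous f → (μ f).Regular := by
    intro f hf
    have := IsLocallyFiniteMeasure.withDensity_ofReal (μ := volume) hf
    have : IsFiniteMeasureOnCompacts (μ f) := ⟨fun K hK => by
      rw [Measure.map_apply hEc.measurable hK.measurableSet]
      exact (isCompact_preimage_energyFun hU hconf hM hK).measure_lt_top⟩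
    infer_instance
  have hμi : ∀ f : ℝ × ℝ → ℝ, Continuous f → ∀ h : ℝ → ℝ, Continuous h →
      ∫ t, h t ∂(μ f) = ∫ x, max (f x) 0 * h (energyFun U M x) := by
    intro f hf h hh
    rw [integral_map hEc.aemeasurable hh.aestronglyMeasurable,
      integral_withDensity_eq_integral_toReal_smul₀ (by fun_prop) (by simp)]
    simp [ENNReal.toReal_ofReal']
  have heq : μ f = μ (fun x => -f x) := by
    have r1 := hμ f hf
    have r2 := hμ (fun x => -f x) hf.neg
    refine Measure.ext_of_integral_eq_on_compactlySupported fun h => ?_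
    rw [hμi f hf h h.continuous, hμi (fun x => -f x) hf.neg h h.continuous, ← sub_eq_zero]
    have hcs : HasCompactSupport fun x => h (energyFun U M x) :=
      HasCompactSupport.intro (isCompact_preimage_energyFun hU hconf hM h.hasCompactSupport)
        fun x hx => image_eq_zero_of_notMem_tsupport hx
    have hhc : Continuous fun x => h (energyFun U M x) := h.continuous.comp hEc
    have m1 : Integrable fun x => max (f x) 0 * h (energyFun U M x) :=
      ((hf.max continuous_const).mul hhc).integrable_of_hasCompactSupport hcs.mul_left
    have m2 : Integrable fun x => max (-f x) 0 * h (energyFun U M x) :=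
      ((hf.neg.max continuous_const).mul hhc).integrable_of_hasCompactSupport hcs.mul_left
    rw [← integral_sub m1 m2]
    refine Eq.trans (integral_congr_ae (ae_of_all _ fun x => ?_))
      (h0 h h.continuous h.hasCompactSupport)
    simp only
    rw [← sub_mul]
    congr 1
    rcases le_total 0 (f x) with hx | hx
    · rw [max_eq_left hx, max_eq_right (by linarith), sub_zero]
    · rw [max_eq_right hx, max_eq_left (by linarith)]
      ring
  have hlint : ∀ f : ℝ × ℝ → ℝ, Continuous f → ∫⁻ t, ENNReal.ofReal (ρ t) ∂(μ f)
      = ∫⁻ x, ENNReal.ofReal (f x * ρ (energyFun U M x)) := by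
    intro f hf
    have m1 : Measurable fun x => ENNReal.ofReal (f x) := by fun_prop
    have m2 : Measurable fun x => ENNReal.ofReal (ρ (energyFun U M x)) :=
      (hρ.comp hEc.measurable).ennreal_ofReal
    rw [lintegral_map hρ.ennreal_ofReal hEc.measurable,
      lintegral_withDensity_eq_lintegral_mul _ m1 m2]
    refine lintegral_congr fun x => ?_
    rw [Pi.mul_apply, ← ENNReal.ofReal_mul' (hρ0 _)]
  rw [integral_eq_lintegral_pos_part_sub_lintegral_neg_part hint, ← hlint f hf, heq,
    hlint (fun x => -f x) hf.neg]
  simp only [neg_mul, sub_self]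

/-- The law of the state of the scatterer, with density `ρhat(H(Q, P))`. -/
noncomputable abbrev scattererLaw (U : ℝ → ℝ) (M : ℝ) (ρhat : ℝ → ℝ) : Measure (ℝ × ℝ) :=
  volume.withDensity fun x : ℝ × ℝ => ENNReal.ofReal (ρhat (hScatt U M x.1 x.2))

variable {ρhat : ℝ → ℝ}

theorem IsStationaryDensity.isProbabilityMeasure (hρ : IsStationaryDensity U M ρhat) :
    IsProbabilityMeasure (scattererLaw U M ρhat) :=
  ⟨by rw [withDensity_apply _ MeasurableSet.univ, Measure.restrict_univ, hρ.total_mass]⟩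

theorem IsStationaryDensity.measurable_density (hρ : IsStationaryDensity U M ρhat)
    (hU : Continuous U) : Measurable fun x : ℝ × ℝ => ρhat (hScatt U M x.1 x.2) :=
  hρ.measurable.comp (energyFun_continuous hU).measurable

theorem IsStationaryDensity.integrable_density (hρ : IsStationaryDensity U M ρhat)
    (hU : Continuous U) : Integrable fun x : ℝ × ℝ => ρhat (hScatt U M x.1 x.2) := by
  refine ⟨(hρ.measurable_density hU).aestronglyMeasurable, ?_⟩
  rw [hasFiniteIntegral_iff_ofReal (ae_of_all _ fun x => hρ.nonneg _), hρ.total_mass]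
  exact ENNReal.one_lt_top

theorem IsStationaryDensity.integrable_mul (hρ : IsStationaryDensity U M ρhat)
    (hU : Continuous U) {f : ℝ × ℝ → ℝ} (hf : Continuous f) :
    Integrable fun x => f x * ρhat (energyFun U M x) := by
  obtain ⟨c, hc⟩ := hρ.compact_support.isCompact.exists_bound_of_continuousOn hf.continuousOn
  refine ((hρ.integrable_density hU).const_mul c).mono'
    (hf.aestronglyMeasurable.mul (hρ.measurable_density hU).aestronglyMeasurable)
    (ae_of_all _ fun x => ?_)
  rw [norm_mul, Real.norm_of_nonneg (hρ.nonneg _)]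
  by_cases hx : ρhat (energyFun U M x) = 0
  · have hx' : ρhat (hScatt U M x.1 x.2) = 0 := hx
    rw [hx, hx', mul_zero, mul_zero]
  · exact mul_le_mul_of_nonneg_right (hc x (subset_tsupport _ hx)) (hρ.nonneg _)

theorem IsStationaryDensity.integrable (hρ : IsStationaryDensity U M ρhat)
    (hU : Continuous U) {f : ℝ × ℝ → ℝ} (hf : Continuous f) :
    Integrable f (scattererLaw U M ρhat) := by
  rw [integrable_withDensity_iff_integrable_smul' (hρ.measurable_density hU).ennreal_ofReal
    (by simp)]
  refine (hρ.integrable_mul hU hf).congr (ae_of_all _ fun x => ?_)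
  simp only
  rw [ENNReal.toReal_ofReal (hρ.nonneg _), smul_eq_mul, mul_comm]
  rfl

theorem IsStationaryDensity.integral_eq (hρ : IsStationaryDensity U M ρhat)
    (hU : Continuous U) (f : ℝ × ℝ → ℝ) :
    ∫ x, f x ∂(scattererLaw U M ρhat) = ∫ x, f x * ρhat (energyFun U M x) := by
  rw [integral_withDensity_eq_integral_toReal_smul₀
    (hρ.measurable_density hU).ennreal_ofReal.aemeasurable (by simp)]
  refine integral_congr_ae (ae_of_all _ fun x => ?_)
  simp only
  rw [ENNReal.toReal_ofReal (hρ.nonneg _), smul_eq_mul, mul_comm]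
  rfl

theorem IsStationaryDensity.integral_bracket (hρ : IsStationaryDensity U M ρhat)
    (hU : ContDiff ℝ ∞ U) (hconf : Tendsto U (cocompact ℝ) atTop) (hM : 0 < M) {u k : ℝ → ℝ}
    (hu : ContDiff ℝ ∞ u) (hk : ContDiff ℝ ∞ k) :
    ∫ x, bracket U M u k x ∂(scattererLaw U M ρhat) = 0 := by
  have c1 := hu.continuous
  have c2 := hk.continuous
  have c3 := (contDiff_infty_iff_deriv.1 hu).2.continuous
  have c4 := (contDiff_infty_iff_deriv.1 hk).2.continuous
  have c5 := (contDiff_infty_iff_deriv.1 hU).2.continuous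
  have hb : Continuous (bracket U M u k) := by
    unfold bracket
    fun_prop
  rw [hρ.integral_eq hU.continuous]
  exact integral_mul_comp_eq_zero hU.continuous hconf hM hb
    (fun h hh hhs => integral_bracket_mul_comp hU hconf hM hu hk hh hhs) hρ.measurable hρ.nonneg
    (hρ.integrable_mul hU.continuous hb)

section Means

variable (hρ : IsStationaryDensity U M ρhat) (hU : ContDiff ℝ ∞ U)
  (hconf : Tendsto U (cocompact ℝ) atTop) (hM : 0 < M)
include hρ hU hconf hM

theorem IsStationaryDensity.integral_force :
    ∫ x, deriv U x.1 ∂(scattererLaw U M ρhat) = 0 := by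
  have := hρ.integral_bracket hU hconf hM (u := fun _ => 1) (k := fun P => P) contDiff_const
    contDiff_id
  simp only [bracket, deriv_const', deriv_id'', zero_mul, one_mul, zero_sub] at this
  rwa [integral_neg, neg_eq_zero] at this

theorem IsStationaryDensity.integral_momentum :
    ∫ x, x.2 ∂(scattererLaw U M ρhat) = 0 := by
  have := hρ.integral_bracket hU hconf hM (u := fun Q => Q) (k := fun _ => 1) contDiff_id
    contDiff_const
  simp only [bracket, deriv_const', deriv_id'', mul_zero, one_mul, zero_mul, sub_zero] at this
  rw [integral_div] at this
  exact (div_eq_zero_iff.1 this).resolve_right hM.ne'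

theorem IsStationaryDensity.integral_disp_mul_momentum :
    ∫ x, x.1 * x.2 ∂(scattererLaw U M ρhat) = 0 := by
  have := hρ.integral_bracket hU hconf hM (u := fun Q => Q ^ 2 / 2) (k := fun _ => 1)
    (by fun_prop) contDiff_const
  have hd : deriv (fun Q : ℝ => Q ^ 2 / 2) = fun Q => Q := by
    funext Q
    simp
  simp only [bracket, deriv_const', hd, mul_zero, mul_one, zero_mul, sub_zero,
    ← mul_div_assoc] at this
  rw [integral_div] at this
  exact (div_eq_zero_iff.1 this).resolve_right hM.ne'

theorem IsStationaryDensity.integral_stiffness_mul_momentum :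
    ∫ x, deriv (deriv U) x.1 * x.2 ∂(scattererLaw U M ρhat) = 0 := by
  have := hρ.integral_bracket hU hconf hM (u := deriv U) (k := fun _ => 1)
    (contDiff_infty_iff_deriv.1 hU).2 contDiff_const
  simp only [bracket, deriv_const', mul_zero, mul_one, zero_mul, sub_zero,
    ← mul_div_assoc] at this
  rw [integral_div] at this
  exact (div_eq_zero_iff.1 this).resolve_right hM.ne'

/-- The virial theorem. -/
theorem IsStationaryDensity.integral_force_mul_disp :
    ∫ x, deriv U x.1 * x.1 ∂(scattererLaw U M ρhat)
      = (∫ x, x.2 ^ 2 ∂(scattererLaw U M ρhat)) / M := by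
  have c5 := (contDiff_infty_iff_deriv.1 hU).2.continuous
  have := hρ.integral_bracket hU hconf hM (u := fun Q => Q) (k := fun P => P) contDiff_id
    contDiff_id
  simp only [bracket, deriv_id'', one_mul, mul_one] at this
  have h1 : Continuous fun x : ℝ × ℝ => x.2 * (x.2 / M) := by fun_prop
  have h2 : Continuous fun x : ℝ × ℝ => x.1 * deriv U x.1 := by fun_prop
  rw [integral_sub (hρ.integrable hU.continuous h1) (hρ.integrable hU.continuous h2),
    sub_eq_zero] at this
  simp only [mul_comm (deriv U _)]
  rw [← this, ← integral_div]
  refine integral_congr_ae (ae_of_all _ fun x => ?_)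
  simp only
  ring

end Means

theorem IsStationaryDensity.integral_momentum_sq_ne_zero (hρ : IsStationaryDensity U M ρhat)
    (hU : Continuous U) : ∫ x, x.2 ^ 2 ∂(scattererLaw U M ρhat) ≠ 0 := by
  intro h
  have := hρ.isProbabilityMeasure
  rw [integral_eq_zero_iff_of_nonneg (fun x => sq_nonneg _)
    (hρ.integrable hU (continuous_snd.pow 2))] at h
  have h2 : ∀ᵐ x ∂(scattererLaw U M ρhat), x.2 ≠ 0 := by
    refine (withDensity_absolutelyContinuous _ _).ae_le ?_
    exact (Measure.quasiMeasurePreserving_snd (μ := (volume : Measure ℝ))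
      (ν := (volume : Measure ℝ))).ae (p := fun P : ℝ => P ≠ 0)
        (by simp [ae_iff])
  have h3 : ∀ᵐ x ∂(scattererLaw U M ρhat), False := by
    filter_upwards [h, h2] with x hx hx2
    exact hx2 (pow_eq_zero_iff two_ne_zero |>.1 hx)
  exact IsProbabilityMeasure.ne_zero (scattererLaw U M ρhat) (by simpa using h3)

end Scatterer

/-! ### The deflection of the particle and the gradient of `L₀` -/

section Virial

variable {d : ℕ} {σ : Space d → ℝ} {e b : Space d}

theorem inner_impulse (hσ : IsFormFactor σ) {f : ℝ → ℝ} (hf : Continuous f) (c : Space d) (l : ℝ) :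
    ⟪c, impulse σ e b f l⟫ = ∫ x in (0 : ℝ)..l, f x * ⟪c, gradient σ (line e b x)⟫ := by
  have := (innerSL ℝ c).intervalIntegral_comp_comm
    ((hf.smul (continuous_gradient_line (e := e) (b := b) hσ)).intervalIntegrable
      (μ := volume) 0 l)
  simp only [innerSL_apply_apply, Pi.smul_apply', real_inner_smul_right] at this
  exact this.symm

theorem inner_gradient_line_dir (he : ‖e‖ = 1) (heb : ⟪e, b⟫ = 0) {l k : ℝ}
    (hk : gradient σ (line e b l) = k • line e b l) :
    ⟪e, gradient σ (line e b l)⟫ = k * (l - 1 / 2) := by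
  rw [hk, line, real_inner_smul_right, inner_add_right, real_inner_smul_right, heb,
    real_inner_self_eq_norm_sq, he]
  ring

theorem inner_gradient_line_impact (heb : ⟪e, b⟫ = 0) {l k : ℝ}
    (hk : gradient σ (line e b l) = k • line e b l) :
    ⟪b, gradient σ (line e b l)⟫ = k * ‖b‖ ^ 2 := by
  rw [hk, line, real_inner_smul_right, inner_add_right, real_inner_smul_right,
    real_inner_comm e b, heb, real_inner_self_eq_norm_sq]
  ring

theorem hasDerivAt_form_line (hσ : IsFormFactor σ) (l : ℝ) :
    HasDerivAt (fun l => σ (line e b l)) ⟪e, gradient σ (line e b l)⟫ l := by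
  have h1 : HasDerivAt (line e b) e l := ((((hasDerivAt_id l).sub_const (1 / 2)).smul_const
      e).const_add b |>.congr_deriv (one_smul ℝ e))
  have := (hσ.differentiable (line e b l)).hasFDerivAt.comp_hasDerivAt l h1
  rwa [hσ.fderiv_apply, real_inner_comm] at this

theorem integral_inner_gradient_line (hσ : IsFormFactor σ) (he : ‖e‖ = 1) (heb : ⟪e, b⟫ = 0) :
    ∫ x in (0 : ℝ)..1, ⟪e, gradient σ (line e b x)⟫ = 0 := by
  rw [intervalIntegral.integral_eq_sub_of_hasDerivAt
    (fun l _ => hasDerivAt_form_line (b := b) hσ l)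
    ((continuous_const.inner (continuous_gradient_line hσ)).intervalIntegrable _ _),
    hσ.eq_zero (half_le_norm_line he heb le_rfl), hσ.eq_zero, sub_zero]
  have h := half_le_norm_line (l := 1) (b := b) he heb le_rfl
  rwa [show ‖line e b 0‖ = ‖line e b 1‖ from ?_]
  have h0 : ∀ t : ℝ, ‖b + t • e‖ ^ 2 = ‖b‖ ^ 2 + t ^ 2 := fun t => by
    rw [norm_add_sq_real, real_inner_smul_right, real_inner_comm, heb, norm_smul, he]
    simp
  refine (sq_eq_sq₀ (norm_nonneg _) (norm_nonneg _)).1 ?_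
  rw [line, line, h0, h0]
  ring

theorem integral_mul_inner_gradient_line (hσ : IsFormFactor σ) (he : ‖e‖ = 1)
    (heb : ⟪e, b⟫ = 0) :
    ∫ x in (0 : ℝ)..1, (x - 1 / 2) * ⟪e, gradient σ (line e b x)⟫ = -L0 σ e b 1 := by
  have hs := continuous_form_line (e := e) (b := b) hσ
  have hD : Continuous fun x => ⟪e, gradient σ (line e b x)⟫ :=
    continuous_const.inner (continuous_gradient_line hσ)
  have h0 : σ (line e b 0) = σ (line e b 1) := by
    have h1 := intervalIntegral.integral_eq_sub_of_hasDerivAt (a := 0) (b := 1)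
      (fun l _ => hasDerivAt_form_line (e := e) (b := b) hσ l) (hD.intervalIntegrable _ _)
    rw [integral_inner_gradient_line hσ he heb] at h1
    linarith
  rw [intervalIntegral.integral_mul_deriv_eq_deriv_mul (u := fun x => x - 1 / 2)
    (u' := fun _ => 1)
    (fun l _ => (hasDerivAt_id l).sub_const (1 / 2))
    (fun l _ => hasDerivAt_form_line (b := b) hσ l)
    (continuous_const.intervalIntegrable _ _) (hD.intervalIntegrable _ _),
    h0, hσ.eq_zero (half_le_norm_line he heb le_rfl)]
  simp [L0, line]

/-- Since the gradient of the form factor is radial, the difference of the moments is a total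
derivative, which reduces it to `L₀` and its radial derivative. -/
theorem gradMoment_sub_gradMoment (hσ : IsFormFactor σ) (he : ‖e‖ = 1) (heb : ⟪e, b⟫ = 0) :
    gradMoment σ e b 1 0 - gradMoment σ e b 0 1
      = -(L0 σ e b 1 * ∫ l in (0 : ℝ)..1, ⟪b, gradient σ (line e b l)⟫) - L0 σ e b 1 ^ 2 := by
  have c0 : Continuous fun _ : ℝ => (1 : ℝ) := continuous_const
  have c1 : Continuous fun x : ℝ => x - 1 / 2 := by fun_prop
  have c2 : Continuous fun x : ℝ => (x - 1 / 2) ^ 2 := by fun_prop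
  have cx : Continuous fun x : ℝ => x := continuous_id
  have cx0 : Continuous fun x : ℝ => x ^ 0 := by fun_prop
  have cx1 : Continuous fun x : ℝ => x ^ 1 := by fun_prop
  set G : ℝ → Space d := fun l => gradient σ (line e b l) with hG
  have hGc : Continuous G := continuous_gradient_line hσ
  set J : (ℝ → ℝ) → ℝ → Space d := impulse σ e b with hJ
  have dJ : ∀ c : Space d, ∀ f : ℝ → ℝ, Continuous f → ∀ l,
      HasDerivAt (fun l => ⟪c, J f l⟫) (f l * ⟪c, G l⟫) l := by
    intro c f hf l
    refine ((innerSL ℝ c).hasFDerivAt.comp_hasDerivAt l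
      (hasDerivAt_impulse hσ hf l)).congr_deriv ?_
    rw [innerSL_apply_apply, real_inner_smul_right]
  -- moments with respect to the centred variable `l - 1/2`
  have e1 : ∀ l, J (fun x => x) l = J (fun x => x - 1 / 2) l + (1 / 2 : ℝ) • J (fun _ => 1) l := by
    intro l
    have : (fun x : ℝ => x - 1 / 2) = fun x => x - 1 / 2 * (1 : ℝ) := by simp
    rw [this, hJ, impulse_sub hσ cx (by fun_prop), impulse_const_mul]
    abel
  have e2 : ∀ l, J (fun x => x * x) l = J (fun x => (x - 1 / 2) ^ 2) l
      + J (fun x => x - 1 / 2) l + (1 / 4 : ℝ) • J (fun _ => 1) l := by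
    intro l
    have : (fun x : ℝ => (x - 1 / 2) ^ 2) = fun x => x * x - (x - 1 / 2 - -(1 / 4) * 1) := by
      funext x
      ring
    rw [this, hJ, impulse_sub hσ (by fun_prop) (by fun_prop), impulse_sub hσ c1 (by fun_prop),
      impulse_const_mul]
    module
  have hbJ : ∀ f g : ℝ → ℝ, Continuous f → Continuous g → (∀ x, f x = (x - 1 / 2) * g x) →
      ∀ l, ⟪b, J f l⟫ = ‖b‖ ^ 2 * ⟪e, J g l⟫ := by
    intro f g hf hg hfg l
    rw [hJ, inner_impulse hσ hf, inner_impulse hσ hg, ← intervalIntegral.integral_const_mul]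
    refine intervalIntegral.integral_congr fun x _ => ?_
    obtain ⟨k, hk⟩ := hσ.exists_gradient_eq_smul (line e b x)
    simp only [hfg]
    rw [inner_gradient_line_impact heb hk, inner_gradient_line_dir he heb hk]
    ring
  set Ψ : ℝ → ℝ := fun l => ⟪e, J (fun x => x - 1 / 2) l⟫ * ⟪b, J (fun _ => 1) l⟫
    - ‖b‖ ^ 2 * ⟪e, J (fun _ => 1) l⟫ ^ 2
    + ⟪e, J (fun x => (x - 1 / 2) ^ 2) l⟫ * ⟪e, J (fun _ => 1) l⟫
    - ⟪e, J (fun x => x - 1 / 2) l⟫ ^ 2 with hΨ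
  have hder : ∀ l, HasDerivAt Ψ (l ^ 1 * ⟪G l, deflection σ e b (fun x => x ^ 0) l⟫
      - l ^ 0 * ⟪G l, deflection σ e b (fun x => x ^ 1) l⟫) l := by
    intro l
    refine ((((dJ e _ c1 l).mul (dJ b _ c0 l)).sub (((dJ e _ c0 l).pow 2).const_mul (‖b‖ ^ 2))).add
      ((dJ e _ c2 l).mul (dJ e _ c0 l)) |>.sub ((dJ e _ c1 l).pow 2)).congr_deriv ?_
    obtain ⟨k, hk⟩ := hσ.exists_gradient_eq_smul (line e b l)
    have hD := inner_gradient_line_dir he heb hk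
    have hB := inner_gradient_line_impact heb hk
    simp only [deflection, pow_zero, pow_one, mul_one, one_mul]
    rw [← hJ, e1, e2, hG]
    simp only
    rw [hD, hB, hk, line, real_inner_smul_left, real_inner_smul_left, inner_add_left,
      inner_add_left, real_inner_smul_left, real_inner_smul_left]
    simp only [inner_sub_right, inner_add_right, real_inner_smul_right]
    rw [hbJ (fun x => x - 1 / 2) (fun _ => 1) c1 c0 (by simp),
      hbJ (fun x => (x - 1 / 2) ^ 2) (fun x => x - 1 / 2) c2 c1 (fun x => by ring)]
    norm_num
    ring
  have i1 : Continuous fun l => l ^ 1 * ⟪G l, deflection σ e b (fun x => x ^ 0) l⟫ :=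
    (continuous_pow 1).mul (continuous_inner_deflection hσ cx0)
  have i2 : Continuous fun l => l ^ 0 * ⟪G l, deflection σ e b (fun x => x ^ 1) l⟫ :=
    (continuous_pow 0).mul (continuous_inner_deflection hσ cx1)
  rw [gradMoment, gradMoment, ← intervalIntegral.integral_sub (i1.intervalIntegrable _ _)
    (i2.intervalIntegrable _ _), intervalIntegral.integral_eq_sub_of_hasDerivAt
    (fun l _ => hder l) ((i1.sub i2).intervalIntegrable _ _)]
  have hΨ0 : Ψ 0 = 0 := by simp [hΨ, hJ]
  have v0 : ⟪e, J (fun _ => 1) 1⟫ = 0 := by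
    rw [hJ, inner_impulse hσ c0]
    simpa using integral_inner_gradient_line hσ he heb
  have v1 : ⟪e, J (fun x => x - 1 / 2) 1⟫ = -L0 σ e b 1 := by
    rw [hJ, inner_impulse hσ c1]
    exact integral_mul_inner_gradient_line hσ he heb
  have v2 : ⟪b, J (fun _ => 1) 1⟫ = ∫ l in (0 : ℝ)..1, ⟪b, gradient σ (line e b l)⟫ := by
    rw [hJ, inner_impulse hσ c0]
    simp
  rw [hΨ0, hΨ]
  simp only
  rw [v0, v1, v2]
  ring

end Virial

/-! ### Continuity in the impact parameter -/

section Continuity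

variable {d : ℕ} {σ : Space d → ℝ} {e : Space d}

theorem continuous_line_uncurry : Continuous fun z : Space d × ℝ => line e z.1 z.2 := by
  unfold line
  fun_prop

theorem continuous_primitive {F : Type*} [NormedAddCommGroup F] [NormedSpace ℝ F]
    {f : Space d × ℝ → F} (hf : Continuous f) :
    Continuous fun z : Space d × ℝ => ∫ x in (0 : ℝ)..z.2, f (z.1, x) :=
  intervalIntegral.continuous_parametric_intervalIntegral_of_continuous
    (f := fun (z : Space d × ℝ) x => f (z.1, x)) (by fun_prop) continuous_snd

theorem continuous_integral_zero_one {F : Type*} [NormedAddCommGroup F] [NormedSpace ℝ F]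
    {f : Space d × ℝ → F} (hf : Continuous f) :
    Continuous fun b : Space d => ∫ x in (0 : ℝ)..1, f (b, x) :=
  (continuous_primitive hf).comp (continuous_id.prodMk continuous_const)

theorem continuous_form_line_uncurry (hσ : IsFormFactor σ) :
    Continuous fun z : Space d × ℝ => σ (line e z.1 z.2) :=
  hσ.continuous.comp continuous_line_uncurry

theorem continuous_gradient_line_uncurry (hσ : IsFormFactor σ) :
    Continuous fun z : Space d × ℝ => gradient σ (line e z.1 z.2) :=
  hσ.continuous_gradient.comp continuous_line_uncurry

theorem continuous_L0_one (hσ : IsFormFactor σ) : Continuous fun b => L0 σ e b 1 :=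
  continuous_integral_zero_one (continuous_form_line_uncurry hσ)

theorem continuous_formIntegral (hσ : IsFormFactor σ) : Continuous (formIntegral σ e) :=
  continuous_integral_zero_one ((continuous_form_line_uncurry hσ).mul (continuous_primitive
    (continuous_primitive (continuous_primitive (continuous_form_line_uncurry hσ)))))

theorem continuous_formMoment (hσ : IsFormFactor σ) (k : ℕ) :
    Continuous fun b => formMoment σ e b k :=
  continuous_integral_zero_one ((continuous_snd.pow k).mul (continuous_form_line_uncurry hσ))

theorem continuous_gradMoment (hσ : IsFormFactor σ) (j k : ℕ) :
    Continuous fun b => gradMoment σ e b j k := by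
  have hG := continuous_gradient_line_uncurry (e := e) hσ
  have hJ : ∀ f : ℝ → ℝ, Continuous f →
      Continuous fun z : Space d × ℝ => impulse σ e z.1 f z.2 := fun f hf =>
    continuous_primitive ((hf.comp continuous_snd).smul hG)
  have hD : Continuous fun z : Space d × ℝ => deflection σ e z.1 (fun x => x ^ k) z.2 :=
    (continuous_snd.smul (hJ _ (by fun_prop))).sub (hJ _ (by fun_prop))
  exact continuous_integral_zero_one ((continuous_snd.pow j).mul (hG.inner hD))

end Continuity

/-! ### Means over the impact parameter -/

/-- The divergence theorem for the vector field `g(x) x`. -/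
theorem integral_fderiv_self {E : Type*} [NormedAddCommGroup E] [InnerProductSpace ℝ E]
    [FiniteDimensional ℝ E] [MeasurableSpace E] [BorelSpace E] {g : E → ℝ}
    (hg : ContDiff ℝ 1 g) (hc : HasCompactSupport g) :
    ∫ x, fderiv ℝ g x x = -(Module.finrank ℝ E * ∫ x, g x) := by
  set v := stdOrthonormalBasis ℝ E with hv
  have hd : Differentiable ℝ g := hg.differentiable one_ne_zero
  have hf : Continuous (fderiv ℝ g) := hg.continuous_fderiv one_ne_zero
  have i0 : Integrable g := hg.continuous.integrable_of_hasCompactSupport hc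
  have i1 : ∀ i, Integrable fun x => ⟪v i, x⟫ * fderiv ℝ g x (v i) := fun i => by
    refine Continuous.integrable_of_hasCompactSupport (by fun_prop) ?_
    exact (hc.fderiv_apply (𝕜 := ℝ) (v i)).mul_left
  have i2 : ∀ i, Integrable fun x => ⟪v i, x⟫ * g x := fun i =>
    Continuous.integrable_of_hasCompactSupport (by fun_prop) hc.mul_left
  have hfd : ∀ i x, fderiv ℝ (fun x => ⟪v i, x⟫) x (v i) = 1 := fun i x => by
    have : HasFDerivAt (fun x => ⟪v i, x⟫) (innerSL ℝ (v i)) x := (innerSL ℝ (v i)).hasFDerivAt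
    rw [this.fderiv, innerSL_apply_apply, real_inner_self_eq_norm_sq, v.norm_eq_one, one_pow]
  have hi : ∀ i, ∫ x, ⟪v i, x⟫ * fderiv ℝ g x (v i) = -∫ x, g x := fun i => by
    rw [integral_mul_fderiv_eq_neg_fderiv_mul_of_integrable (by simpa only [hfd, one_mul] using i0)
      (i1 i) (i2 i) (fun x _ => (innerSL ℝ (v i)).differentiableAt) fun x _ => hd x]
    simp only [hfd, one_mul]
  calc ∫ x, fderiv ℝ g x x = ∫ x, ∑ i, ⟪v i, x⟫ * fderiv ℝ g x (v i) := by
        refine integral_congr_ae (ae_of_all _ fun x => ?_)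
        simp only
        conv_lhs => rw [← v.sum_repr' x]
        rw [map_sum]
        simp only [map_smul, smul_eq_mul, v.sum_repr']
    _ = ∑ _i : Fin (Module.finrank ℝ E), -∫ x, g x := by
        rw [integral_finsetSum _ fun i _ => i1 i]
        exact Finset.sum_congr rfl fun i _ => hi i
    _ = _ := by simp

section Impact

variable {d : ℕ} {σ : Space d → ℝ} {e p : Space d}

theorem hasFDerivAt_L0 (hσ : IsFormFactor σ) (b : Space d) :
    HasFDerivAt (fun b => L0 σ e b 1) (∫ l in (0 : ℝ)..1, fderiv ℝ σ (line e b l)) b := by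
  obtain ⟨S, -, -, hS, -⟩ := hσ.exists_bound
  have hf : Continuous (fderiv ℝ σ) := hσ.contDiff.continuous_fderiv two_ne_zero
  refine intervalIntegral.hasFDerivAt_integral_of_dominated_of_fderiv_le
    (F := fun b l => σ (line e b l)) (F' := fun b l => fderiv ℝ σ (line e b l))
    (bound := fun _ => S) univ_mem
    (Eventually.of_forall fun x => (continuous_form_line hσ).aestronglyMeasurable)
    ((continuous_form_line hσ).intervalIntegrable _ _)
    (hf.comp (continuous_line e b)).aestronglyMeasurable
    (ae_of_all _ fun t _ x _ => ?_) (continuous_const.intervalIntegrable _ _)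
    (ae_of_all _ fun t _ x _ => ?_)
  · rw [← (InnerProductSpace.toDual ℝ (Space d)).symm.norm_map]
    exact hS _
  · exact ((hσ.differentiable _).hasFDerivAt.comp x ((hasFDerivAt_id x).add_const _))

theorem contDiff_L0 (hσ : IsFormFactor σ) : ContDiff ℝ 1 fun b => L0 σ e b 1 := by
  rw [contDiff_one_iff_fderiv]
  refine ⟨fun b => (hasFDerivAt_L0 hσ b).differentiableAt, ?_⟩
  rw [show fderiv ℝ (fun b => L0 σ e b 1) = fun b => ∫ l in (0 : ℝ)..1, fderiv ℝ σ (line e b l)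
    from funext fun b => (hasFDerivAt_L0 hσ b).fderiv]
  exact continuous_integral_zero_one
    ((hσ.contDiff.continuous_fderiv two_ne_zero).comp continuous_line_uncurry)

theorem fderiv_L0_apply (hσ : IsFormFactor σ) (b c : Space d) :
    fderiv ℝ (fun b => L0 σ e b 1) b c
      = ∫ l in (0 : ℝ)..1, ⟪c, gradient σ (line e b l)⟫ := by
  have hf : Continuous fun l => fderiv ℝ σ (line e b l) :=
    (hσ.contDiff.continuous_fderiv two_ne_zero).comp (continuous_line e b)
  rw [(hasFDerivAt_L0 hσ b).fderiv,
    ContinuousLinearMap.intervalIntegral_apply (hf.intervalIntegrable _ _)]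
  refine intervalIntegral.integral_congr fun l _ => ?_
  rw [hσ.fderiv_apply, real_inner_comm]

theorem L0_eq_zero (hσ : IsFormFactor σ) {b : Space d} (heb : ⟪e, b⟫ = 0) (hb : 1 / 2 ≤ ‖b‖) :
    L0 σ e b 1 = 0 := by
  have : ∀ l, σ (line e b l) = 0 := fun l => by
    refine hσ.eq_zero (hb.trans ?_)
    refine (sq_le_sq₀ (norm_nonneg _) (norm_nonneg _)).1 ?_
    rw [line, norm_add_sq_real, real_inner_smul_right, real_inner_comm, heb]
    nlinarith [sq_nonneg ‖(l - 1 / 2) • e‖]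
  have h2 : L0 σ e b 1 = ∫ l in (0 : ℝ)..1, σ (line e b l) := rfl
  simp [h2, this]

theorem inner_coe_orthogonal (b : (Submodule.span ℝ {p})ᗮ) : ⟪p, (b : Space d)⟫ = 0 :=
  (Submodule.mem_orthogonal_singleton_iff_inner_right).1 b.2

instance isProbabilityMeasure_impactLaw : IsProbabilityMeasure (impactLaw p) := by
  have : IsProbabilityMeasure (ProbabilityTheory.cond
      (volume : Measure (Submodule.span ℝ {p})ᗮ) (Metric.closedBall 0 (1 / 2))) :=
    ProbabilityTheory.cond_isProbabilityMeasure_of_finite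
      (Metric.measure_closedBall_pos _ _ (by norm_num)).ne' measure_closedBall_lt_top.ne
  exact Measure.isProbabilityMeasure_map (by fun_prop)

theorem ae_impactLaw : ∀ᵐ b ∂(impactLaw p), ⟪p, b⟫ = 0 ∧ ‖b‖ ≤ 1 / 2 := by
  have hm : MeasurableSet {b : Space d | ⟪p, b⟫ = 0 ∧ ‖b‖ ≤ 1 / 2} :=
    ((isClosed_eq (by fun_prop) continuous_const).inter
      (isClosed_le continuous_norm continuous_const)).measurableSet
  rw [impactLaw, ae_map_iff (by fun_prop) hm]
  filter_upwards [ProbabilityTheory.ae_cond_mem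
    (μ := (volume : Measure (Submodule.span ℝ {p})ᗮ)) Metric.isClosed_closedBall.measurableSet]
    with b hb
  exact ⟨inner_coe_orthogonal b, by simpa using hb⟩

theorem integrable_impactLaw {f : Space d → ℝ} (hf : Continuous f) :
    Integrable f (impactLaw p) := by
  obtain ⟨c, hc⟩ := (isCompact_closedBall (0 : Space d) (1 / 2)).exists_bound_of_continuousOn
    hf.continuousOn
  refine Integrable.of_bound hf.aestronglyMeasurable c ?_
  filter_upwards [ae_impactLaw] with b hb
  exact hc b (by simpa using hb.2)

theorem integral_impactLaw {f : Space d → ℝ} (hf : Continuous f)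
    (h0 : ∀ b, ⟪p, b⟫ = 0 → 1 / 2 ≤ ‖b‖ → f b = 0) :
    ∫ b, f b ∂(impactLaw p)
      = ((volume (Metric.closedBall (0 : (Submodule.span ℝ {p})ᗮ) (1 / 2)))⁻¹).toReal
        * ∫ b : (Submodule.span ℝ {p})ᗮ, f b := by
  rw [impactLaw, integral_map (by fun_prop) hf.aestronglyMeasurable, ProbabilityTheory.cond,
    integral_smul_measure, smul_eq_mul, setIntegral_eq_integral_of_forall_compl_eq_zero]
  intro b hb
  refine h0 b (inner_coe_orthogonal b) ?_
  simp only [Metric.mem_closedBall, dist_zero_right, not_le] at hb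
  exact hb.le

/-- The mean of the difference of the moments. In the hyperplane of the impact parameters, of
dimension `d - 1`, the radial derivative of `L₀²` is integrated by parts. -/
theorem integral_gradMoment_sub (hσ : IsFormFactor σ) (hd : 2 ≤ d) (hp : p ≠ 0) :
    ∫ b, (gradMoment σ (dir p) b 1 0 - gradMoment σ (dir p) b 0 1) ∂(impactLaw p)
      = ((d : ℝ) - 3) / 2 * ∫ b, L0 σ (dir p) b 1 ^ 2 ∂(impactLaw p) := by
  set e := dir p with he
  have hen : ‖e‖ = 1 := norm_dir hp
  set V := (Submodule.span ℝ {p})ᗮ with hV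
  have hev : ∀ b : V, ⟪e, (b : Space d)⟫ = 0 := fun b => inner_dir (inner_coe_orthogonal b)
  have hdim : (Module.finrank ℝ V : ℝ) = d - 1 := by
    obtain ⟨n, rfl⟩ : ∃ n, d = n + 1 := ⟨d - 1, by omega⟩
    have : Fact (Module.finrank ℝ (Space (n + 1)) = n + 1) := ⟨by simp⟩
    rw [hV, Submodule.finrank_orthogonal_span_singleton (n := n) hp]
    push_cast
    ring
  set g : Space d → ℝ := fun b => L0 σ e b 1 ^ 2 with hg
  have hgc : ContDiff ℝ 1 g := (contDiff_L0 hσ).pow 2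
  have hgz : ∀ b, ⟪p, b⟫ = 0 → 1 / 2 ≤ ‖b‖ → g b = 0 := fun b hb hb' => by
    rw [hg]
    simp only
    rw [L0_eq_zero hσ (inner_dir hb) hb', zero_pow two_ne_zero]
  have hgd : ∀ b : V, fderiv ℝ (fun b : V => g b) b b
      = 2 * (L0 σ e b 1 * ∫ l in (0 : ℝ)..1, ⟪(b : Space d), gradient σ (line e b l)⟫) := by
    intro b
    have h1 := ((hasFDerivAt_L0 (e := e) hσ (b : Space d)).differentiableAt.hasFDerivAt.pow 2).comp
      b V.subtypeL.hasFDerivAt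
    have h2 : fderiv ℝ (fun b : V => g b) b = _ := h1.fderiv
    rw [h2, ← fderiv_L0_apply hσ]
    simp
    ring
  have hgcV : ContDiff ℝ 1 fun b : V => g b := hgc.comp V.subtypeL.contDiff
  have hgsV : HasCompactSupport fun b : V => g b :=
    HasCompactSupport.intro (isCompact_closedBall (0 : V) (1 / 2)) fun b hb => by
      simp only [Metric.mem_closedBall, dist_zero_right, not_le] at hb
      exact hgz b (inner_coe_orthogonal b) hb.le
  have hdiff : ∀ b : V, gradMoment σ e b 1 0 - gradMoment σ e b 0 1
      = -(1 / 2) * fderiv ℝ (fun b : V => g b) b b - g b := fun b => by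
    rw [gradMoment_sub_gradMoment hσ hen (hev b), hgd]
    ring
  have hi1 : Integrable fun b : V => fderiv ℝ (fun b : V => g b) b b := by
    refine Continuous.integrable_of_hasCompactSupport
      ((hgcV.continuous_fderiv one_ne_zero).clm_apply continuous_id) ?_
    exact (hgsV.fderiv (𝕜 := ℝ)).mono fun b hb h => hb (by simp [h])
  have hi2 : Integrable fun b : V => g b := hgcV.continuous.integrable_of_hasCompactSupport hgsV
  have hmc : Continuous fun b => gradMoment σ e b 1 0 - gradMoment σ e b 0 1 :=
    (continuous_gradMoment hσ 1 0).sub (continuous_gradMoment hσ 0 1)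
  rw [integral_impactLaw hmc (fun b hb hb' => by
      rw [gradMoment_sub_gradMoment hσ hen (inner_dir hb), L0_eq_zero hσ (inner_dir hb) hb']
      ring), integral_impactLaw hgc.continuous hgz]
  have : ∫ b : V, (gradMoment σ e b 1 0 - gradMoment σ e b 0 1)
      = ((d : ℝ) - 3) / 2 * ∫ b : V, g b := by
    simp only [hdiff]
    rw [integral_sub (hi1.const_mul _) hi2, integral_const_mul, integral_fderiv_self hgcV hgsV,
      hdim]
    ring
  rw [this]
  ring

end Impact

/-! ### Means of the coefficients -/

namespace HasMean

variable {d : ℕ} {law : Measure (Param d)} {f g : Param d → ℝ} {m n : ℝ}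

theorem congr (h : HasMean law f m) (hfg : f =ᵐ[law] g) : HasMean law g m :=
  ⟨h.1.congr hfg, (integral_congr_ae hfg).symm.trans h.2⟩

theorem add (hf : HasMean law f m) (hg : HasMean law g n) :
    HasMean law (fun κ => f κ + g κ) (m + n) :=
  ⟨hf.1.add hg.1, by rw [integral_add hf.1 hg.1, hf.2, hg.2]⟩

theorem const_mul (hf : HasMean law f m) (c : ℝ) : HasMean law (fun κ => c * f κ) (c * m) :=
  ⟨hf.1.const_mul c, by rw [integral_const_mul, hf.2]⟩

end HasMean

section Means

variable {d : ℕ} {σ : Space d → ℝ} {U : ℝ → ℝ} {M s : ℝ} {ρhat : ℝ → ℝ} {p : Space d}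

theorem ae_collisionLaw (hρ : IsStationaryDensity U M ρhat) :
    ∀ᵐ κ ∂(collisionLaw U M ρhat p), ⟪p, impact κ⟫ = 0 := by
  have := hρ.isProbabilityMeasure
  exact (Measure.quasiMeasurePreserving_fst (μ := impactLaw p)
    (ν := scattererLaw U M ρhat)).ae (ae_impactLaw.mono fun b hb => hb.1)

theorem hasMean_mul (hρ : IsStationaryDensity U M ρhat) (hU : Continuous U) {g : Space d → ℝ}
    (hg : Continuous g) {h : ℝ × ℝ → ℝ} (hh : Continuous h) :
    HasMean (collisionLaw U M ρhat p) (fun κ => g (impact κ) * h κ.2)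
      ((∫ b, g b ∂(impactLaw p)) * ∫ x, h x ∂(scattererLaw U M ρhat)) := by
  have := hρ.isProbabilityMeasure
  exact ⟨(integrable_impactLaw hg).mul_prod (hρ.integrable hU hh), integral_prod_mul g h⟩

theorem hasMean_impact (hρ : IsStationaryDensity U M ρhat) (hU : Continuous U) {g : Space d → ℝ}
    (hg : Continuous g) :
    HasMean (collisionLaw U M ρhat p) (fun κ => g (impact κ)) (∫ b, g b ∂(impactLaw p)) := by
  have := hρ.isProbabilityMeasure
  simpa using hasMean_mul (p := p) hρ hU hg (h := fun _ => 1) continuous_const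

theorem hasMean_scatterer (hρ : IsStationaryDensity U M ρhat) (hU : Continuous U)
    {h : ℝ × ℝ → ℝ} (hh : Continuous h) :
    HasMean (collisionLaw U M ρhat p) (fun κ => h κ.2) (∫ x, h x ∂(scattererLaw U M ρhat)) := by
  simpa using hasMean_mul (p := p) hρ hU (g := fun _ => 1) continuous_const hh

variable (hσ : IsFormFactor σ) (hρ : IsStationaryDensity U M ρhat) (hU : ContDiff ℝ ∞ U)
include hσ hρ hU

theorem hasMean_beta1_sq : HasMean (collisionLaw U M ρhat p) (fun κ => beta1 σ M (dir p) κ ^ 2)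
    (((√M)⁻¹) ^ 2 * ((∫ b, L0 σ (dir p) b 1 ^ 2 ∂(impactLaw p))
      * ∫ x, x.2 ^ 2 ∂(scattererLaw U M ρhat))) := by
  refine ((hasMean_mul hρ hU.continuous ((continuous_L0_one hσ).pow 2)
    (continuous_snd.pow 2)).const_mul (((√M)⁻¹) ^ 2)).congr (ae_of_all _ fun κ => ?_)
  simp only [beta1, mom, Pi.pow_apply]
  ring

variable (hconf : Tendsto U (cocompact ℝ) atTop) (hM : 0 < M)
include hconf hM

theorem hasMean_beta1 : HasMean (collisionLaw U M ρhat p) (beta1 σ M (dir p)) 0 := by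
  have h := (hasMean_mul (p := p) hρ hU.continuous (continuous_L0_one (e := dir p) hσ)
    continuous_snd).const_mul (√M)⁻¹
  rw [hρ.integral_momentum hU hconf hM, mul_zero, mul_zero] at h
  refine h.congr (ae_of_all _ fun κ => ?_)
  simp only [beta1, mom]
  ring

variable (hd : 2 ≤ d) (hp : p ≠ 0)
include hd hp

theorem hasMean_meanZeroA : HasMean (collisionLaw U M ρhat p)
    (fun κ => meanZeroA σ U M s (perp (impact κ)) κ) 0 := by
  have c1 := (contDiff_infty_iff_deriv.1 hU).2
  have c2 := (contDiff_infty_iff_deriv.1 c1).2.continuous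
  have h1 := (hasMean_mul (p := p) hρ hU.continuous (continuous_formMoment (e := dir p) hσ 1)
    (h := fun x => deriv U x.1) (c1.continuous.comp continuous_fst)).const_mul
      (-(1 / (√M * s ^ 2)))
  have h2 := (hasMean_mul (p := p) hρ hU.continuous (continuous_formMoment (e := dir p) hσ 2)
    (h := fun x => deriv (deriv U) x.1 * x.2)
    ((c2.comp continuous_fst).mul continuous_snd)).const_mul (-(1 / (2 * √M ^ 3 * s ^ 3)))
  rw [hρ.integral_force hU hconf hM] at h1
  rw [hρ.integral_stiffness_mul_momentum hU hconf hM] at h2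
  have h3 := h1.add h2
  rw [mul_zero, mul_zero, mul_zero, mul_zero, add_zero] at h3
  refine h3.congr ?_
  filter_upwards [ae_collisionLaw (p := p) hρ] with κ hκ
  have hn : ‖dir p‖ = ‖perp (impact κ)‖ := by rw [norm_dir hp, norm_perp hd]
  rw [meanZeroA, formMoment_eq hσ hn (inner_dir hκ) (inner_perp hd _),
    formMoment_eq hσ hn (inner_dir hκ) (inner_perp hd _), disp, mom]
  ring

theorem hasMean_meanZeroB : HasMean (collisionLaw U M ρhat p)
    (fun κ => meanZeroB σ s (perp (impact κ)) κ) 0 := by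
  have h := (hasMean_mul (p := p) hρ hU.continuous (continuous_gradMoment (e := dir p) hσ 0 0)
    (h := fun x => x.1 * x.2) (continuous_fst.mul continuous_snd)).const_mul (-(1 / s ^ 3))
  rw [hρ.integral_disp_mul_momentum hU hconf hM, mul_zero, mul_zero] at h
  refine h.congr ?_
  filter_upwards [ae_collisionLaw (p := p) hρ] with κ hκ
  have hn : ‖dir p‖ = ‖perp (impact κ)‖ := by rw [norm_dir hp, norm_perp hd]
  rw [meanZeroB, gradMoment_eq hσ hn (inner_dir hκ) (inner_perp hd _), disp, mom]
  ring

theorem hasMean_deltaBeta4 : HasMean (collisionLaw U M ρhat p)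
    (fun κ => deltaBeta4 σ U M (perp (impact κ)) κ)
    ((∫ x, deriv (deriv U) x.1 ∂(scattererLaw U M ρhat))
        * (∫ b, formIntegral σ (dir p) b ∂(impactLaw p)) / M
      + (∫ x, x.2 ^ 2 ∂(scattererLaw U M ρhat)) / M
        * (((d : ℝ) - 3) / 2 * ∫ b, L0 σ (dir p) b 1 ^ 2 ∂(impactLaw p))) := by
  have c1 := (contDiff_infty_iff_deriv.1 hU).2
  have c2 := (contDiff_infty_iff_deriv.1 c1).2.continuous
  have h1 := (hasMean_mul (p := p) hρ hU.continuous (continuous_formIntegral (e := dir p) hσ)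
    (h := fun x => deriv (deriv U) x.1) (c2.comp continuous_fst)).const_mul M⁻¹
  have h2 := hasMean_mul (p := p) hρ hU.continuous (continuous_gradMoment (e := dir p) hσ 1 0)
    (h := fun x => deriv U x.1 * x.1) ((c1.continuous.comp continuous_fst).mul continuous_fst)
  have h3 := (hasMean_mul (p := p) hρ hU.continuous (continuous_gradMoment (e := dir p) hσ 0 1)
    (h := fun x => x.2 ^ 2) (continuous_snd.pow 2)).const_mul (-M⁻¹)
  rw [hρ.integral_force_mul_disp hU hconf hM] at h2
  have h4 := (h1.add h2).add h3
  have h5 := integral_gradMoment_sub hσ hd hp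
  rw [integral_sub (integrable_impactLaw (continuous_gradMoment hσ 1 0))
    (integrable_impactLaw (continuous_gradMoment hσ 0 1))] at h5
  rw [← h5]
  convert h4.congr ?_ using 1
  · ring
  filter_upwards [ae_collisionLaw (p := p) hρ] with κ hκ
  have hn : ‖dir p‖ = ‖perp (impact κ)‖ := by rw [norm_dir hp, norm_perp hd]
  rw [deltaBeta4, gradMoment_eq hσ hn (inner_dir hκ) (inner_perp hd _),
    gradMoment_eq hσ hn (inner_dir hκ) (inner_perp hd _),
    formIntegral_eq hσ hn (inner_dir hκ) (inner_perp hd _), disp, mom]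
  ring

end Means

/-! ### The coefficients and the remainder -/

section Coefficients

variable {d : ℕ} {σ : Space d → ℝ} {U : ℝ → ℝ} {R C α M s : ℝ} {κ : Param d}

open Classical in
/-- The energy transfer of a collision with parameters `κ` of a particle of speed `s`; it does not
depend on the direction of incidence. The value is `0` if there is no such collision. -/
noncomputable def collisionEnergy (σ : Space d → ℝ) (U : ℝ → ℝ) (α M s : ℝ) (κ : Param d) : ℝ :=
  if h : ∃ x, ∃ p q v Q P T, ⟪p, impact κ⟫ = 0 ∧ ‖p‖ = s ∧ IsCollision σ U α M p κ q v Q P T ∧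
    energyTransfer σ α p q Q T = x then h.choose else 0

theorem IsCollision.energyTransfer_eq_collisionEnergy {p : Space d} {q v : ℝ → Space d}
    {Q P : ℝ → ℝ} {T : ℝ} (h : IsCollision σ U α M p κ q v Q P T) (hσ : IsFormFactor σ)
    (hU : ContDiff ℝ ∞ U) (hp : ⟪p, impact κ⟫ = 0) :
    energyTransfer σ α p q Q T = collisionEnergy σ U α M ‖p‖ κ := by
  have hex : ∃ x, ∃ p' q v Q P T, ⟪p', impact κ⟫ = 0 ∧ ‖p'‖ = ‖p‖ ∧
      IsCollision σ U α M p' κ q v Q P T ∧ energyTransfer σ α p' q Q T = x :=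
    ⟨_, p, q, v, Q, P, T, hp, rfl, h, rfl⟩
  rw [collisionEnergy, dif_pos hex]
  obtain ⟨p', q', v', Q', P', T', hp', hn, h', hx⟩ := hex.choose_spec
  rw [← hx]
  exact h.energyTransfer_eq_of_norm_eq hσ hU h' hp hp' hn.symm

/-- The pair `a` consists of the free parts of the coefficients in an expansion of the energy
transfer to second order in the coupling constant. -/
def IsFreePart (σ : Space d → ℝ) (U : ℝ → ℝ) (M s : ℝ) (κ : Param d) (a : ℝ × ℝ) : Prop :=
  ∃ K : ℝ, ∀ αs : ℝ, 0 < αs → αs * √M ≤ 1 →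
    |collisionEnergy σ U (αs * √M) M s κ - expansion σ U αs M s (perp (impact κ)) κ a.1 a.2|
      ≤ K * αs ^ 3

theorem eq_zero_of_forall_abs_le {u w K δ : ℝ} (hδ : 0 < δ)
    (h : ∀ x, 0 < x → x ≤ δ → |x * u + x ^ 2 * w| ≤ K * x ^ 3) : u = 0 ∧ w = 0 := by
  have hev : ∀ᶠ x in 𝓝[>] (0 : ℝ), 0 < x ∧ x ≤ δ := by
    filter_upwards [Ioc_mem_nhdsGT hδ] with x hx using hx
  have lim : ∀ f : ℝ → ℝ, Continuous f → Tendsto f (𝓝[>] 0) (𝓝 (f 0)) := fun f hf =>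
    (hf.tendsto 0).mono_left nhdsWithin_le_nhds
  have hu : |u| ≤ 0 := by
    have h1 := lim (fun x => |u + x * w|) (by fun_prop)
    have h2 := lim (fun x => K * x ^ 2) (by fun_prop)
    simp only [zero_mul, add_zero, ne_eq, OfNat.ofNat_ne_zero, not_false_eq_true, zero_pow,
      mul_zero] at h1 h2
    refine le_of_tendsto_of_tendsto h1 h2 ?_
    filter_upwards [hev] with x hx
    refine le_of_mul_le_mul_left ?_ hx.1
    have := h x hx.1 hx.2
    rw [show x * u + x ^ 2 * w = x * (u + x * w) by ring, abs_mul, abs_of_pos hx.1] at this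
    linarith
  have hu0 : u = 0 := abs_nonpos_iff.1 hu
  refine ⟨hu0, abs_nonpos_iff.1 ?_⟩
  have h2 := lim (fun x => K * x) (by fun_prop)
  simp only [mul_zero] at h2
  refine le_of_tendsto_of_tendsto tendsto_const_nhds h2 ?_
  filter_upwards [hev] with x hx
  have := h x hx.1 hx.2
  rw [hu0, mul_zero, zero_add, abs_mul, abs_of_pos (pow_pos hx.1 2)] at this
  refine le_of_mul_le_mul_left ?_ (pow_pos hx.1 2)
  linarith

theorem IsFreePart.unique {a a' : ℝ × ℝ} (hM : 1 ≤ M) (h : IsFreePart σ U M s κ a)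
    (h' : IsFreePart σ U M s κ a') : a = a' := by
  obtain ⟨K, hK⟩ := h
  obtain ⟨K', hK'⟩ := h'
  have hm : 0 < √M := Real.sqrt_pos.2 (by linarith)
  have := eq_zero_of_forall_abs_le (u := a.1 - a'.1) (w := a.2 - a'.2) (K := K + K')
    (one_div_pos.2 hm) fun x hx hx' => by
      have hx1 : x * √M ≤ 1 := (le_div_iff₀ hm).1 hx'
      have k1 := abs_le.1 (hK x hx hx1)
      have k2 := abs_le.1 (hK' x hx hx1)
      rw [expansion] at k1 k2
      exact abs_le.2 ⟨by linarith, by linarith⟩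
  exact Prod.ext (by linarith [this.1]) (by linarith [this.2])

open Classical in
/-- The free parts of the coefficients, where an expansion exists, and `0` elsewhere. They are
selected by the expansion itself, hence do not depend on the bounds used to prove it. -/
noncomputable def freePart (σ : Space d → ℝ) (U : ℝ → ℝ) (M s : ℝ) (κ : Param d) : ℝ × ℝ :=
  if h : ∃ a, IsFreePart σ U M s κ a then h.choose else 0

theorem IsFreePart.freePart_eq {a : ℝ × ℝ} (hM : 1 ≤ M) (h : IsFreePart σ U M s κ a) :
    freePart σ U M s κ = a := by
  rw [freePart, dif_pos ⟨a, h⟩]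
  exact (Exists.choose_spec (⟨a, h⟩ : ∃ a, IsFreePart σ U M s κ a)).unique hM h

/-- The difference of the energy transfer and its expansion. -/
noncomputable def remainder (σ : Space d → ℝ) (U : ℝ → ℝ) (αs M s : ℝ) (κ : Param d) : ℝ :=
  collisionEnergy σ U (αs * √M) M s κ - expansion σ U αs M s (perp (impact κ)) κ
    (freePart σ U M s κ).1 (freePart σ U M s κ).2

theorem freePart_bounds (hd : 2 ≤ d) (hσ : IsFormFactor σ) (hU : ContDiff ℝ ∞ U)
    (hC : IsBound σ U R C) (hM : 1 ≤ M) (hs : 32 * C ^ 2 ≤ s) (hκ : κ ∈ params d R M) :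
    |(freePart σ U M s κ).1| ≤ 60000 * C ^ 6 * (1 / (√M ^ 3 * s ^ 4)) ∧
      |(freePart σ U M s κ).2| ≤ 60000 * C ^ 6 * (1 / (√M * s ^ 5)) ∧
      ∀ αs : ℝ, 0 < αs → αs * √M ≤ 1 →
        |remainder σ U αs M s κ| ≤ 60000 * C ^ 6 * (αs ^ 3 * M) := by
  have hs0 : 0 ≤ s := le_trans (by positivity) hs
  have hn : ‖s • perp (impact κ)‖ = s := by
    rw [norm_smul, norm_perp hd, mul_one, Real.norm_of_nonneg hs0]
  have hin : ⟪s • perp (impact κ), impact κ⟫ = 0 := by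
    rw [real_inner_smul_left, inner_perp hd, mul_zero]
  obtain ⟨a, a', ha, ha', h⟩ :=
    exists_expansion hσ hU hC hM hs hκ (norm_perp hd (impact κ)) (inner_perp hd (impact κ))
  have h' : ∀ αs : ℝ, 0 < αs → αs * √M ≤ 1 →
      |collisionEnergy σ U (αs * √M) M s κ - expansion σ U αs M s (perp (impact κ)) κ a a'|
        ≤ 60000 * C ^ 6 * (αs ^ 3 * M) := by
    intro αs hαs hα1
    obtain ⟨-, -, -, -, -, q, v, Q, P, T, hcol, -⟩ :=
      exists_collision hσ hU hC (α := αs * √M) (by positivity) hM hκ hin (by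
        rw [hn, max_eq_left (Real.sqrt_le_one.2 hα1), mul_one]
        exact hs)
    have he := hcol.energyTransfer_eq_collisionEnergy hσ hU hin
    rw [hn] at he
    rw [← he]
    exact h αs hαs hα1 q v Q P T hcol
  have hfree : freePart σ U M s κ = (a, a') := IsFreePart.freePart_eq hM
    ⟨60000 * C ^ 6 * M, fun αs hαs hα1 => (h' αs hαs hα1).trans (le_of_eq (by ring))⟩
  simp only [remainder, hfree]
  exact ⟨ha, ha', h'⟩

theorem meanZeroA_bound {e : Space d} (hC : IsBound σ U R C) (hM : 1 ≤ M)
    (hs : 32 * C ^ 2 ≤ s) (hκ : κ ∈ params d R M) :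
    |meanZeroA σ U M s e κ| ≤ 60000 * C ^ 6 * (1 / (√M * s ^ 2)) := by
  have hC1 := hC.one_le
  have hs1 : 1 ≤ s := by nlinarith
  have hs0 : 0 < s := by linarith
  have hm1 : 1 ≤ √M := Real.one_le_sqrt.2 hM
  have hm0 : 0 < √M := by linarith
  obtain ⟨-, hQ, hP⟩ := hκ
  have hmoment : ∀ k, |formMoment σ e (impact κ) k| ≤ C := fun k => by
    refine abs_integral_zero_one_le fun l hl => ?_
    rw [abs_mul, abs_of_nonneg (pow_nonneg hl.1 k)]
    calc _ ≤ 1 * C := by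
          gcongr
          · exact pow_le_one₀ hl.1 hl.2
          · exact hC.form _
      _ = C := one_mul C
  have hP' : |mom κ| ≤ C * √M := by
    rw [div_le_iff₀ hm0] at hP
    exact hP.trans (by gcongr; linarith [hC.radius_le])
  have h1 := hC.force (disp κ) (by linarith)
  have h2 := hC.force_deriv (disp κ) (by linarith)
  have hC26 : C ^ 2 ≤ C ^ 6 := pow_le_pow_right₀ hC1 (by norm_num)
  have hC36 : C ^ 3 ≤ C ^ 6 := pow_le_pow_right₀ hC1 (by norm_num)
  rw [meanZeroA]
  calc _ ≤ C * C / (√M * s ^ 2) + C * (C * √M) * C / (2 * √M ^ 3 * s ^ 3) := by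
        refine (abs_sub _ _).trans (add_le_add ?_ ?_)
        · rw [abs_neg, abs_div, abs_mul, abs_of_pos (by positivity : 0 < √M * s ^ 2)]
          gcongr
          exact hmoment 1
        · rw [abs_div, abs_mul, abs_mul, abs_of_pos (by positivity : 0 < 2 * √M ^ 3 * s ^ 3)]
          gcongr
          exact hmoment 2
    _ = C ^ 2 * (1 / (√M * s ^ 2)) + C ^ 3 * (1 / (√M * s ^ 2)) * (1 / (2 * √M * s)) := by
        field_simp
    _ ≤ C ^ 6 * (1 / (√M * s ^ 2)) + C ^ 6 * (1 / (√M * s ^ 2)) * 1 := by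
        gcongr
        rw [div_le_one (by positivity)]
        nlinarith
    _ ≤ _ := by
        have : 0 ≤ C ^ 6 * (1 / (√M * s ^ 2)) := by positivity
        linarith

theorem meanZeroB_bound {e : Space d} (hσ : IsFormFactor σ) (hC : IsBound σ U R C) (hM : 1 ≤ M)
    (hs : 0 < s) (hκ : κ ∈ params d R M) :
    |meanZeroB σ s e κ| ≤ 60000 * C ^ 6 * (√M / s ^ 3) := by
  have hC1 := hC.one_le
  have hm0 : 0 < √M := Real.sqrt_pos.2 (by linarith)
  obtain ⟨-, hQ, hP⟩ := hκ
  have hP' : |mom κ| ≤ C * √M := by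
    rw [div_le_iff₀ hm0] at hP
    exact hP.trans (by gcongr; linarith [hC.radius_le])
  have hQ' : |disp κ| ≤ C := by linarith [hC.radius_le]
  have hC46 : C ^ 4 ≤ C ^ 6 := pow_le_pow_right₀ hC1 (by norm_num)
  rw [meanZeroB, abs_neg, abs_div, abs_mul, abs_mul, abs_of_pos (pow_pos hs 3)]
  calc _ ≤ C * √M * C * (64 * C ^ 2) / s ^ 3 := by
        gcongr
        exact abs_gradMoment_le hσ hC 0
    _ = 64 * C ^ 4 * (√M / s ^ 3) := by ring
    _ ≤ 60000 * C ^ 6 * (√M / s ^ 3) := by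
        gcongr
        norm_num

end Coefficients

end LorentzGas

open LorentzGas in
theorem proposition2p1 {d : ℕ} (hd : 2 ≤ d)
    (σ : Space d → ℝ) (hσ : ContDiff ℝ 2 σ)
    (hrad : ∀ x y : Space d, ‖x‖ = ‖y‖ → σ x = σ y)
    (hsupp : Function.support σ ⊆ Metric.closedBall 0 (1 / 2))
    (U : ℝ → ℝ) (hU : ContDiff ℝ ∞ U) (hconf : Tendsto U (cocompact ℝ) atTop) :
    -- the coefficient `δβ⁽⁴⁾(M, κ)`, the four error terms as functions of `(M, ‖p‖, κ)` and the
    -- remainder as a function of `(α_*, M, ‖p‖, κ)`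
    ∃ (δβ4 : ℝ → Param d → ℝ) (A₂ A₄ B₃ B₅ : ℝ → ℝ → Param d → ℝ)
      (r : ℝ → ℝ → ℝ → Param d → ℝ),
      (∀ R : ℝ, 0 < R → ∃ C s₀ : ℝ, 0 < C ∧ 0 < s₀ ∧
        -- the collision of a fast particle is well defined, and its energy transfer is expanded
        (∀ αs M : ℝ, 0 < αs → 1 ≤ M → ∀ p : Space d, ∀ κ ∈ params d R M, ⟪p, impact κ⟫ = 0 →
          s₀ * max 1 √(αs * √M) ≤ ‖p‖ →
            (∃ q v Q P T, IsCollision σ U (αs * √M) M p κ q v Q P T) ∧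
            ∀ q v Q P T, IsCollision σ U (αs * √M) M p κ q v Q P T →
              energyTransfer σ (αs * √M) p q Q T =
                αs * (beta1 σ M (dir p) κ / ‖p‖ + A₂ M ‖p‖ κ + A₄ M ‖p‖ κ)
                + αs ^ 2 * (deltaBeta2 σ (dir p) κ / ‖p‖ ^ 2 + B₃ M ‖p‖ κ
                    + δβ4 M κ / ‖p‖ ^ 4 + B₅ M ‖p‖ κ)
                + r αs M ‖p‖ κ) ∧
        -- the size of the error terms
        (∀ M s : ℝ, 1 ≤ M → s₀ ≤ s → ∀ κ ∈ params d R M,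
          |A₂ M s κ| ≤ C * (1 / (√M * s ^ 2)) ∧
          |A₄ M s κ| ≤ C * (1 / (√M ^ 3 * s ^ 4)) ∧
          |B₃ M s κ| ≤ C * (√M / s ^ 3) ∧
          |B₅ M s κ| ≤ C * (1 / (√M * s ^ 5))) ∧
        -- the remainder is `o(α_*² √M)` as `α = α_* √M` tends to `0`
        (∀ ε : ℝ, 0 < ε → ∃ δ : ℝ, 0 < δ ∧
          ∀ αs M s : ℝ, 0 < αs → 1 ≤ M → αs * √M ≤ δ → s₀ ≤ s → ∀ κ ∈ params d R M,
            |r αs M s κ| ≤ ε * (αs ^ 2 * √M))) ∧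
      -- the means
      (∀ (M : ℝ) (ρhat : ℝ → ℝ) (p : Space d), 1 ≤ M → p ≠ 0 → IsStationaryDensity U M ρhat →
        ∃ meanP2 meanU'' meanL2 meanF varBeta1 meanδβ4 : ℝ,
          HasMean (collisionLaw U M ρhat p) (fun κ => mom κ ^ 2) meanP2 ∧
          HasMean (collisionLaw U M ρhat p) (fun κ => deriv (deriv U) (disp κ)) meanU'' ∧
          HasMean (collisionLaw U M ρhat p) (fun κ => L0 σ (dir p) (impact κ) 1 ^ 2) meanL2 ∧
          HasMean (collisionLaw U M ρhat p) (fun κ => formIntegral σ (dir p) (impact κ)) meanF ∧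
          HasMean (collisionLaw U M ρhat p) (fun κ => beta1 σ M (dir p) κ ^ 2) varBeta1 ∧
          HasMean (collisionLaw U M ρhat p) (δβ4 M) meanδβ4 ∧
          HasMean (collisionLaw U M ρhat p) (A₂ M ‖p‖) 0 ∧
          HasMean (collisionLaw U M ρhat p) (B₃ M ‖p‖) 0 ∧
          HasMean (collisionLaw U M ρhat p) (beta1 σ M (dir p)) 0 ∧
          HasMean (collisionLaw U M ρhat p) (deltaBeta2 σ (dir p)) (-meanL2 / 2) ∧
          varBeta1 = meanP2 / M * meanL2 ∧
          (meanL2 ≠ 0 →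
            meanδβ4 = varBeta1 * (((d : ℝ) - 3) / 2 + meanU'' / meanP2 * (meanF / meanL2)))) := by
  have hf : IsFormFactor σ := ⟨hσ, hrad, hsupp⟩
  refine ⟨fun M κ => deltaBeta4 σ U M (perp (impact κ)) κ,
    fun M s κ => meanZeroA σ U M s (perp (impact κ)) κ, fun M s κ => (freePart σ U M s κ).1,
    fun M s κ => meanZeroB σ s (perp (impact κ)) κ, fun M s κ => (freePart σ U M s κ).2,
    remainder σ U, fun R hR => ?_, fun M ρhat p hM hp hρ => ?_⟩
  · obtain ⟨C, hC⟩ := exists_isBound hf hU hR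
    have hC1 := hC.one_le
    have hC0 : 0 < C := by linarith
    refine ⟨60000 * C ^ 6, 32 * C ^ 2, by positivity, by positivity, ?_, ?_, ?_⟩
    · intro αs M hαs hM p κ hκ hpb hp
      have hp0 : p ≠ 0 := norm_pos_iff.1 (lt_of_lt_of_le (by positivity) hp)
      refine ⟨?_, fun q v Q P T hcol => ?_⟩
      · obtain ⟨-, -, -, -, -, q, v, Q, P, T, hcol, -⟩ :=
          exists_collision hf hU hC (α := αs * √M) (by positivity) hM hκ hpb hp
        exact ⟨q, v, Q, P, T, hcol⟩
      · have hL : L0 σ (dir p) (impact κ) 1 = L0 σ (perp (impact κ)) (impact κ) 1 :=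
          L0_eq hf (by rw [norm_dir hp0, norm_perp hd]) (inner_perp hd _) (inner_dir hpb) 1
        rw [hcol.energyTransfer_eq_collisionEnergy hf hU hpb, remainder, expansion, beta1, beta1,
          deltaBeta2, deltaBeta2, hL]
        ring
    · intro M s hM hs κ hκ
      obtain ⟨h1, h2, -⟩ := freePart_bounds hd hf hU hC hM hs hκ
      exact ⟨meanZeroA_bound hC hM hs hκ, h1,
        meanZeroB_bound hf hC hM (lt_of_lt_of_le (by positivity) hs) hκ, h2⟩
    · intro ε hε
      refine ⟨min 1 (ε / (60000 * C ^ 6)), by positivity, fun αs M s hαs hM hδ hs κ hκ => ?_⟩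
      obtain ⟨-, -, h⟩ := freePart_bounds hd hf hU hC hM hs hκ
      refine (h αs hαs (hδ.trans (min_le_left _ _))).trans ?_
      have h1 : αs * √M * (60000 * C ^ 6) ≤ ε :=
        (le_div_iff₀ (by positivity)).1 (hδ.trans (min_le_right _ _))
      calc 60000 * C ^ 6 * (αs ^ 3 * M)
          = αs * √M * (60000 * C ^ 6) * (αs ^ 2 * √M) := by
            conv_lhs => rw [← Real.mul_self_sqrt (by linarith : 0 ≤ M)]
            ring
        _ ≤ ε * (αs ^ 2 * √M) := by gcongr
  · have hM0 : 0 < M := by linarith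
    have hc := hU.continuous
    have hU2 : Continuous (deriv (deriv U)) :=
      (contDiff_infty_iff_deriv.1 (contDiff_infty_iff_deriv.1 hU).2).2.continuous
    have hL2 := hasMean_impact (p := p) hρ hc ((continuous_L0_one (e := dir p) hf).pow 2)
    refine ⟨_, _, _, _, _, _, hasMean_scatterer hρ hc (continuous_snd.pow 2),
      hasMean_scatterer hρ hc (hU2.comp continuous_fst), hL2,
      hasMean_impact hρ hc (continuous_formIntegral hf), hasMean_beta1_sq hf hρ hU,
      hasMean_deltaBeta4 hf hρ hU hconf hM0 hd hp, hasMean_meanZeroA hf hρ hU hconf hM0 hd hp,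
      hasMean_meanZeroB hf hρ hU hconf hM0 hd hp, hasMean_beta1 hf hρ hU hconf hM0, ?_, ?_, ?_⟩
    · convert (hL2.const_mul (-(1 / 2))).congr (ae_of_all _ fun κ => ?_) using 1
      · simp only [Pi.pow_apply]
        ring
      · simp only [deltaBeta2, Pi.pow_apply]
        ring
    · rw [inv_pow, Real.sq_sqrt hM0.le]
      simp only [Pi.pow_apply]
      field_simp
    · intro h0
      have hP := hρ.integral_momentum_sq_ne_zero hc
      rw [inv_pow, Real.sq_sqrt hM0.le]
      simp only [Pi.pow_apply, Function.comp_apply] at h0 ⊢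
      field_simp
      ring
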